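/- Fix $T>0$ and a constant vector $\lambda\in\mathbb{R}^N$ (the market price of risk). A utility function is a strictly increasing, strictly concave function $U\in C^\infty(0,\infty)$ with $\lim_{x\downarrow 0}U'(x)=\infty$ and $\lim_{x\uparrow\infty}U'(x)=0$; its inverse marginal is $I=(U')^{(-1)}:(0,\infty)\to(0,\infty)$, and its risk tolerance coefficient is $R(x)=-U'(x)/U''(x)$ for $x>0$, $R(0)=0$. Call $U$ admissible if there are constants $C,\delta,c_1,c_2,C_1,C_2,C_3>0$ with $c_2>1$ (depending on $U$) such that for all $x>0$ $$I(x)\le C(1+x^{-\delta}),\qquad c_1I(x)\le|xI'(x)|\le C_1I(x),$$ $$c_2|I'(x)|\le xI''(x)\le C_2|I'(x)|,\qquad |xI'''(x)|\le C_3I''(x).$$ By a solution of Black's equation with terminal datum $R$ we mean a function $r:[0,\infty)\times[0,T]\to\mathbb{R}$ that is continuous on $[0,\infty)\times[0,T]$, whose derivatives $r_t,r_x,r_{xx}$ exist and are continuous on $(0,\infty)\times(0,T)$, and which satisfies $$r_t+\tfrac12|\lambda|^2r^2r_{xx}=0\ \text{ on }(0,\infty)\times(0,T),\qquad r(x,T)=R(x)\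 (x\ge0),\qquad r(0,t)=0\ (0\le t\le T).$$ Let $U_1,U_2$ be admissible utility functions with risk tolerance coefficients satisfying $R_1(x)\le R_2(x)$ for all $x\ge0$. If $r_1$ and $r_2$ are solutions of Black's equation with terminal data $R_1$ and $R_2$, respectively, then $r_1(x,t)\le r_2(x,t)$ for all $(x,t)\in[0,\infty)\times[0,T]$. In particular, for every admissible utility function, with risk tolerance coefficient $R$, any two solutions of Black's equation with terminal datum $R$ coincide on $[0,\infty)\times[0,T]$. -/

import Mathlib

open Set Filter Topology
open scoped ContDiff

/-- A utility function on `(0, ∞)`: strictly concave, strictly increasing, smooth, and satisfying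
the Inada conditions. Only the values of `U` on `(0, ∞)` matter. -/
structure IsUtility (U : ℝ → ℝ) : Prop where
  strictConcave : StrictConcaveOn ℝ (Ioi 0) U
  strictMono : StrictMonoOn U (Ioi 0)
  smooth : ContDiffOn ℝ ∞ U (Ioi 0)
  inada_zero : Tendsto (deriv U) (𝓝[>] 0) atTop
  inada_top : Tendsto (deriv U) atTop (𝓝 0)

/-- The inverse marginal `I = (U')⁻¹ : (0, ∞) → (0, ∞)`, the inverse of `U'` on `(0, ∞)`. -/
noncomputable def inverseMarginal (U : ℝ → ℝ) : ℝ → ℝ :=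
  Function.invFunOn (deriv U) (Ioi 0)

/-- The growth condition `I x ≤ C (1 + x ^ (-δ))` on `(0, ∞)`. -/
def GrowthBound (I : ℝ → ℝ) : Prop :=
  ∃ C δ : ℝ, 0 < C ∧ 0 < δ ∧ ∀ x : ℝ, 0 < x → I x ≤ C * (1 + x ^ (-δ))

/-- The condition on the first derivative: `c₁ I ≤ |x I'| ≤ C₁ I` on `(0, ∞)`. -/
def FirstDerivBound (I : ℝ → ℝ) : Prop :=
  ∃ c₁ C₁ : ℝ, 0 < c₁ ∧ 0 < C₁ ∧ ∀ x : ℝ, 0 < x →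
    c₁ * I x ≤ |x * deriv I x| ∧ |x * deriv I x| ≤ C₁ * I x

/-- The conditions on the second and third derivatives: `c₂ |I'| ≤ x I'' ≤ C₂ |I'|` with `c₂ > 1`,
and `|x I'''| ≤ C₃ I''`, on `(0, ∞)`. -/
def HigherDerivBound (I : ℝ → ℝ) : Prop :=
  ∃ c₂ C₂ C₃ : ℝ, 1 < c₂ ∧ 0 < C₂ ∧ 0 < C₃ ∧ ∀ x : ℝ, 0 < x →
    c₂ * |deriv I x| ≤ x * iteratedDeriv 2 I x ∧
    x * iteratedDeriv 2 I x ≤ C₂ * |deriv I x| ∧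
    |x * iteratedDeriv 3 I x| ≤ C₃ * iteratedDeriv 2 I x

/-- `U` is a utility function whose inverse marginal satisfies all the growth and derivative
conditions. -/
structure IsAdmissibleUtility (U : ℝ → ℝ) : Prop where
  isUtility : IsUtility U
  growth : GrowthBound (inverseMarginal U)
  first : FirstDerivBound (inverseMarginal U)
  higher : HigherDerivBound (inverseMarginal U)

/-- The (absolute) risk tolerance coefficient `R x = - U' x / U'' x` for `x > 0`, with `R 0 = 0`. -/
noncomputable def riskTolerance (U : ℝ → ℝ) (x : ℝ) : ℝ :=
  if 0 < x then -(deriv U x) / iteratedDeriv 2 U x else 0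

/-- `r` is a classical solution of Black's equation `r_t + (|lam|² / 2) r² r_xx = 0` on the
half-line, with terminal datum `R` at time `T` and with `r (0, t) = 0`: it is continuous on
`[0, ∞) × [0, T]`, its derivatives `r_t`, `r_x`, `r_xx` exist and are continuous on
`(0, ∞) × (0, T)`, and the equation holds there. -/
structure IsBlackSolution {N : ℕ} (lam : EuclideanSpace ℝ (Fin N)) (T : ℝ) (R : ℝ → ℝ)
    (r : ℝ → ℝ → ℝ) : Prop where
  continuousOn : ContinuousOn (fun p : ℝ × ℝ => r p.1 p.2) (Ici 0 ×ˢ Icc 0 T)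
  differentiable_time : ∀ x t : ℝ, 0 < x → t ∈ Ioo 0 T → DifferentiableAt ℝ (fun s => r x s) t
  contDiff_space : ∀ t ∈ Ioo 0 T, ContDiffOn ℝ 2 (fun y => r y t) (Ioi 0)
  continuousOn_time_deriv :
    ContinuousOn (fun p : ℝ × ℝ => deriv (fun s => r p.1 s) p.2) (Ioi 0 ×ˢ Ioo 0 T)
  continuousOn_space_deriv :
    ContinuousOn (fun p : ℝ × ℝ => deriv (fun y => r y p.2) p.1) (Ioi 0 ×ˢ Ioo 0 T)
  continuousOn_space_deriv_two :
    ContinuousOn (fun p : ℝ × ℝ => iteratedDeriv 2 (fun y => r y p.2) p.1) (Ioi 0 ×ˢ Ioo 0 T)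
  equation : ∀ x t : ℝ, 0 < x → t ∈ Ioo 0 T →
    deriv (fun s => r x s) t
      + 1 / 2 * ‖lam‖ ^ 2 * r x t ^ 2 * iteratedDeriv 2 (fun y => r y t) x = 0
  terminal : ∀ x : ℝ, 0 ≤ x → r x T = R x
  boundary : ∀ t ∈ Icc 0 T, r 0 t = 0

/-! Put `a = |λ|²/2` and reverse time. If `y = U'(x)` then `x = I(y)` and `R(x) = |y I'(y)|`, so the
first derivative condition on `I` gives `c x ≤ R(x) ≤ C x`. For `a > 0` a solution becomes a
positive flow `r_s = a r² r_xx` with `r(0, s) = 0` (`IsBlackSolution.isFlow`). Since nothing is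
assumed about growth as `x → ∞`, the main point is that the linear bounds persist in time
(`IsFlow.linearBounds`); comparison is then a weighted `L¹` argument (`IsFlow.le_of_initial_le`).

Persistence of `r ≤ C x`. As `(1/r)_s = -a r_xx`, there is a convex potential `V` with `V_xx = 1/r`
and `V_s = -a r`. Thus `V_s = -a / V_xx`, and this equation has a comparison principle
(`le_potential`). If the flow survives a further time `τ`, the average of `V` over that time,
corrected by a linear function, satisfies `Y Y'' ≥ k > 0`; this forces `V ≥ x (D √(log x) - K)`
(`exists_mul_sqrt_log_le_potential`). The function `V₀ - a C x s` is a subsolution, and a softplus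
correction pushes it below that growth at a far right edge. Hence `V ≥ V₀ - a C x s` for short
times: on average over `[0, s]`, `r` is at most `C x`. Comparing `V` with its time translates
upgrades this to `V(s + δ) ≥ V(s) - a C x δ`, and differentiation gives `r ≤ C x`. The bound `c x ≤
r` follows from the maximum principle, because `c x` is stationary. Restarting the flow extends both
bounds to its whole life.

Comparison. Kato's inequality controls the growth of `∫ φ (1/r₂ - 1/r₁)⁺` by boundary terms and `a ∫
φ'' (r₁ - r₂)⁺`. Since `r₁ r₂ ≤ C² x²`, a weight with `x² φ'' = 2 φ` closes a Grönwall estimate.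
Gluing `innerWeight` and `outerWeight` at `x = 1` makes the boundary terms `O(1/X)`, and they vanish
as `X → ∞`. -/

open MeasureTheory

/-! ### Parabolic maximum principle on a rectangle. -/

/-- Second-derivative necessary condition at an interior maximum. -/
theorem second_deriv_nonpos_of_isLocalMax {f f' : ℝ → ℝ} {x q : ℝ}
    (hmax : IsLocalMax f x) (hf : ∀ᶠ y in 𝓝 x, HasDerivAt f (f' y) y)
    (hf' : HasDerivAt f' q x) : q ≤ 0 := by
  by_contra hq
  push Not at hq
  have h0 : f' x = 0 := hmax.hasDerivAt_eq_zero hf.self_of_nhds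
  have hslope : ∀ᶠ y in 𝓝[>] x, 0 < f' y := by
    have h1 := hasDerivAt_iff_tendsto_slope.1 hf'
    have h2 : ∀ᶠ y in 𝓝[≠] x, 0 < slope f' x y := h1.eventually (lt_mem_nhds hq)
    have h3 : ∀ᶠ y in 𝓝[>] x, 0 < slope f' x y :=
      h2.filter_mono (nhdsWithin_mono _ fun y hy => ne_of_gt hy)
    filter_upwards [h3, self_mem_nhdsWithin] with y hy hxy
    rw [slope_def_field, h0, sub_zero] at hy
    have : 0 < y - x := sub_pos.2 hxy
    exact (div_pos_iff_of_pos_right this).1 hy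
  have hall : ∀ᶠ y in 𝓝[>] x, (0 < f' y ∧ HasDerivAt f (f' y) y) ∧ f y ≤ f x :=
    (hslope.and (hf.filter_mono nhdsWithin_le_nhds)).and (hmax.filter_mono nhdsWithin_le_nhds)
  obtain ⟨b, hb, hsub⟩ := mem_nhdsGT_iff_exists_Ioo_subset.1 hall
  have hxb : x < b := hb
  obtain ⟨y, hxy, hyb⟩ := exists_between hxb
  have hcont : ContinuousOn f (Icc x y) := by
    intro z hz
    rcases eq_or_lt_of_le hz.1 with h | h
    · rw [← h]; exact hf.self_of_nhds.continuousAt.continuousWithinAt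
    · exact (hsub ⟨h, lt_of_le_of_lt hz.2 hyb⟩).1.2.continuousAt.continuousWithinAt
  obtain ⟨z, hz, hz'⟩ := exists_hasDerivAt_eq_slope f f' hxy hcont
    (fun z hz => (hsub ⟨hz.1, hz.2.trans hyb⟩).1.2)
  have h1 : 0 < f' z := (hsub ⟨hz.1, hz.2.trans hyb⟩).1.1
  have h2 : f y ≤ f x := (hsub ⟨hxy, hyb⟩).2
  rw [hz'] at h1
  have := (div_pos_iff_of_pos_right (sub_pos.2 hxy)).1 h1
  linarith

/-- A weak parabolic maximum principle on a rectangle, with the differential inequality required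
only where the second space derivative is nonpositive. -/
theorem parabolic_maximum_principle {φ φx : ℝ → ℝ → ℝ} {α β S : ℝ}
    (hcont : ContinuousOn (fun p : ℝ × ℝ => φ p.1 p.2) (Icc α β ×ˢ Icc 0 S))
    (hx : ∀ s ∈ Ioc 0 S, ∀ x ∈ Ioo α β, HasDerivAt (fun y => φ y s) (φx x s) x)
    (hineq : ∀ s ∈ Ioc 0 S, ∀ x ∈ Ioo α β, ∃ p q : ℝ, HasDerivAt (fun σ => φ x σ) p s ∧
      HasDerivAt (fun y => φx y s) q x ∧ (q ≤ 0 → p ≤ 0))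
    (hinit : ∀ x ∈ Icc α β, φ x 0 ≤ 0)
    (hleft : ∀ s ∈ Icc 0 S, φ α s ≤ 0) (hright : ∀ s ∈ Icc 0 S, φ β s ≤ 0) :
    ∀ x ∈ Icc α β, ∀ s ∈ Icc 0 S, φ x s ≤ 0 := by
  -- The penalty `η * s` makes the contradiction strict: at a positive maximum the hypothesis gives
  -- `p ≤ 0`, while difference quotients in time give `p ≥ η`. Left quotients suffice, so the
  -- maximum may sit at the final time.
  have key : ∀ η > 0, ∀ x ∈ Icc α β, ∀ s ∈ Icc 0 S, φ x s - η * s ≤ 0 := by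
    intro η hη x hxm s hsm
    by_contra hpos
    push Not at hpos
    have hc : ContinuousOn (fun p : ℝ × ℝ => φ p.1 p.2 - η * p.2) (Icc α β ×ˢ Icc 0 S) :=
      hcont.sub (by fun_prop)
    obtain ⟨⟨y, t⟩, ⟨hy, ht⟩, hmax⟩ := (isCompact_Icc.prod isCompact_Icc).exists_isMaxOn
      ⟨(x, s), hxm, hsm⟩ hc
    simp only at hy ht
    have hm : ∀ x' ∈ Icc α β, ∀ s' ∈ Icc 0 S, φ x' s' - η * s' ≤ φ y t - η * t :=
      fun x' hx' s' hs' => hmax (mk_mem_prod hx' hs')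
    have hval : 0 < φ y t - η * t := lt_of_lt_of_le hpos (hm x hxm s hsm)
    have hηt : 0 ≤ η * t := mul_nonneg hη.le ht.1
    have ht0 : 0 < t := by
      rcases eq_or_lt_of_le ht.1 with h | h
      · have := hinit y hy
        rw [← h] at hval hηt
        linarith
      · exact h
    have hy1 : α < y := by
      rcases eq_or_lt_of_le hy.1 with h | h
      · have := hleft t ht
        rw [h] at this
        linarith
      · exact h
    have hy2 : y < β := by
      rcases eq_or_lt_of_le hy.2 with h | h
      · have := hright t ht
        rw [← h] at this
        linarith
      · exact h
    obtain ⟨p, q, hp, hq, hpq⟩ := hineq t ⟨ht0, ht.2⟩ y ⟨hy1, hy2⟩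
    have hq0 : q ≤ 0 := by
      refine second_deriv_nonpos_of_isLocalMax (f := fun y => φ y t) (f' := fun y => φx y t)
        (x := y) ?_ ?_ hq
      · filter_upwards [Ioo_mem_nhds hy1 hy2] with y' hy'
        have := hm y' ⟨hy'.1.le, hy'.2.le⟩ t ht
        linarith
      · filter_upwards [Ioo_mem_nhds hy1 hy2] with y' hy'
        exact hx t ⟨ht0, ht.2⟩ y' hy'
    have hp0 := hpq hq0
    have hder : HasDerivAt (fun σ => φ y σ - η * σ) (p - η) t := by
      simpa using hp.fun_sub ((hasDerivAt_id' t).const_mul η)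
    have : 0 ≤ p - η := by
      have h1 : Tendsto (slope (fun σ => φ y σ - η * σ) t) (𝓝[<] t) (𝓝 (p - η)) :=
        (hasDerivAt_iff_tendsto_slope.1 hder).mono_left
          (nhdsWithin_mono t fun y hy => ne_of_lt hy)
      refine ge_of_tendsto h1 ?_
      filter_upwards [Ioo_mem_nhdsLT ht0] with σ hσ
      rw [slope_def_field]
      have := hm y hy σ ⟨hσ.1.le, hσ.2.le.trans ht.2⟩
      exact div_nonneg_of_nonpos (by linarith) (by linarith [hσ.2])
    linarith
  intro x hxm s hsm
  by_contra hpos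
  push Not at hpos
  have hs : 0 ≤ s := hsm.1
  have := key (φ x s / (2 * (s + 1))) (by positivity) x hxm s hsm
  have h2 : φ x s / (2 * (s + 1)) * s ≤ φ x s / 2 := by
    rw [div_mul_eq_mul_div, div_le_div_iff₀ (by positivity) (by positivity)]
    nlinarith
  linarith

/-! ### Integrals depending on a parameter, for integrands continuous on a closed rectangle. -/

section Rectangle

variable {f : ℝ → ℝ → ℝ} {α β σ₀ σ₁ : ℝ}

/-- Clamping both coordinates to the rectangle. Results on parametric integrals of globally
continuous functions then apply to functions controlled only on the rectangle. -/
theorem exists_continuous_extension_rectangle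
    (h : ContinuousOn (fun p : ℝ × ℝ => f p.1 p.2) (uIcc α β ×ˢ uIcc σ₀ σ₁)) :
    ∃ g : ℝ → ℝ → ℝ, Continuous (fun p : ℝ × ℝ => g p.1 p.2) ∧
      ∀ x ∈ uIcc α β, ∀ s ∈ uIcc σ₀ σ₁, g x s = f x s := by
  refine ⟨fun x s => f (projIcc (α ⊓ β) (α ⊔ β) inf_le_sup x)
    (projIcc (σ₀ ⊓ σ₁) (σ₀ ⊔ σ₁) inf_le_sup s), ?_, ?_⟩
  · exact h.comp_continuous (f := fun p : ℝ × ℝ =>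
      ((projIcc (α ⊓ β) (α ⊔ β) inf_le_sup p.1 : ℝ),
        (projIcc (σ₀ ⊓ σ₁) (σ₀ ⊔ σ₁) inf_le_sup p.2 : ℝ)) ) (by fun_prop)
      (fun p => ⟨Subtype.coe_prop _, Subtype.coe_prop _⟩)
  · intro x hx s hs
    have h1 : (projIcc (α ⊓ β) (α ⊔ β) inf_le_sup x : ℝ) = x := by
      rw [projIcc_of_mem inf_le_sup hx]
    have h2 : (projIcc (σ₀ ⊓ σ₁) (σ₀ ⊔ σ₁) inf_le_sup s : ℝ) = s := by
      rw [projIcc_of_mem inf_le_sup hs]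
    simp only [h1, h2]

theorem continuousOn_integral_rectangle
    (h : ContinuousOn (fun p : ℝ × ℝ => f p.1 p.2) (uIcc α β ×ˢ uIcc σ₀ σ₁)) :
    ContinuousOn (fun s => ∫ x in α..β, f x s) (uIcc σ₀ σ₁) := by
  obtain ⟨g, hg, hfg⟩ := exists_continuous_extension_rectangle h
  have h1 : Continuous fun s => ∫ x in α..β, g x s :=
    intervalIntegral.continuous_parametric_intervalIntegral_of_continuous'
      (f := fun s x => g x s) (hg.comp continuous_swap) α β
  refine h1.continuousOn.congr fun s hs => ?_
  exact intervalIntegral.integral_congr fun x hx => (hfg x hx s hs).symm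

theorem integral_swap_rectangle
    (h : ContinuousOn (fun p : ℝ × ℝ => f p.1 p.2) (uIcc α β ×ˢ uIcc σ₀ σ₁)) :
    ∫ x in α..β, ∫ s in σ₀..σ₁, f x s = ∫ s in σ₀..σ₁, ∫ x in α..β, f x s := by
  obtain ⟨g, hg, hfg⟩ := exists_continuous_extension_rectangle h
  have e1 : ∫ x in α..β, ∫ s in σ₀..σ₁, f x s = ∫ x in α..β, ∫ s in σ₀..σ₁, g x s :=
    intervalIntegral.integral_congr fun x hx =>
      intervalIntegral.integral_congr fun s hs => (hfg x hx s hs).symm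
  have e2 : ∫ s in σ₀..σ₁, ∫ x in α..β, f x s = ∫ s in σ₀..σ₁, ∫ x in α..β, g x s :=
    intervalIntegral.integral_congr fun s hs =>
      intervalIntegral.integral_congr fun x hx => (hfg x hx s hs).symm
  rw [e1, e2]
  refine intervalIntegral_intervalIntegral_swap (IntegrableOn.mono_set ?_
    (prod_mono uIoc_subset_uIcc uIoc_subset_uIcc))
  exact hg.continuousOn.integrableOn_compact (isCompact_uIcc.prod isCompact_uIcc)

end Rectangle

/-! ### Second antiderivatives without derivatives. -/

/-- `g'' = f` on `(0, ∞)` in integrated form. In contrast with the pointwise form, this passes to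
limits and to integrals depending on a parameter. -/
def SecondAntideriv (g f : ℝ → ℝ) : Prop :=
  ∀ x > 0, g x = g 1 + (x - 1) * (g 2 - g 1 - ∫ ξ in (1 : ℝ)..2, (2 - ξ) * f ξ)
    + ∫ ξ in (1 : ℝ)..x, (x - ξ) * f ξ

/-- The first derivative of a function with `SecondAntideriv g f`. -/
noncomputable def antiderivSlope (g f : ℝ → ℝ) (x : ℝ) : ℝ :=
  (g 2 - g 1 - ∫ ξ in (1 : ℝ)..2, (2 - ξ) * f ξ) + ∫ ξ in (1 : ℝ)..x, f ξ

theorem uIcc_one_subset_Ioi {x : ℝ} (hx : 0 < x) : uIcc 1 x ⊆ Ioi 0 := by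
  intro y hy
  exact lt_of_lt_of_le (lt_min one_pos hx) hy.1

theorem ContinuousOn.intervalIntegrable_Ioi {f : ℝ → ℝ} (hf : ContinuousOn f (Ioi 0)) {x y : ℝ}
    (hx : 0 < x) (hy : 0 < y) : IntervalIntegrable f volume x y :=
  (hf.mono fun _ hz => lt_of_lt_of_le (lt_min hx hy) hz.1).intervalIntegrable

theorem hasDerivAt_integral_Ioi {f : ℝ → ℝ} (hf : ContinuousOn f (Ioi 0)) {x : ℝ} (hx : 0 < x) :
    HasDerivAt (fun y => ∫ ξ in (1 : ℝ)..y, f ξ) (f x) x :=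
  intervalIntegral.integral_hasDerivAt_right (hf.intervalIntegrable_Ioi one_pos hx)
    (hf.stronglyMeasurableAtFilter isOpen_Ioi x hx) (hf.continuousAt (Ioi_mem_nhds hx))

theorem SecondAntideriv.of_hasDerivAt {g g' f : ℝ → ℝ} (hg : ∀ x > 0, HasDerivAt g (g' x) x)
    (hg' : ∀ x > 0, HasDerivAt g' (f x) x) (hf : ContinuousOn f (Ioi 0)) :
    SecondAntideriv g f := by
  have key : ∀ x > 0, ∫ ξ in (1 : ℝ)..x, (x - ξ) * f ξ = g x - g 1 - (x - 1) * g' 1 := by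
    intro x hx
    have hd : ∀ ξ ∈ uIcc 1 x, HasDerivAt (fun ξ => (x - ξ) * g' ξ + g ξ) ((x - ξ) * f ξ) ξ := by
      intro ξ hξ
      have h0 := uIcc_one_subset_Ioi hx hξ
      have := (((hasDerivAt_id' ξ).const_sub x).fun_mul (hg' ξ h0)).fun_add (hg ξ h0)
      exact this.congr_deriv (by ring)
    rw [intervalIntegral.integral_eq_sub_of_hasDerivAt hd]
    · ring
    · have hc : ContinuousOn (fun ξ => (x - ξ) * f ξ) (Ioi 0) :=
        (by fun_prop : ContinuousOn (fun ξ => x - ξ) (Ioi 0)).mul hf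
      exact hc.intervalIntegrable_Ioi one_pos hx
  intro x hx
  rw [key x hx, key 2 two_pos]
  ring

theorem SecondAntideriv.hasDerivAt {g f : ℝ → ℝ} (h : SecondAntideriv g f)
    (hf : ContinuousOn f (Ioi 0)) {x : ℝ} (hx : 0 < x) :
    HasDerivAt g (antiderivSlope g f x) x := by
  have h1 := hasDerivAt_integral_Ioi hf hx
  have hc : ContinuousOn (fun ξ => ξ * f ξ) (Ioi 0) := continuousOn_id.mul hf
  have h2 := hasDerivAt_integral_Ioi hc hx
  set A := g 2 - g 1 - ∫ ξ in (1 : ℝ)..2, (2 - ξ) * f ξ with hA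
  have h3 : HasDerivAt (fun y => g 1 + (y - 1) * A + (y * (∫ ξ in (1 : ℝ)..y, f ξ)
      - ∫ ξ in (1 : ℝ)..y, ξ * f ξ)) (antiderivSlope g f x) x := by
    have := ((((hasDerivAt_id' x).sub_const 1).mul_const A).const_add (g 1)).fun_add
      (((hasDerivAt_id' x).fun_mul h1).fun_sub h2)
    refine this.congr_deriv ?_
    rw [antiderivSlope]
    ring
  refine h3.congr_of_eventuallyEq ?_
  filter_upwards [Ioi_mem_nhds hx] with y hy
  rw [h y hy]
  congr 1
  rw [← intervalIntegral.integral_const_mul, ← intervalIntegral.integral_sub]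
  · congr 1
    ext ξ
    ring
  · exact (hf.intervalIntegrable_Ioi one_pos hy).const_mul y
  · exact hc.intervalIntegrable_Ioi one_pos hy

theorem SecondAntideriv.hasDerivAt_slope {g f : ℝ → ℝ}
    (hf : ContinuousOn f (Ioi 0)) {x : ℝ} (hx : 0 < x) :
    HasDerivAt (antiderivSlope g f) (f x) x :=
  (hasDerivAt_integral_Ioi hf hx).const_add _

theorem SecondAntideriv.sub {g₁ f₁ g₂ f₂ : ℝ → ℝ} (h₁ : SecondAntideriv g₁ f₁)
    (h₂ : SecondAntideriv g₂ f₂) (hf₁ : ContinuousOn f₁ (Ioi 0)) (hf₂ : ContinuousOn f₂ (Ioi 0)) :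
    SecondAntideriv (fun x => g₁ x - g₂ x) (fun x => f₁ x - f₂ x) :=
  SecondAntideriv.of_hasDerivAt (fun _ hx => (h₁.hasDerivAt hf₁ hx).fun_sub (h₂.hasDerivAt hf₂ hx))
    (fun _ hx => (hasDerivAt_slope hf₁ hx).fun_sub (hasDerivAt_slope hf₂ hx)) (hf₁.sub hf₂)

/-- The slope at `1` is encoded by the values of `g` at `1` and `2`, so pointwise convergence of `g
i` is enough and no convergence of derivatives has to be shown. -/
theorem SecondAntideriv.of_tendsto {ι : Type*} {l : Filter ι} [l.NeBot] {g f : ι → ℝ → ℝ}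
    {G F : ℝ → ℝ} (h : ∀ᶠ i in l, SecondAntideriv (g i) (f i))
    (hg : ∀ x > 0, Tendsto (fun i => g i x) l (𝓝 (G x)))
    (hf : ∀ x > 0, Tendsto (fun i => ∫ ξ in (1 : ℝ)..x, (x - ξ) * f i ξ) l
      (𝓝 (∫ ξ in (1 : ℝ)..x, (x - ξ) * F ξ))) :
    SecondAntideriv G F := by
  intro x hx
  refine tendsto_nhds_unique (hg x hx) ?_
  have := ((hg 1 one_pos).add ((((hg 2 two_pos).sub (hg 1 one_pos)).sub
    (hf 2 two_pos)).const_mul (x - 1))).add (hf x hx)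
  refine this.congr' ?_
  filter_upwards [h] with i hi
  exact (hi x hx).symm

/-- The defining identity is linear in `(g, f)`; integrating it in `σ` and exchanging the integrals
avoids differentiation under the integral sign. -/
theorem SecondAntideriv.integral {g f : ℝ → ℝ → ℝ} {σ₀ σ₁ : ℝ}
    (h : ∀ σ ∈ uIcc σ₀ σ₁, SecondAntideriv (fun x => g x σ) (fun x => f x σ))
    (hg : ∀ x > 0, ContinuousOn (g x) (uIcc σ₀ σ₁))
    (hf : ContinuousOn (fun p : ℝ × ℝ => f p.1 p.2) (Ioi 0 ×ˢ uIcc σ₀ σ₁)) :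
    SecondAntideriv (fun x => ∫ σ in σ₀..σ₁, g x σ) (fun x => ∫ σ in σ₀..σ₁, f x σ) := by
  have hrect : ∀ x > 0, ContinuousOn (fun p : ℝ × ℝ => (x - p.1) * f p.1 p.2)
      (uIcc 1 x ×ˢ uIcc σ₀ σ₁) := fun x hx =>
    (by fun_prop : ContinuousOn (fun p : ℝ × ℝ => x - p.1) _).mul
      (hf.mono (prod_mono (uIcc_one_subset_Ioi hx) Subset.rfl))
  have hI : ∀ x > 0, IntervalIntegrable (g x) volume σ₀ σ₁ := fun x hx =>
    (hg x hx).intervalIntegrable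
  have hJ : ∀ x > 0, IntervalIntegrable (fun σ => ∫ ξ in (1 : ℝ)..x, (x - ξ) * f ξ σ)
      volume σ₀ σ₁ := fun x hx =>
    (continuousOn_integral_rectangle (f := fun ξ σ => (x - ξ) * f ξ σ) (hrect x hx)).intervalIntegrable
  have hs : ∀ x > 0, ∫ ξ in (1 : ℝ)..x, (x - ξ) * ∫ σ in σ₀..σ₁, f ξ σ
      = ∫ σ in σ₀..σ₁, ∫ ξ in (1 : ℝ)..x, (x - ξ) * f ξ σ := by
    intro x hx
    rw [← integral_swap_rectangle (f := fun ξ σ => (x - ξ) * f ξ σ) (hrect x hx)]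
    simp only [intervalIntegral.integral_const_mul]
  intro x hx
  rw [hs x hx, hs 2 two_pos]
  have e : ∫ σ in σ₀..σ₁, g x σ = ∫ σ in σ₀..σ₁, (g 1 σ + (x - 1) * (g 2 σ - g 1 σ
      - ∫ ξ in (1 : ℝ)..2, (2 - ξ) * f ξ σ) + ∫ ξ in (1 : ℝ)..x, (x - ξ) * f ξ σ) :=
    intervalIntegral.integral_congr fun σ hσ => h σ hσ x hx
  have i1 := hI 1 one_pos
  have i2 := hI 2 two_pos
  have j2 := hJ 2 two_pos
  have jx := hJ x hx
  beta_reduce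
  rw [e, intervalIntegral.integral_add (i1.add (((i2.sub i1).sub j2).const_mul _)) jx,
    intervalIntegral.integral_add i1 (((i2.sub i1).sub j2).const_mul _),
    intervalIntegral.integral_const_mul, intervalIntegral.integral_sub (i2.sub i1) j2,
    intervalIntegral.integral_sub i2 i1]

/-! ### Flows, linear bounds, and the potential of the initial datum. -/

/-- A positive classical solution of `r_s = a r² r_xx` on `(0, ∞) × [0, S)` vanishing at `x = 0`,
together with its space derivatives. -/
structure IsFlow (a S : ℝ) (r rx rxx : ℝ → ℝ → ℝ) : Prop where
  continuousOn : ContinuousOn (fun p : ℝ × ℝ => r p.1 p.2) (Ici 0 ×ˢ Ico 0 S)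
  zero : ∀ s ∈ Ico 0 S, r 0 s = 0
  pos : ∀ x > 0, ∀ s ∈ Ico 0 S, 0 < r x s
  hasDerivAt : ∀ x > 0, ∀ s ∈ Ioo 0 S, HasDerivAt (fun y => r y s) (rx x s) x
  hasDerivAt_two : ∀ x > 0, ∀ s ∈ Ioo 0 S, HasDerivAt (fun y => rx y s) (rxx x s) x
  hasDerivAt_time : ∀ x > 0, ∀ s ∈ Ioo 0 S,
    HasDerivAt (fun σ => r x σ) (a * r x s ^ 2 * rxx x s) s
  continuousOn_two : ContinuousOn (fun p : ℝ × ℝ => rxx p.1 p.2) (Ioi 0 ×ˢ Ioo 0 S)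

/-- `R` is continuous on `(0, ∞)` and lies between two linear functions. -/
structure LinearBounds (c C : ℝ) (R : ℝ → ℝ) : Prop where
  pos : 0 < c
  continuousOn : ContinuousOn R (Ioi 0)
  lower : ∀ x > 0, c * x ≤ R x
  upper : ∀ x > 0, R x ≤ C * x

/-- `∫₁ˣ 1 / R`. -/
noncomputable def reciprocalIntegral (R : ℝ → ℝ) (x : ℝ) : ℝ := ∫ ξ in (1 : ℝ)..x, (R ξ)⁻¹

/-- `∫₀ˣ ξ / R`. -/
noncomputable def reciprocalMoment (R : ℝ → ℝ) (x : ℝ) : ℝ := ∫ ξ in (0 : ℝ)..x, ξ * (R ξ)⁻¹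

/-- The second antiderivative of `1 / R` vanishing at `0` and with zero slope at `1`. -/
noncomputable def initialPotential (R : ℝ → ℝ) (x : ℝ) : ℝ :=
  x * reciprocalIntegral R x - reciprocalMoment R x

namespace LinearBounds

variable {c C : ℝ} {R : ℝ → ℝ}

theorem R_pos (h : LinearBounds c C R) {x : ℝ} (hx : 0 < x) : 0 < R x :=
  lt_of_lt_of_le (mul_pos h.pos hx) (h.lower x hx)

theorem upper_pos (h : LinearBounds c C R) : 0 < C := by
  have := (h.R_pos one_pos).trans_le (h.upper 1 one_pos)
  linarith

theorem continuousOn_inv (h : LinearBounds c C R) : ContinuousOn (fun x => (R x)⁻¹) (Ioi 0) :=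
  h.continuousOn.inv₀ fun _ hx => (h.R_pos hx).ne'

theorem mul_inv_le (h : LinearBounds c C R) {x : ℝ} (hx : 0 < x) : x * (R x)⁻¹ ≤ 1 / c := by
  have := h.lower x hx
  have h1 := h.pos
  have h2 := h.R_pos hx
  rw [← div_eq_mul_inv, div_le_div_iff₀ h2 h1]
  linarith

theorem le_mul_inv (h : LinearBounds c C R) {x : ℝ} (hx : 0 < x) : 1 / C ≤ x * (R x)⁻¹ := by
  have := h.upper x hx
  have h1 := h.upper_pos
  have h2 := h.R_pos hx
  rw [← div_eq_mul_inv, div_le_div_iff₀ h1 h2]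
  linarith

theorem mul_inv_nonneg (h : LinearBounds c C R) {x : ℝ} (hx : 0 < x) : 0 ≤ x * (R x)⁻¹ :=
  mul_nonneg hx.le (inv_nonneg.2 (h.R_pos hx).le)

theorem hasDerivAt_reciprocalIntegral (h : LinearBounds c C R) {x : ℝ} (hx : 0 < x) :
    HasDerivAt (reciprocalIntegral R) (R x)⁻¹ x :=
  hasDerivAt_integral_Ioi h.continuousOn_inv hx

theorem continuousOn_mul_inv (h : LinearBounds c C R) :
    ContinuousOn (fun x => x * (R x)⁻¹) (Ioi 0) := continuousOn_id.mul h.continuousOn_inv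

/-- The lower bound `c * x ≤ R x` makes `ξ / R` bounded near `0`, where `1 / R` itself is not
integrable. For this reason the first integral in `initialPotential` starts at `1` and the second at
`0`. -/
theorem intervalIntegrable_mul_inv (h : LinearBounds c C R) {x : ℝ} (hx : 0 < x) :
    IntervalIntegrable (fun ξ => ξ * (R ξ)⁻¹) volume 0 x := by
  rw [intervalIntegrable_iff_integrableOn_Ioc_of_le hx.le]
  refine Integrable.of_bound (C := 1 / c) ?_ ?_
  · exact (h.continuousOn_mul_inv.mono fun y hy => hy.1).aestronglyMeasurable measurableSet_Ioc
  · refine (ae_restrict_mem measurableSet_Ioc).mono fun y hy => ?_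
    rw [Real.norm_of_nonneg (h.mul_inv_nonneg hy.1)]
    exact h.mul_inv_le hy.1

theorem hasDerivAt_reciprocalMoment (h : LinearBounds c C R) {x : ℝ} (hx : 0 < x) :
    HasDerivAt (reciprocalMoment R) (x * (R x)⁻¹) x :=
  intervalIntegral.integral_hasDerivAt_right (h.intervalIntegrable_mul_inv hx)
    (h.continuousOn_mul_inv.stronglyMeasurableAtFilter isOpen_Ioi x hx)
    (h.continuousOn_mul_inv.continuousAt (Ioi_mem_nhds hx))

theorem reciprocalMoment_nonneg (h : LinearBounds c C R) {x : ℝ} (hx : 0 < x) :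
    0 ≤ reciprocalMoment R x := by
  refine intervalIntegral.integral_nonneg_of_ae_restrict hx.le ?_
  refine (ae_restrict_mem measurableSet_Icc).mono fun y hy => ?_
  rcases eq_or_lt_of_le hy.1 with h0 | h0
  · simp [← h0]
  · exact h.mul_inv_nonneg h0

theorem reciprocalMoment_le (h : LinearBounds c C R) {x : ℝ} (hx : 0 < x) :
    reciprocalMoment R x ≤ x / c := by
  have : reciprocalMoment R x ≤ ∫ _ in (0 : ℝ)..x, 1 / c := by
    refine intervalIntegral.integral_mono_on hx.le (h.intervalIntegrable_mul_inv hx)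
      intervalIntegrable_const fun y hy => ?_
    rcases eq_or_lt_of_le hy.1 with h0 | h0
    · have := h.pos
      rw [← h0, zero_mul]; positivity
    · exact h.mul_inv_le h0
  rw [intervalIntegral.integral_const, smul_eq_mul, sub_zero] at this
  linarith [mul_one_div x c]

theorem hasDerivAt_initialPotential (h : LinearBounds c C R) {x : ℝ} (hx : 0 < x) :
    HasDerivAt (initialPotential R) (reciprocalIntegral R x) x := by
  have := ((hasDerivAt_id' x).fun_mul (h.hasDerivAt_reciprocalIntegral hx)).fun_sub
    (h.hasDerivAt_reciprocalMoment hx)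
  exact this.congr_deriv (by ring)

theorem monotoneOn_reciprocalIntegral (h : LinearBounds c C R) :
    MonotoneOn (reciprocalIntegral R) (Ioi 0) := by
  refine monotoneOn_of_deriv_nonneg (convex_Ioi 0)
    (fun x hx => (h.hasDerivAt_reciprocalIntegral hx).continuousAt.continuousWithinAt) ?_ ?_
  · rw [interior_Ioi]
    exact fun x hx => (h.hasDerivAt_reciprocalIntegral hx).differentiableAt.differentiableWithinAt
  · rw [interior_Ioi]
    intro x hx
    rw [(h.hasDerivAt_reciprocalIntegral hx).deriv]
    exact inv_nonneg.2 (h.R_pos hx).le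

/-- The potential is convex with zero slope at `1`, so its minimum is its value at `1`, which is
minus the moment `∫₀¹ ξ / R ≤ 1 / c`. -/
theorem neg_inv_le_initialPotential (h : LinearBounds c C R) {x : ℝ} (hx : 0 < x) :
    -(1 / c) ≤ initialPotential R x := by
  have h1 : initialPotential R 1 ≥ -(1 / c) := by
    have := h.reciprocalMoment_le one_pos
    simp only [initialPotential, reciprocalIntegral, intervalIntegral.integral_same]
    linarith
  have hy1 : reciprocalIntegral R 1 = 0 := intervalIntegral.integral_same
  refine h1.le.trans ?_
  have hd := fun y (hy : 0 < y) => h.hasDerivAt_initialPotential hy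
  rcases lt_trichotomy x 1 with hlt | heq | hgt
  · obtain ⟨z, hz, he⟩ := exists_hasDerivAt_eq_slope (initialPotential R) (reciprocalIntegral R) hlt
      (fun y hy => (hd y (hx.trans_le hy.1)).continuousAt.continuousWithinAt)
      (fun y hy => hd y (hx.trans hy.1))
    have := h.monotoneOn_reciprocalIntegral (hx.trans hz.1) (mem_Ioi.2 one_pos) hz.2.le
    rw [hy1, he, div_le_iff₀ (by linarith)] at this
    linarith
  · rw [heq]
  · obtain ⟨z, hz, he⟩ := exists_hasDerivAt_eq_slope (initialPotential R) (reciprocalIntegral R) hgt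
      (fun y hy => (hd y (one_pos.trans_le hy.1)).continuousAt.continuousWithinAt)
      (fun y hy => hd y (one_pos.trans hy.1))
    have := h.monotoneOn_reciprocalIntegral (mem_Ioi.2 one_pos) (one_pos.trans hz.1) hz.1.le
    rw [hy1, he, le_div_iff₀ (by linarith)] at this
    linarith

theorem log_div_le_reciprocalIntegral (h : LinearBounds c C R) {x : ℝ} (hx : 1 ≤ x) :
    Real.log x / C ≤ reciprocalIntegral R x := by
  have hx0 : 0 < x := one_pos.trans_le hx
  have e : Real.log x / C = ∫ ξ in (1 : ℝ)..x, C⁻¹ * ξ⁻¹ := by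
    rw [intervalIntegral.integral_const_mul, integral_inv_of_pos one_pos hx0, div_one]
    ring
  rw [e]
  refine intervalIntegral.integral_mono_on hx ?_
    (h.continuousOn_inv.intervalIntegrable_Ioi one_pos hx0) fun y hy => ?_
  · exact ContinuousOn.intervalIntegrable_Ioi
      (continuousOn_const.mul (continuousOn_inv₀.mono fun y hy => ne_of_gt hy)) one_pos hx0
  · have hy0 : 0 < y := one_pos.trans_le hy.1
    rw [← mul_inv]
    exact inv_anti₀ (h.R_pos hy0) (h.upper y hy0)

theorem reciprocalIntegral_le_log_div (h : LinearBounds c C R) {x : ℝ} (hx : 1 ≤ x) :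
    reciprocalIntegral R x ≤ Real.log x / c := by
  have hx0 : 0 < x := one_pos.trans_le hx
  have e : Real.log x / c = ∫ ξ in (1 : ℝ)..x, c⁻¹ * ξ⁻¹ := by
    rw [intervalIntegral.integral_const_mul, integral_inv_of_pos one_pos hx0, div_one]
    ring
  rw [e]
  refine intervalIntegral.integral_mono_on hx
    (h.continuousOn_inv.intervalIntegrable_Ioi one_pos hx0) ?_ fun y hy => ?_
  · exact ContinuousOn.intervalIntegrable_Ioi
      (continuousOn_const.mul (continuousOn_inv₀.mono fun y hy => ne_of_gt hy)) one_pos hx0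
  · have hy0 : 0 < y := one_pos.trans_le hy.1
    rw [← mul_inv]
    exact inv_anti₀ (mul_pos h.pos hy0) (h.lower y hy0)

theorem initialPotential_le (h : LinearBounds c C R) {x : ℝ} (hx : 1 ≤ x) :
    initialPotential R x ≤ x * (Real.log x / c) := by
  have hx0 : 0 < x := one_pos.trans_le hx
  have h1 := h.reciprocalMoment_nonneg hx0
  have h2 := mul_le_mul_of_nonneg_left (h.reciprocalIntegral_le_log_div hx) hx0.le
  rw [initialPotential]
  linarith

/-- Superlinear growth of the initial potential; it later absorbs linear error terms at a distant
right edge. -/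
theorem le_initialPotential (h : LinearBounds c C R) {x : ℝ} (hx : 1 ≤ x) :
    x * (Real.log x / C - 1 / c) ≤ initialPotential R x := by
  have hx0 : 0 < x := one_pos.trans_le hx
  have h1 := h.reciprocalMoment_le hx0
  have h2 := mul_le_mul_of_nonneg_left (h.log_div_le_reciprocalIntegral hx) hx0.le
  rw [initialPotential, mul_sub, mul_one_div]
  linarith

/-- The left side is the numerator of the derivative of `initialPotential R x / x`, the quotient on
which the barrier below is built. -/
theorem initialPotential_eq_sub (R : ℝ → ℝ) (x : ℝ) :
    x * reciprocalIntegral R x - initialPotential R x = reciprocalMoment R x := by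
  rw [initialPotential]; ring

end LinearBounds

/-! ### The potential of a flow. -/

/-- The convex potential `V` of a flow: `V_xx = 1 / r` and `V_s = -a r`. -/
noncomputable def potential (a : ℝ) (r : ℝ → ℝ → ℝ) (x s : ℝ) : ℝ :=
  initialPotential (fun y => r y 0) x - a * ∫ σ in (0 : ℝ)..s, r x σ

theorem potential_zero (a : ℝ) (r : ℝ → ℝ → ℝ) (x : ℝ) :
    potential a r x 0 = initialPotential (fun y => r y 0) x := by
  simp [potential]

namespace IsFlow

variable {a S c C : ℝ} {r rx rxx : ℝ → ℝ → ℝ}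

theorem continuousOn_inv (h : IsFlow a S r rx rxx) :
    ContinuousOn (fun p : ℝ × ℝ => (r p.1 p.2)⁻¹) (Ioi 0 ×ˢ Ico 0 S) :=
  (h.continuousOn.mono (prod_mono Ioi_subset_Ici_self Subset.rfl)).inv₀
    fun p hp => (h.pos p.1 hp.1 p.2 hp.2).ne'

theorem continuousOn_space_inv (h : IsFlow a S r rx rxx) {s : ℝ} (hs : s ∈ Ico 0 S) :
    ContinuousOn (fun x => (r x s)⁻¹) (Ioi 0) :=
  h.continuousOn_inv.comp (f := fun x => (x, s)) (by fun_prop) fun _ hx => ⟨hx, hs⟩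

theorem continuousOn_time (h : IsFlow a S r rx rxx) {x : ℝ} (hx : 0 ≤ x) :
    ContinuousOn (fun s => r x s) (Ico 0 S) :=
  h.continuousOn.comp (f := fun s => (x, s)) (by fun_prop) fun _ hs => ⟨hx, hs⟩

theorem continuousOn_space (h : IsFlow a S r rx rxx) {s : ℝ} (hs : s ∈ Ico 0 S) :
    ContinuousOn (fun x => r x s) (Ici 0) :=
  h.continuousOn.comp (f := fun x => (x, s)) (by fun_prop) fun _ hx => ⟨hx, hs⟩

theorem nonneg (h : IsFlow a S r rx rxx) {x s : ℝ} (hx : 0 ≤ x) (hs : s ∈ Ico 0 S) : 0 ≤ r x s := by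
  rcases eq_or_lt_of_le hx with h0 | h0
  · rw [← h0, h.zero s hs]
  · exact (h.pos x h0 s hs).le

theorem uIcc_subset {s t : ℝ} (hs : s ∈ Ico 0 S) (ht : t ∈ Ico 0 S) : uIcc s t ⊆ Ico 0 S :=
  ordConnected_Ico.uIcc_subset hs ht

theorem intervalIntegrable_time (h : IsFlow a S r rx rxx) {x s t : ℝ} (hx : 0 ≤ x)
    (hs : s ∈ Ico 0 S) (ht : t ∈ Ico 0 S) : IntervalIntegrable (fun σ => r x σ) volume s t :=
  ((h.continuousOn_time hx).mono (uIcc_subset hs ht)).intervalIntegrable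

/-- Restarting a flow at a later time. -/
theorem shift (h : IsFlow a S r rx rxx) {s₀ : ℝ} (hs₀ : s₀ ∈ Ico 0 S) :
    IsFlow a (S - s₀) (fun x s => r x (s₀ + s)) (fun x s => rx x (s₀ + s))
      (fun x s => rxx x (s₀ + s)) := by
  have hIco : ∀ s ∈ Ico 0 (S - s₀), s₀ + s ∈ Ico 0 S := fun s hs =>
    ⟨add_nonneg hs₀.1 hs.1, by linarith [hs.2]⟩
  have hIoo : ∀ s ∈ Ioo 0 (S - s₀), s₀ + s ∈ Ioo 0 S := fun s hs =>
    ⟨add_pos_of_nonneg_of_pos hs₀.1 hs.1, by linarith [hs.2]⟩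
  refine ⟨?_, fun s hs => h.zero _ (hIco s hs), fun x hx s hs => h.pos x hx _ (hIco s hs),
    fun x hx s hs => h.hasDerivAt x hx _ (hIoo s hs),
    fun x hx s hs => h.hasDerivAt_two x hx _ (hIoo s hs), ?_, ?_⟩
  · exact h.continuousOn.comp (f := fun p : ℝ × ℝ => (p.1, s₀ + p.2)) (by fun_prop)
      fun p hp => ⟨hp.1, hIco _ hp.2⟩
  · exact fun x hx s hs => (h.hasDerivAt_time x hx _ (hIoo s hs)).comp_const_add s₀ s
  · exact h.continuousOn_two.comp (f := fun p : ℝ × ℝ => (p.1, s₀ + p.2)) (by fun_prop)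
      fun p hp => ⟨hp.1, hIoo _ hp.2⟩

/-- Passing to `1 / r` removes the factor `r²`: the right side becomes an exact second space
derivative. This is what makes both the potential and the `L¹` argument possible. -/
theorem hasDerivAt_inv_time (h : IsFlow a S r rx rxx) {x s : ℝ} (hx : 0 < x) (hs : s ∈ Ioo 0 S) :
    HasDerivAt (fun σ => (r x σ)⁻¹) (-(a * rxx x s)) s := by
  have hp := (h.pos x hx s (Ioo_subset_Ico_self hs)).ne'
  refine ((h.hasDerivAt_time x hx s hs).inv hp).congr_deriv ?_
  field_simp

theorem integral_two (h : IsFlow a S r rx rxx) {x s t : ℝ} (hx : 0 < x) (hs : s ∈ Ioo 0 S)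
    (ht : t ∈ Ioo 0 S) : ∫ σ in s..t, a * rxx x σ = (r x s)⁻¹ - (r x t)⁻¹ := by
  have hsub : uIcc s t ⊆ Ioo 0 S := ordConnected_Ioo.uIcc_subset hs ht
  have := intervalIntegral.integral_eq_sub_of_hasDerivAt
    (f := fun σ => -(r x σ)⁻¹) (f' := fun σ => a * rxx x σ) (a := s) (b := t) ?_ ?_
  · rw [this]; ring
  · intro σ hσ
    exact (h.hasDerivAt_inv_time hx (hsub hσ)).fun_neg.congr_deriv (by ring)
  · refine ContinuousOn.intervalIntegrable (continuousOn_const.mul ?_)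
    exact h.continuousOn_two.comp (f := fun σ => (x, σ)) (by fun_prop)
      fun σ hσ => ⟨hx, hsub hσ⟩

theorem secondAntideriv_integral (h : IsFlow a S r rx rxx) {s t : ℝ} (hs : s ∈ Ioo 0 S)
    (ht : t ∈ Ioo 0 S) : SecondAntideriv (fun x => a * ∫ σ in s..t, r x σ)
      (fun x => (r x s)⁻¹ - (r x t)⁻¹) := by
  have hsub : uIcc s t ⊆ Ioo 0 S := ordConnected_Ioo.uIcc_subset hs ht
  have h1 : SecondAntideriv (fun x => ∫ σ in s..t, a * r x σ)
      (fun x => ∫ σ in s..t, a * rxx x σ) := by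
    refine SecondAntideriv.integral (g := fun x σ => a * r x σ) (f := fun x σ => a * rxx x σ)
      ?_ ?_ ?_
    · intro σ hσ
      refine SecondAntideriv.of_hasDerivAt
        (fun x hx => (h.hasDerivAt x hx σ (hsub hσ)).const_mul a)
        (fun x hx => (h.hasDerivAt_two x hx σ (hsub hσ)).const_mul a)
        (continuousOn_const.mul ?_)
      exact h.continuousOn_two.comp (f := fun x => (x, σ)) (by fun_prop)
        fun x hx => ⟨hx, hsub hσ⟩
    · intro x hx
      exact continuousOn_const.mul ((h.continuousOn_time hx.le).mono
        (hsub.trans Ioo_subset_Ico_self))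
    · exact continuousOn_const.mul (h.continuousOn_two.mono (prod_mono Subset.rfl hsub))
  intro x hx
  have h2 := h1 x hx
  simp only [intervalIntegral.integral_const_mul] at h2 ⊢
  rw [h2]
  have e : ∀ y > 0, ∫ ξ in (1 : ℝ)..y, (y - ξ) * (a * ∫ σ in s..t, rxx ξ σ)
      = ∫ ξ in (1 : ℝ)..y, (y - ξ) * ((r ξ s)⁻¹ - (r ξ t)⁻¹) := by
    intro y hy
    refine intervalIntegral.integral_congr fun ξ hξ => ?_
    simp only [← intervalIntegral.integral_const_mul]
    rw [intervalIntegral.integral_const_mul, h.integral_two (uIcc_one_subset_Ioi hy hξ) hs ht]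
  rw [e x hx, e 2 two_pos]

theorem secondAntideriv_initialPotential (h₀ : LinearBounds c C (fun y => r y 0)) :
    SecondAntideriv (initialPotential (fun y => r y 0)) (fun x => (r x 0)⁻¹) :=
  SecondAntideriv.of_hasDerivAt (fun _ hx => h₀.hasDerivAt_initialPotential hx)
    (fun _ hx => h₀.hasDerivAt_reciprocalIntegral hx) h₀.continuousOn_inv

/-- Control of `r_xx` is available only for `s > 0`, so the time integral is started at `ε` and then
`ε → 0`. Continuity of `r` up to `s = 0` is all the limit needs, thanks to the integrated form. -/
theorem secondAntideriv_potential (h : IsFlow a S r rx rxx)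
    (h₀ : LinearBounds c C (fun y => r y 0)) {s : ℝ} (hs : s ∈ Ico 0 S) :
    SecondAntideriv (fun x => potential a r x s) (fun x => (r x s)⁻¹) := by
  rcases eq_or_lt_of_le hs.1 with rfl | hs0
  · simp only [potential_zero]
    exact secondAntideriv_initialPotential h₀
  have hS : 0 < S := hs0.trans hs.2
  have hz : (0 : ℝ) ∈ Ico 0 S := ⟨le_rfl, hS⟩
  have hsub := uIcc_subset hz hs
  have hle : 𝓝[>] (0 : ℝ) ≤ 𝓝[uIcc 0 s] 0 := by
    rw [uIcc_of_le hs0.le]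
    exact nhdsWithin_le_of_mem (mem_of_superset (Ioo_mem_nhdsGT hs0) Ioo_subset_Icc_self)
  refine SecondAntideriv.of_tendsto (l := 𝓝[>] (0 : ℝ))
    (g := fun ε x => initialPotential (fun y => r y 0) x - a * ∫ σ in ε..s, r x σ)
    (f := fun ε x => (r x 0)⁻¹ - ((r x ε)⁻¹ - (r x s)⁻¹)) ?_ ?_ ?_
  · filter_upwards [Ioo_mem_nhdsGT hs0] with ε hε
    have hεS : ε ∈ Ioo 0 S := ⟨hε.1, hε.2.trans hs.2⟩
    exact (secondAntideriv_initialPotential h₀).sub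
      (h.secondAntideriv_integral hεS ⟨hs0, hs.2⟩) h₀.continuousOn_inv
      ((h.continuousOn_space_inv (Ioo_subset_Ico_self hεS)).sub (h.continuousOn_space_inv hs))
  · intro x hx
    refine Tendsto.const_sub _ (Tendsto.const_mul a ?_)
    have hc : ContinuousOn (fun ε => ∫ σ in (0 : ℝ)..ε, r x σ) (uIcc 0 s) :=
      intervalIntegral.continuousOn_primitive_interval
        (((h.continuousOn_time hx.le).mono hsub).integrableOn_compact isCompact_uIcc)
    have ht := ((hc 0 left_mem_uIcc).mono_left hle).const_sub (∫ σ in (0 : ℝ)..s, r x σ)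
    beta_reduce at ht
    rw [intervalIntegral.integral_same, sub_zero] at ht
    refine ht.congr' ?_
    filter_upwards [Ioo_mem_nhdsGT hs0] with ε hε
    rw [intervalIntegral.integral_interval_sub_left (h.intervalIntegrable_time hx.le hz hs)
      (h.intervalIntegrable_time hx.le hz ⟨hε.1.le, hε.2.trans hs.2⟩)]
  · intro x hx
    have hF := h.continuousOn_inv
    have hc : ContinuousOn (fun p : ℝ × ℝ =>
        (x - p.1) * ((r p.1 0)⁻¹ - ((r p.1 p.2)⁻¹ - (r p.1 s)⁻¹))) (uIcc 1 x ×ˢ uIcc 0 s) := by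
      have hm : ∀ t ∈ Ico 0 S, ContinuousOn (fun p : ℝ × ℝ => (r p.1 t)⁻¹)
          (uIcc 1 x ×ˢ uIcc 0 s) := fun t ht =>
        (h.continuousOn_space_inv ht).comp continuousOn_fst
          fun p hp => uIcc_one_subset_Ioi hx hp.1
      exact (by fun_prop : ContinuousOn (fun p : ℝ × ℝ => x - p.1) _).mul
        ((hm 0 hz).sub ((hF.mono (prod_mono (uIcc_one_subset_Ioi hx) hsub)).sub (hm s hs)))
    have := continuousOn_integral_rectangle
      (f := fun ξ ε => (x - ξ) * ((r ξ 0)⁻¹ - ((r ξ ε)⁻¹ - (r ξ s)⁻¹))) hc 0 left_mem_uIcc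
    have := this.mono_left hle
    simpa using this

theorem hasDerivAt_potential_time (h : IsFlow a S r rx rxx) {x s : ℝ} (hx : 0 < x)
    (hs : s ∈ Ioo 0 S) : HasDerivAt (fun σ => potential a r x σ) (-(a * r x s)) s := by
  have hz : (0 : ℝ) ∈ Ico 0 S := ⟨le_rfl, hs.1.trans hs.2⟩
  have hc : ContinuousOn (fun σ => r x σ) (Ioo 0 S) :=
    (h.continuousOn_time hx.le).mono Ioo_subset_Ico_self
  exact ((intervalIntegral.integral_hasDerivAt_right
    (h.intervalIntegrable_time hx.le hz (Ioo_subset_Ico_self hs))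
    (hc.stronglyMeasurableAtFilter isOpen_Ioo s hs)
    (hc.continuousAt (Ioo_mem_nhds hs.1 hs.2))).const_mul a).const_sub _

theorem potential_sub (h : IsFlow a S r rx rxx) {x s t : ℝ} (hx : 0 ≤ x)
    (hs : s ∈ Ico 0 S) (ht : t ∈ Ico 0 S) :
    potential a r x s - potential a r x t = a * ∫ σ in s..t, r x σ := by
  have hz : (0 : ℝ) ∈ Ico 0 S := ⟨le_rfl, hs.1.trans_lt hs.2⟩
  rw [potential, potential, ← intervalIntegral.integral_interval_sub_left
    (h.intervalIntegrable_time hx hz ht) (h.intervalIntegrable_time hx hz hs)]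
  ring

theorem potential_antitone (h : IsFlow a S r rx rxx) (ha : 0 ≤ a) {x s t : ℝ} (hx : 0 ≤ x)
    (hs : s ∈ Ico 0 S) (ht : t ∈ Ico 0 S) (hst : s ≤ t) :
    potential a r x t ≤ potential a r x s := by
  have h1 := h.potential_sub hx hs ht
  have h2 : 0 ≤ ∫ σ in s..t, r x σ :=
    intervalIntegral.integral_nonneg hst fun σ hσ =>
      h.nonneg hx ⟨hs.1.trans hσ.1, hσ.2.trans_lt ht.2⟩
  have := mul_nonneg ha h2
  linarith

theorem continuousOn_potential (h : IsFlow a S r rx rxx)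
    (h₀ : LinearBounds c C (fun y => r y 0)) {α β s : ℝ} (hα : 0 < α) (hαβ : α ≤ β)
    (hs : s ∈ Ico 0 S) :
    ContinuousOn (fun p : ℝ × ℝ => potential a r p.1 p.2) (Icc α β ×ˢ Icc 0 s) := by
  have hz : (0 : ℝ) ∈ Ico 0 S := ⟨le_rfl, hs.1.trans_lt hs.2⟩
  obtain ⟨g, hg, hgr⟩ := exists_continuous_extension_rectangle (f := r) (α := α) (β := β)
    (σ₀ := 0) (σ₁ := s) (h.continuousOn.mono (prod_mono (by
      rw [uIcc_of_le hαβ]; exact fun y hy => hα.le.trans hy.1) (uIcc_subset hz hs)))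
  rw [uIcc_of_le hαβ, uIcc_of_le hs.1] at hgr
  have h1 : Continuous fun p : ℝ × ℝ => ∫ σ in (0 : ℝ)..p.2, g p.1 σ :=
    intervalIntegral.continuous_parametric_intervalIntegral_of_continuous
      (f := fun (p : ℝ × ℝ) σ => g p.1 σ) (by
        exact hg.comp (f := fun q : (ℝ × ℝ) × ℝ => (q.1.1, q.2)) (by fun_prop)) continuous_snd
  have h2 : ContinuousOn (fun p : ℝ × ℝ => initialPotential (fun y => r y 0) p.1)
      (Icc α β ×ˢ Icc 0 s) := by
    have : ContinuousOn (initialPotential (fun y => r y 0)) (Ioi 0) := fun x hx =>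
      (h₀.hasDerivAt_initialPotential hx).continuousAt.continuousWithinAt
    exact this.comp continuousOn_fst fun p hp => hα.trans_le hp.1.1
  refine (h2.sub (h1.continuousOn.const_mul a)).congr fun p hp => ?_
  simp only [potential]
  congr 2
  refine intervalIntegral.integral_congr fun σ hσ => ?_
  rw [uIcc_of_le hp.2.1] at hσ
  exact (hgr p.1 hp.1 σ ⟨hσ.1, hσ.2.trans hp.2.2⟩).symm

end IsFlow

/-! ### Survival of the flow forces growth of the potential. -/

theorem le_of_hasDerivAt_nonneg {f f' : ℝ → ℝ} {b : ℝ} (hf : ∀ x ≥ b, HasDerivAt f (f' x) x)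
    (hf' : ∀ x ≥ b, 0 ≤ f' x) {x : ℝ} (hx : b ≤ x) : f b ≤ f x := by
  refine monotoneOn_of_deriv_nonneg (convex_Ici b)
    (fun x hx => (hf x hx).continuousAt.continuousWithinAt) ?_ ?_ (mem_Ici.2 le_rfl) hx hx
  · rw [interior_Ici]
    exact fun x hx => (hf x (le_of_lt hx)).differentiableAt.differentiableWithinAt
  · rw [interior_Ici]
    intro x hx
    rw [(hf x (le_of_lt hx)).deriv]
    exact hf' x (le_of_lt hx)

/-- A positive increasing solution of `Y Y'' ≥ k` grows at least like `x √(2 k log x)`. -/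
theorem exists_mul_sqrt_log_le {Y Y' Y'' : ℝ → ℝ} {k : ℝ} (hk : 0 < k)
    (hY : ∀ x ≥ 1, HasDerivAt Y (Y' x) x) (hY' : ∀ x ≥ 1, HasDerivAt Y' (Y'' x) x)
    (hpos : ∀ x ≥ 1, 0 < Y x) (h1 : 0 < Y' 1) (hode : ∀ x ≥ 1, k ≤ Y x * Y'' x) :
    ∃ K, ∀ x ≥ 1, x * (√(2 * k) * √(Real.log x) - K) ≤ Y x := by
  have hY2 : ∀ x ≥ 1, 0 < Y'' x := fun x hx =>
    pos_of_mul_pos_right (hk.trans_le (hode x hx)) (hpos x hx).le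
  have hmono : ∀ x ≥ 1, Y' 1 ≤ Y' x := fun x hx =>
    le_of_hasDerivAt_nonneg hY' (fun y hy => (hY2 y hy).le) hx
  have hY1 := hpos 1 le_rfl
  set m := min (Y 1) (Y' 1) with hm
  have hm0 : 0 < m := lt_min hY1 h1
  have hlin : ∀ x ≥ 1, m * x ≤ Y x := by
    intro x hx
    have := le_of_hasDerivAt_nonneg (f := fun x => Y x - Y' 1 * x) (f' := fun x => Y' x - Y' 1)
      (fun y hy => by simpa using (hY y hy).fun_sub ((hasDerivAt_id' y).const_mul (Y' 1)))
      (fun y hy => sub_nonneg.2 (hmono y hy)) hx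
    have h2 : m ≤ Y 1 := min_le_left _ _
    have h3 : m ≤ Y' 1 := min_le_right _ _
    nlinarith
  -- Energy estimate: multiplying `Y'' ≥ k / Y` by `2 Y' > 0` shows that `Y'² - 2 k log Y` is
  -- nondecreasing.
  have hQ : ∀ x ≥ 1, Y' 1 ^ 2 - 2 * k * Real.log (Y 1) ≤ Y' x ^ 2 - 2 * k * Real.log (Y x) := by
    intro x hx
    refine le_of_hasDerivAt_nonneg (f := fun x => Y' x ^ 2 - 2 * k * Real.log (Y x))
      (f' := fun x => 2 * Y' x * Y'' x - 2 * k * (Y' x / Y x)) (fun y hy => ?_)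
      (fun y hy => ?_) hx
    · have := ((hY' y hy).fun_pow 2).fun_sub
        (((hY y hy).log (hpos y hy).ne').const_mul (2 * k))
      exact this.congr_deriv (by push_cast; ring)
    · have hp := hpos y hy
      have h0 : 0 < Y' y := h1.trans_le (hmono y hy)
      have h4 : k / Y y ≤ Y'' y := by
        rw [div_le_iff₀ hp]; linarith [hode y hy]
      have h5 := mul_le_mul_of_nonneg_left h4 h0.le
      have h6 : Y' y * (k / Y y) = k * (Y' y / Y y) := by ring
      nlinarith
  -- `E` collects the initial energy and the constant `log m` from `Y ≥ m x`, so that `Y' ≥ √(2 k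
  -- log x) - E`.
  set E := √|Y' 1 ^ 2 - 2 * k * Real.log (Y 1) + 2 * k * Real.log m| with hE
  have hE0 : 0 ≤ E := Real.sqrt_nonneg _
  have hE2 : E ^ 2 = |Y' 1 ^ 2 - 2 * k * Real.log (Y 1) + 2 * k * Real.log m| :=
    Real.sq_sqrt (abs_nonneg _)
  have hder : ∀ x ≥ 1, √(2 * k) * √(Real.log x) - E ≤ Y' x := by
    intro x hx
    have hx0 : (0 : ℝ) < x := one_pos.trans_le hx
    have h0 : 0 < Y' x := h1.trans_le (hmono x hx)
    have h2 : Real.log m + Real.log x ≤ Real.log (Y x) := by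
      rw [← Real.log_mul hm0.ne' hx0.ne']
      exact Real.log_le_log (by positivity) (hlin x hx)
    have h3 : 2 * k * (Real.log m + Real.log x) ≤ 2 * k * Real.log (Y x) :=
      mul_le_mul_of_nonneg_left h2 (by positivity)
    have h4 := hQ x hx
    have h5 := neg_abs_le (Y' 1 ^ 2 - 2 * k * Real.log (Y 1) + 2 * k * Real.log m)
    rw [← Real.sqrt_mul (by positivity)]
    have h6 : √(2 * k * Real.log x) ≤ Y' x + E := by
      rw [Real.sqrt_le_left (by positivity)]
      nlinarith [mul_nonneg h0.le hE0]
    linarith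
  set B := √(2 * k) with hB
  have hB0 : 0 ≤ B := Real.sqrt_nonneg _
  refine ⟨E + 3 / 2 * B + B, fun x hx => ?_⟩
  have hlog : ∀ y ≥ 1, 0 ≤ Real.log y := fun y hy => Real.log_nonneg hy
  -- Integrating the bound on `Y'`. The shift `log x + 1` keeps the root differentiable at `x = 1`;
  -- the derivative of `x √(log x + 1)` exceeds `√(log x)` by at most `1 + 1/2`, whence the constant
  -- `3 / 2 * B`.
  have key := le_of_hasDerivAt_nonneg
    (f := fun x => Y x - B * (x * √(Real.log x + 1)) + (E + 3 / 2 * B) * x)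
    (f' := fun x => Y' x - B * (√(Real.log x + 1) + x * (x⁻¹ / (2 * √(Real.log x + 1))))
      + (E + 3 / 2 * B)) (fun y hy => ?_) (fun y hy => ?_) hx
  · have hx0 : (0 : ℝ) < x := one_pos.trans_le hx
    simp only [Real.log_one, zero_add, Real.sqrt_one, mul_one] at key
    have h2 : √(Real.log x) ≤ √(Real.log x + 1) := Real.sqrt_le_sqrt (by linarith)
    have h3 : B * (x * √(Real.log x)) ≤ B * (x * √(Real.log x + 1)) := by gcongr
    nlinarith
  · have hy0 : (0 : ℝ) < y := one_pos.trans_le hy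
    have hl := hlog y hy
    have h2 := (((Real.hasDerivAt_log hy0.ne').add_const 1).sqrt (by positivity))
    have h3 := ((hY y hy).fun_sub (((hasDerivAt_id' y).fun_mul h2).const_mul B)).fun_add
      ((hasDerivAt_id' y).const_mul (E + 3 / 2 * B))
    exact h3.congr_deriv (by ring)
  · have hy0 : (0 : ℝ) < y := one_pos.trans_le hy
    have hl := hlog y hy
    have h2 : √(Real.log y + 1) ≤ √(Real.log y) + 1 := by
      rw [Real.sqrt_le_left (by positivity)]
      nlinarith [Real.sq_sqrt hl, Real.sqrt_nonneg (Real.log y)]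
    have h3 : 1 ≤ √(Real.log y + 1) := by
      rw [Real.one_le_sqrt]; linarith
    have h4 : y * (y⁻¹ / (2 * √(Real.log y + 1))) ≤ 1 / 2 := by
      rw [mul_div_assoc', mul_inv_cancel₀ hy0.ne']
      exact one_div_le_one_div_of_le two_pos (by linarith)
    have h5 := hder y hy
    nlinarith

namespace IsFlow

variable {a S c C : ℝ} {r rx rxx : ℝ → ℝ → ℝ}

/-- Comparison of a strict classical subsolution `U` of `V_s = -a / V_xx` with the potential,
started at time `δ`. -/
theorem le_potential (h : IsFlow a S r rx rxx) (h₀ : LinearBounds c C (fun y => r y 0))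
    (ha : 0 ≤ a) {α β δ s₁ : ℝ} (hα : 0 < α) (hαβ : α ≤ β) (hδ : 0 ≤ δ) (hs₁ : 0 ≤ s₁)
    (hS : δ + s₁ < S) {U Ux : ℝ → ℝ → ℝ}
    (hU : ContinuousOn (fun p : ℝ × ℝ => U p.1 p.2) (Icc α β ×ˢ Icc 0 s₁))
    (hUx : ∀ s ∈ Ioc 0 s₁, ∀ x ∈ Ioo α β, HasDerivAt (fun y => U y s) (Ux x s) x)
    (hsub : ∀ s ∈ Ioc 0 s₁, ∀ x ∈ Ioo α β, ∃ p G : ℝ, 0 < G ∧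
      HasDerivAt (fun σ => U x σ) p s ∧ HasDerivAt (fun y => Ux y s) G x ∧ p ≤ -(a / G))
    (hinit : ∀ x ∈ Icc α β, U x 0 ≤ potential a r x δ)
    (hleft : ∀ s ∈ Icc 0 s₁, U α s ≤ potential a r α (δ + s))
    (hright : ∀ s ∈ Icc 0 s₁, U β s ≤ potential a r β (δ + s)) :
    ∀ x ∈ Icc α β, ∀ s ∈ Icc 0 s₁, U x s ≤ potential a r x (δ + s) := by
  have hmem : ∀ s ∈ Icc 0 s₁, δ + s ∈ Icc 0 (δ + s₁) := fun s hs =>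
    ⟨add_nonneg hδ hs.1, by linarith [hs.2]⟩
  have hIoo : ∀ s ∈ Ioc 0 s₁, δ + s ∈ Ioo 0 S := fun s hs =>
    ⟨add_pos_of_nonneg_of_pos hδ hs.1, by linarith [hs.2]⟩
  have key := parabolic_maximum_principle (α := α) (β := β) (S := s₁)
    (φ := fun x s => U x s - potential a r x (δ + s))
    (φx := fun x s => Ux x s - antiderivSlope (fun x => potential a r x (δ + s))
      (fun x => (r x (δ + s))⁻¹) x) ?_ ?_ ?_ ?_ ?_ ?_
  · exact fun x hx s hs => sub_nonpos.1 (key x hx s hs)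
  · refine hU.sub ?_
    exact (h.continuousOn_potential h₀ hα hαβ (s := δ + s₁) ⟨add_nonneg hδ hs₁, hS⟩).comp
      (f := fun p : ℝ × ℝ => (p.1, δ + p.2)) (by fun_prop) fun p hp => ⟨hp.1, hmem _ hp.2⟩
  · intro s hs x hx
    have hs' := Ioo_subset_Ico_self (hIoo s hs)
    exact (hUx s hs x hx).fun_sub ((h.secondAntideriv_potential h₀ hs').hasDerivAt
      (h.continuousOn_space_inv hs') (hα.trans hx.1))
  · intro s hs x hx
    have hx0 : 0 < x := hα.trans hx.1
    have hs' := Ioo_subset_Ico_self (hIoo s hs)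
    obtain ⟨p, G, hG, hp, hGx, hpG⟩ := hsub s hs x hx
    refine ⟨_, _, hp.fun_sub
      ((h.hasDerivAt_potential_time hx0 (hIoo s hs)).comp_const_add δ s),
      hGx.fun_sub (SecondAntideriv.hasDerivAt_slope (h.continuousOn_space_inv hs') hx0), ?_⟩
    -- Where `(U - V)_xx ≤ 0` one has `G ≤ 1 / r`, hence `U_s ≤ -a / G ≤ -a r = V_s`.
    intro hq
    have hr := h.pos x hx0 _ hs'
    have h1 : r x (δ + s) ≤ G⁻¹ := by
      rw [le_inv_comm₀ hr hG]; linarith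
    have h2 := mul_le_mul_of_nonneg_left h1 ha
    rw [← div_eq_mul_inv] at h2
    linarith
  · intro x hx
    simpa using hinit x hx
  · intro s hs
    exact sub_nonpos.2 (hleft s hs)
  · intro s hs
    exact sub_nonpos.2 (hright s hs)

/-- As long as the flow survives, the slope of its potential at infinity is infinite, with a
quantitative lower bound in terms of the remaining life time. -/
theorem exists_mul_sqrt_log_le_potential (h : IsFlow a S r rx rxx)
    (h₀ : LinearBounds c C (fun y => r y 0)) (ha : 0 < a) {s₁ s₂ : ℝ} (hs₁ : 0 ≤ s₁)
    (h12 : s₁ < s₂) (hs₂ : s₂ < S) :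
    ∃ K, ∀ x ≥ 1, x * (√(a * (s₂ - s₁)) / 2 * √(Real.log x) - K) ≤ potential a r x s₁ := by
  set τ := s₂ - s₁ with hτ
  have hτ0 : 0 < τ := sub_pos.2 h12
  set mid := (s₁ + s₂) / 2 with hmid
  have hm1 : mid - s₁ = τ / 2 := by rw [hmid, hτ]; ring
  have hm2 : s₂ - mid = τ / 2 := by rw [hmid, hτ]; ring
  have hIcc : ∀ σ ∈ Icc s₁ s₂, σ ∈ Ico 0 S := fun σ hσ =>
    ⟨hs₁.trans hσ.1, hσ.2.trans_lt hs₂⟩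
  have m1 : s₁ ∈ Icc s₁ s₂ := ⟨le_rfl, h12.le⟩
  have m2 : s₂ ∈ Icc s₁ s₂ := ⟨h12.le, le_rfl⟩
  have mm : mid ∈ Icc s₁ s₂ := ⟨by linarith, by linarith⟩
  have hsub : uIcc s₁ s₂ ⊆ Ico 0 S := uIcc_subset (hIcc _ m1) (hIcc _ m2)
  have hinvpos : ∀ x > 0, ∀ s ∈ Ico 0 S, 0 < (r x s)⁻¹ := fun x hx s hs =>
    inv_pos.2 (h.pos x hx s hs)
  -- linear lower bound at the final time
  obtain ⟨A, hA0, hA⟩ : ∃ A, 0 ≤ A ∧ ∀ x ≥ 1, -(A * x) ≤ potential a r x s₂ := by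
    set g := fun x => potential a r x s₂
    set g' := antiderivSlope g (fun x => (r x s₂)⁻¹)
    have hV := h.secondAntideriv_potential h₀ (hIcc _ m2)
    have hc := h.continuousOn_space_inv (hIcc _ m2)
    have hg' : ∀ x ≥ 1, g' 1 ≤ g' x := fun x hx => le_of_hasDerivAt_nonneg
      (fun y hy => SecondAntideriv.hasDerivAt_slope hc (one_pos.trans_le hy))
      (fun y hy => (hinvpos y (one_pos.trans_le hy) _ (hIcc _ m2)).le) hx
    refine ⟨|g 1| + |g' 1|, by positivity, fun x hx => ?_⟩
    have := le_of_hasDerivAt_nonneg (f := fun x => g x - g' 1 * x) (f' := fun x => g' x - g' 1)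
      (fun y hy => by
        simpa using (hV.hasDerivAt hc (one_pos.trans_le hy)).fun_sub
          ((hasDerivAt_id' y).const_mul (g' 1)))
      (fun y hy => sub_nonneg.2 (hg' y hy)) hx
    have e1 := neg_abs_le (g 1)
    have e2 := neg_abs_le (g' 1)
    have e3 := abs_nonneg (g 1)
    change _ ≤ g x
    have e4 : 0 ≤ x - 1 := sub_nonneg.2 hx
    nlinarith [mul_nonneg e3 e4, mul_nonneg (by linarith : 0 ≤ g' 1 + |g' 1|) e4,
      abs_nonneg (g' 1)]
  have hVA : ∀ x ≥ 1, ∀ σ ∈ Icc s₁ s₂, -(A * x) ≤ potential a r x σ := fun x hx σ hσ =>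
    (hA x hx).trans (h.potential_antitone ha.le (zero_le_one.trans hx) (hIcc σ hσ) (hIcc _ m2) hσ.2)
  have hVc : ∀ x > 0, ContinuousOn (fun σ => potential a r x σ) (Icc s₁ s₂) := fun x hx =>
    (h.continuousOn_potential h₀ hx le_rfl (hIcc _ m2)).comp
      (f := fun σ => (x, σ)) (by fun_prop) fun σ hσ => ⟨⟨le_rfl, le_rfl⟩, hs₁.trans hσ.1, hσ.2⟩
  -- The time average turns the evolution into an ordinary differential inequality. With `I = ∫ r`
  -- over the second half of `[s₁, s₂]`, the drop of `V` there is `a I`, so `Z` plus a linear term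
  -- is at least `τ / 2 * (a * I)`, while `Z'' = ∫ 1 / r ≥ (τ / 2)² / I`. The product no longer
  -- contains `I`.
  set Z := fun x => ∫ σ in s₁..s₂, potential a r x σ with hZ
  set Z₂ := fun x => ∫ σ in s₁..s₂, (r x σ)⁻¹ with hZ₂
  have hFc : ContinuousOn (fun p : ℝ × ℝ => (r p.1 p.2)⁻¹) (Ioi 0 ×ˢ uIcc s₁ s₂) :=
    h.continuousOn_inv.mono (prod_mono Subset.rfl hsub)
  have hFt : ∀ x > 0, ContinuousOn (fun σ => (r x σ)⁻¹) (Icc s₁ s₂) := fun x hx => by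
    rw [← uIcc_of_le h12.le]
    exact hFc.comp (f := fun σ => (x, σ)) (by fun_prop) fun σ hσ => ⟨hx, hσ⟩
  have hZD : SecondAntideriv Z Z₂ :=
    SecondAntideriv.integral (g := fun x σ => potential a r x σ) (f := fun x σ => (r x σ)⁻¹)
      (fun σ hσ => h.secondAntideriv_potential h₀ (hsub hσ))
      (fun x hx => by rw [uIcc_of_le h12.le]; exact hVc x hx) hFc
  have hZ₂c : ContinuousOn Z₂ (Ioi 0) := by
    intro x hx
    have hrect : ContinuousOn (fun p : ℝ × ℝ => (r p.2 p.1)⁻¹)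
        (uIcc s₁ s₂ ×ˢ uIcc (x / 2) (2 * x)) :=
      hFc.comp continuous_swap.continuousOn fun p hp => ⟨by
        have := hp.2.1
        have hx0 : (0 : ℝ) < x := hx
        exact lt_of_lt_of_le (lt_min (by positivity) (by positivity)) this, hp.1⟩
    have := continuousOn_integral_rectangle (f := fun σ y => (r y σ)⁻¹) hrect
    refine (this.continuousAt ?_).continuousWithinAt
    have hx0 : (0 : ℝ) < x := hx
    rw [uIcc_of_le (by linarith)]
    exact Icc_mem_nhds (by linarith) (by linarith)
  set Z₁ := antiderivSlope Z Z₂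
  -- Large enough that the corrected average `Z x + A' * τ * x` is positive for `x ≥ 1` and has
  -- positive slope at `1`.
  set A' := A + 1 + |Z₁ 1| / τ with hA'
  have hA'A : A + 1 ≤ A' := le_add_of_nonneg_right (by positivity)
  have hVi : ∀ x > 0, ∀ σ ∈ Icc s₁ s₂, ∀ σ' ∈ Icc s₁ s₂,
      IntervalIntegrable (fun σ => potential a r x σ) volume σ σ' := fun x hx σ hσ σ' hσ' =>
    ((hVc x hx).mono (ordConnected_Icc.uIcc_subset hσ hσ')).intervalIntegrable
  have hZge : ∀ x ≥ 1, τ / 2 * potential a r x mid - τ / 2 * (A * x) ≤ Z x := by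
    intro x hx
    have hx0 : (0 : ℝ) < x := one_pos.trans_le hx
    have e1 : τ / 2 * potential a r x mid ≤ ∫ σ in s₁..mid, potential a r x σ := by
      have := intervalIntegral.integral_mono_on mm.1
        (intervalIntegrable_const (c := potential a r x mid)) (hVi x hx0 _ m1 _ mm)
        fun σ hσ => h.potential_antitone ha.le hx0.le (hIcc σ ⟨hσ.1, hσ.2.trans mm.2⟩)
          (hIcc _ mm) hσ.2
      rwa [intervalIntegral.integral_const, smul_eq_mul, hm1] at this
    have e2 : -(τ / 2 * (A * x)) ≤ ∫ σ in mid..s₂, potential a r x σ := by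
      have := intervalIntegral.integral_mono_on mm.2
        (intervalIntegrable_const (c := -(A * x))) (hVi x hx0 _ mm _ m2)
        fun σ hσ => hVA x hx σ ⟨mm.1.trans hσ.1, hσ.2⟩
      rw [intervalIntegral.integral_const, smul_eq_mul, hm2] at this
      linarith
    have e3 := intervalIntegral.integral_add_adjacent_intervals
      (hVi x hx0 _ m1 _ mm) (hVi x hx0 _ mm _ m2)
    change _ ≤ ∫ σ in s₁..s₂, potential a r x σ
    linarith
  have hk : 0 < a * τ ^ 3 / 8 := by positivity
  have growth : ∃ K, ∀ x ≥ 1, x * (√(2 * (a * τ ^ 3 / 8)) * √(Real.log x) - K)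
      ≤ Z x + A' * τ * x := by
    refine exists_mul_sqrt_log_le (Y := fun x => Z x + A' * τ * x)
      (Y' := fun x => Z₁ x + A' * τ) (Y'' := Z₂) hk
      (fun x hx => by
        simpa using (hZD.hasDerivAt hZ₂c (one_pos.trans_le hx)).fun_add
          ((hasDerivAt_id' x).const_mul (A' * τ)))
      (fun x hx => (SecondAntideriv.hasDerivAt_slope hZ₂c (one_pos.trans_le hx)).add_const _)
      (fun x hx => ?_) ?_ (fun x hx => ?_)
    · have hx0 : (0 : ℝ) < x := one_pos.trans_le hx
      have e1 := hZge x hx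
      have e2 := hVA x hx mid mm
      have e3 : 0 < τ * x := by positivity
      have e4 : (A + 1) * (τ * x) ≤ A' * (τ * x) := mul_le_mul_of_nonneg_right hA'A e3.le
      nlinarith
    · have e1 := neg_abs_le (Z₁ 1)
      have e2 : A' * τ = (A + 1) * τ + |Z₁ 1| := by
        rw [hA', add_mul, div_mul_cancel₀ _ hτ0.ne']
      have e3 : 0 < (A + 1) * τ := by positivity
      change 0 < Z₁ 1 + A' * τ
      linarith
    · have hx0 : (0 : ℝ) < x := one_pos.trans_le hx
      set I := ∫ σ in mid..s₂, r x σ with hI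
      have hri : IntervalIntegrable (fun σ => r x σ) volume mid s₂ :=
        h.intervalIntegrable_time hx0.le (hIcc _ mm) (hIcc _ m2)
      have hI0 : 0 < I := by
        refine intervalIntegral.intervalIntegral_pos_of_pos_on hri (fun σ hσ => ?_) (by linarith)
        exact h.pos x hx0 σ (hIcc σ ⟨mm.1.trans hσ.1.le, hσ.2.le⟩)
      have hFi : ∀ σ ∈ Icc s₁ s₂, ∀ σ' ∈ Icc s₁ s₂,
          IntervalIntegrable (fun σ => (r x σ)⁻¹) volume σ σ' := fun σ hσ σ' hσ' =>
        ((hFt x hx0).mono (ordConnected_Icc.uIcc_subset hσ hσ')).intervalIntegrable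
      have e1 : (τ / 2) ^ 2 / I ≤ ∫ σ in mid..s₂, (r x σ)⁻¹ := by
        -- Cauchy–Schwarz through the tangent line `1 / r ≥ 2 μ - μ² r`, with the value of `μ` that
        -- is optimal after integration.
        set μ := τ / 2 / I with hμ
        have := intervalIntegral.integral_mono_on mm.2
          ((intervalIntegrable_const (c := 2 * μ)).sub (hri.const_mul (μ ^ 2))) (hFi _ mm _ m2)
          fun σ hσ => by
            have hp := h.pos x hx0 σ (hIcc σ ⟨mm.1.trans hσ.1, hσ.2⟩)
            rw [← sub_nonneg]
            have : (r x σ)⁻¹ - (2 * μ - μ ^ 2 * r x σ) = (1 - μ * r x σ) ^ 2 / r x σ := by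
              field_simp; ring
            rw [this]; positivity
        rw [intervalIntegral.integral_sub intervalIntegrable_const (hri.const_mul _),
          intervalIntegral.integral_const, intervalIntegral.integral_const_mul, smul_eq_mul,
          hm2, ← hI] at this
        refine le_of_eq_of_le ?_ this
        rw [hμ]; field_simp; ring
      have e2 : ∫ σ in mid..s₂, (r x σ)⁻¹ ≤ Z₂ x := by
        have e3 := intervalIntegral.integral_add_adjacent_intervals
          (hFi _ m1 _ mm) (hFi _ mm _ m2)
        have e4 : 0 ≤ ∫ σ in s₁..mid, (r x σ)⁻¹ := intervalIntegral.integral_nonneg mm.1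
          fun σ hσ => (hinvpos x hx0 σ (hIcc σ ⟨hσ.1, hσ.2.trans mm.2⟩)).le
        change _ ≤ ∫ σ in s₁..s₂, (r x σ)⁻¹
        linarith
      have e3 : τ / 2 * (a * I) ≤ Z x + A' * τ * x := by
        have f1 := h.potential_sub hx0.le (hIcc _ mm) (hIcc _ m2)
        have f2 := hA x hx
        have f3 := hZge x hx
        have f4 : τ / 2 * (a * I) ≤ τ / 2 * (potential a r x mid + A * x) :=
          mul_le_mul_of_nonneg_left (by linarith) (by positivity)
        have f5 : (A + 1) * (τ * x) ≤ A' * (τ * x) :=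
          mul_le_mul_of_nonneg_right hA'A (by positivity)
        have f6 : 0 < τ * x := by positivity
        nlinarith
      have e4 : a * τ ^ 3 / 8 = τ / 2 * (a * I) * ((τ / 2) ^ 2 / I) := by
        field_simp; ring
      rw [e4]
      exact mul_le_mul e3 (e1.trans e2) (by positivity) (by
        have : 0 ≤ τ / 2 * (a * I) := by positivity
        linarith)
  obtain ⟨K, hK⟩ := growth
  refine ⟨K / τ + A', fun x hx => ?_⟩
  have hx0 : (0 : ℝ) < x := one_pos.trans_le hx
  have e1 : Z x ≤ τ * potential a r x s₁ := by
    have := intervalIntegral.integral_mono_on h12.le (hVi x hx0 _ m1 _ m2)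
      (intervalIntegrable_const (c := potential a r x s₁))
      fun σ hσ => h.potential_antitone ha.le hx0.le (hIcc _ m1) (hIcc σ hσ) hσ.1
    rwa [intervalIntegral.integral_const, smul_eq_mul] at this
  have e2 : √(2 * (a * τ ^ 3 / 8)) = τ * (√(a * τ) / 2) := by
    have : 2 * (a * τ ^ 3 / 8) = (τ / 2) ^ 2 * (a * τ) := by ring
    rw [this, Real.sqrt_mul (by positivity), Real.sqrt_sq (by positivity)]
    ring
  have e3 := hK x hx
  rw [e2] at e3
  have e4 : τ * (x * (√(a * τ) / 2 * √(Real.log x) - (K / τ + A')))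
      = x * (τ * (√(a * τ) / 2) * √(Real.log x) - K) - A' * τ * x := by
    field_simp
    ring
  refine le_of_mul_le_mul_left ?_ hτ0
  linarith

end IsFlow

/-! ### The softplus barrier and the averaged upper bound. -/

/-- The function `β⁻¹ log (1 + exp (β q))`, a smooth approximation of the positive part. -/
noncomputable def softplus (β q : ℝ) : ℝ := β⁻¹ * Real.log (1 + Real.exp (β * q))

/-- The derivative of `softplus`. -/
noncomputable def softstep (β q : ℝ) : ℝ := Real.exp (β * q) / (1 + Real.exp (β * q))

theorem softstep_pos (β q : ℝ) : 0 < softstep β q := by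
  rw [softstep]; positivity

theorem softstep_lt_one (β q : ℝ) : softstep β q < 1 := by
  rw [softstep, div_lt_one (by positivity)]
  linarith

theorem softplus_nonneg {β : ℝ} (hβ : 0 < β) (q : ℝ) : 0 ≤ softplus β q := by
  have := Real.log_nonneg (by linarith [Real.exp_pos (β * q)] : 1 ≤ 1 + Real.exp (β * q))
  rw [softplus]; positivity

theorem le_softplus {β : ℝ} (hβ : 0 < β) (q : ℝ) : q ≤ softplus β q := by
  have h1 : β * q ≤ Real.log (1 + Real.exp (β * q)) := by
    rw [Real.le_log_iff_exp_le (by positivity)]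
    linarith
  rw [softplus, inv_mul_eq_div, le_div_iff₀ hβ]
  linarith

theorem softplus_le {β : ℝ} (hβ : 0 < β) (q : ℝ) : softplus β q ≤ β⁻¹ * Real.exp (β * q) := by
  have h1 := Real.log_le_sub_one_of_pos (by positivity : 0 < 1 + Real.exp (β * q))
  rw [softplus]
  gcongr
  linarith

theorem continuous_softplus (β : ℝ) : Continuous (softplus β) := by
  have : ∀ q, 1 + Real.exp (β * q) ≠ 0 := fun q => by positivity
  unfold softplus
  fun_prop (disch := exact this _)

theorem hasDerivAt_softplus {β : ℝ} (hβ : β ≠ 0) (q : ℝ) :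
    HasDerivAt (softplus β) (softstep β q) q := by
  have h1 : HasDerivAt (fun q => 1 + Real.exp (β * q)) (Real.exp (β * q) * (β * 1)) q :=
    (((hasDerivAt_id' q).const_mul β).exp).const_add 1
  refine ((h1.log (by positivity)).const_mul β⁻¹).congr_deriv ?_
  rw [softstep]
  field_simp

theorem hasDerivAt_softstep (β q : ℝ) :
    HasDerivAt (softstep β) (β * softstep β q * (1 - softstep β q)) q := by
  have h0 : HasDerivAt (fun q => Real.exp (β * q)) (Real.exp (β * q) * (β * 1)) q :=
    ((hasDerivAt_id' q).const_mul β).exp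
  have hne : (1 + Real.exp (β * q)) ≠ 0 := by positivity
  refine (h0.fun_div (h0.const_add 1) hne).congr_deriv ?_
  rw [softstep]
  field_simp

/-- The subsolution inequality for `V₀ - a C x s - x * softplus β q`: here `F = V₀''`, and `p σ F +
T` is the second derivative of the softplus term. With `u = p σ (2 - σ)` the curvature left is at
least `F (1 - u)`. Since `u ≤ p` and `u ≤ 2 σ`, one has `1 / (1 - u) ≤ 1 + 2 σ / (1 - p)`; the
excess is paid by the time slope `2 a C / (1 - p)` of `q`. -/
theorem barrier_inequality {a C x F σ p T : ℝ} (ha : 0 < a) (hC : 0 < C) (hx : 0 < x)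
    (hF0 : 0 < F) (hF : 1 ≤ C * x * F) (hσ : 0 < σ) (hp : 0 < p) (hp1 : p < 1)
    (hT : T ≤ p * σ * (1 - σ) * F) :
    0 < F - (p * σ * F + T) ∧
      -(a * C * x) - x * (σ * (2 * a * C / (1 - p))) ≤ -(a / (F - (p * σ * F + T))) := by
  set u := p * σ * (2 - σ) with hu
  have hu1 : u ≤ p := by
    have : p - u = p * (1 - σ) ^ 2 := by rw [hu]; ring
    nlinarith [mul_nonneg hp.le (sq_nonneg (1 - σ))]
  have hu2 : u ≤ 2 * σ := by
    have h1 : p * σ ≤ σ := by nlinarith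
    have h2 : 0 < p * σ := mul_pos hp hσ
    nlinarith
  have hG : F * (1 - u) ≤ F - (p * σ * F + T) := by
    rw [hu]; nlinarith
  have hG0 : 0 < F - (p * σ * F + T) :=
    lt_of_lt_of_le (mul_pos hF0 (by linarith)) hG
  refine ⟨hG0, ?_⟩
  have hq : 0 < 1 - p := sub_pos.2 hp1
  have h1 : 1 ≤ (1 + 2 * σ / (1 - p)) * (1 - u) := by
    have : (1 + 2 * σ / (1 - p)) * (1 - u) = ((1 - p) + 2 * σ) * (1 - u) / (1 - p) := by
      field_simp
    rw [this, le_div_iff₀ hq]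
    nlinarith [mul_nonneg (by linarith : 0 ≤ 2 * σ - u) hq.le,
      mul_nonneg hσ.le (by linarith : 0 ≤ p - u)]
  have h2 : a / (F - (p * σ * F + T)) ≤ a * C * x * (1 + 2 * σ / (1 - p)) := by
    rw [div_le_iff₀ hG0]
    have h3 : 0 ≤ a * C * x * (1 + 2 * σ / (1 - p)) := by positivity
    have h4 := mul_le_mul_of_nonneg_left hG h3
    have h5 : a * C * x * (1 + 2 * σ / (1 - p)) * (F * (1 - u))
        = a * ((C * x * F) * ((1 + 2 * σ / (1 - p)) * (1 - u))) := by ring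
    have h6 : 1 ≤ (C * x * F) * ((1 + 2 * σ / (1 - p)) * (1 - u)) :=
      one_le_mul_of_one_le_of_one_le hF h1
    have h7 := mul_le_mul_of_nonneg_left h6 ha.le
    linarith
  have h3 : a * C * x * (1 + 2 * σ / (1 - p))
      = a * C * x + x * (σ * (2 * a * C / (1 - p))) := by ring
  linarith

namespace IsFlow

variable {a S c C : ℝ} {r rx rxx : ℝ → ℝ → ℝ}

theorem exists_le_near_zero (h : IsFlow a S r rx rxx) {s₁ ε : ℝ} (hs₁ : s₁ ∈ Ico 0 S)
    (hε : 0 < ε) : ∃ δ > 0, ∀ x ∈ Icc 0 δ, ∀ s ∈ Icc 0 s₁, r x s ≤ ε := by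
  have huc := (isCompact_Icc.prod isCompact_Icc).uniformContinuousOn_of_continuous
    (h.continuousOn.mono (prod_mono (Icc_subset_Ici_self : Icc (0 : ℝ) 1 ⊆ Ici 0)
      (fun s hs => ⟨hs.1, hs.2.trans_lt hs₁.2⟩ : Icc 0 s₁ ⊆ Ico 0 S)))
  obtain ⟨δ, hδ, hd⟩ := Metric.uniformContinuousOn_iff.1 huc ε hε
  refine ⟨min (δ / 2) 1, by positivity, fun x hx s hs => ?_⟩
  have hx1 := hx.2.trans (min_le_right _ _)
  have hx2 := hx.2.trans (min_le_left _ _)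
  have := hd (x, s) ⟨⟨hx.1, hx1⟩, hs⟩ (0, s) ⟨⟨le_rfl, zero_le_one⟩, hs⟩ (by
    rw [Prod.dist_eq, dist_self, Real.dist_eq, sub_zero, abs_of_nonneg hx.1]
    exact max_lt (by linarith) hδ)
  simp only [h.zero s ⟨hs.1, hs.2.trans_lt hs₁.2⟩, Real.dist_eq, sub_zero] at this
  exact (le_abs_self _).trans this.le

/-- Since `r` is continuous up to `x = 0` and vanishes there, the potential loses arbitrarily little
near `0`, uniformly in time. This supplies the left boundary condition in the comparisons, at the
cost of `η`. -/
theorem exists_potential_near_zero (h : IsFlow a S r rx rxx) (ha : 0 ≤ a) {s₁ η : ℝ}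
    (hs₁ : s₁ ∈ Ico 0 S) (hη : 0 < η) : ∃ δ > 0, ∀ x ∈ Ioc 0 δ, ∀ s ∈ Icc 0 s₁,
      initialPotential (fun y => r y 0) x - η ≤ potential a r x s := by
  have hs0 := hs₁.1
  obtain ⟨δ, hδ, hd⟩ := h.exists_le_near_zero hs₁ (ε := η / ((a + 1) * (s₁ + 1))) (by positivity)
  refine ⟨δ, hδ, fun x hx s hs => ?_⟩
  have hz : (0 : ℝ) ∈ Ico 0 S := ⟨le_rfl, hs0.trans_lt hs₁.2⟩
  have h1 := intervalIntegral.integral_mono_on hs.1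
    (h.intervalIntegrable_time hx.1.le hz ⟨hs.1, hs.2.trans_lt hs₁.2⟩)
    (intervalIntegrable_const (c := η / ((a + 1) * (s₁ + 1))))
    fun σ hσ => hd x ⟨hx.1.le, hx.2⟩ σ ⟨hσ.1, hσ.2.trans hs.2⟩
  rw [intervalIntegral.integral_const, smul_eq_mul, sub_zero] at h1
  have h2 : a * (s * (η / ((a + 1) * (s₁ + 1)))) ≤ η := by
    have : a * (s * (η / ((a + 1) * (s₁ + 1)))) = η * ((a * s) / ((a + 1) * (s₁ + 1))) := by ring
    rw [this]
    refine mul_le_of_le_one_right hη.le ?_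
    rw [div_le_one (by positivity)]
    have := hs.1
    have := hs.2
    gcongr <;> linarith
  have h3 := mul_le_mul_of_nonneg_left h1 ha
  rw [potential]
  linarith

/-- The barrier estimate: if the potential at time `s₁` grows superlinearly at a sufficient rate,
the flow stays below `C x` on average on the time intervals `[0, s]`, `s ≤ s₁`. -/
theorem initialPotential_sub_le_potential (h : IsFlow a S r rx rxx)
    (h₀ : LinearBounds c C (fun y => r y 0)) (ha : 0 < a) {s₁ D K : ℝ} (hs₁ : s₁ ∈ Ico 0 S)
    (hD : 0 < D) (hsmall : 8 * a * C * s₁ < D ^ 2 * c)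
    (hgrow : ∀ x ≥ 1, x * (D * √(Real.log x) - K) ≤ potential a r x s₁) {x₀ s : ℝ}
    (hx₀ : 0 < x₀) (hs : s ∈ Icc 0 s₁) :
    initialPotential (fun y => r y 0) x₀ - a * C * x₀ * s ≤ potential a r x₀ s := by
  have hc := h₀.pos
  have hC := h₀.upper_pos
  set R := fun y => r y 0 with hR
  -- `κ` makes `(1 - p) V₀` at the right edge use exactly half of the growth rate `D`; `β` keeps the
  -- curvature of softplus below `1 / R`; `θ` is the rate at which `q` tends to `-∞` at `x₀`, and `θ
  -- > 0` is equivalent to `hsmall`.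
  set κ := D * c / 2 with hκ
  have hκ0 : 0 < κ := by positivity
  set β := c ^ 2 / C with hβdef
  have hβ : 0 < β := by positivity
  set θ := D / 2 - 2 * a * C * s₁ / κ with hθ
  have hθ0 : 0 < θ := by
    rw [hθ, sub_pos, div_lt_iff₀ hκ0, hκ]
    nlinarith
  -- The right edge is `X = exp (N²)`, so that `√(log X) = N`. The subsolution `V₀ - a C x s` may
  -- exceed `V` at `X`; subtracting `x * softplus β q` repairs this, and at the fixed point `x₀` the
  -- correction disappears as `N → ∞`.
  have main : ∀ N : ℝ, κ < N → x₀ < Real.exp (N ^ 2) →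
      initialPotential R x₀ - a * C * x₀ * s - potential a r x₀ s ≤
        x₀ * (β⁻¹ * Real.exp (β * (|initialPotential R x₀ / x₀| + K - θ * N))) := by
    intro N hN hX
    have hN0 : 0 < N := hκ0.trans hN
    set X := Real.exp (N ^ 2) with hXdef
    have hlogX : Real.log X = N ^ 2 := Real.log_exp _
    have hX1 : 1 ≤ X := Real.one_le_exp (by positivity)
    set p := 1 - κ / N with hp
    have hp0 : 0 < p := by rw [hp, sub_pos, div_lt_one hN0]; exact hN
    have hp1 : p < 1 := by rw [hp]; linarith [div_pos hκ0 hN0]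
    have h1p : 1 - p = κ / N := by rw [hp]; ring
    set k := 2 * a * C / (1 - p) with hk
    have hkN : k = 2 * a * C * N / κ := by rw [hk, h1p]; field_simp
    have hk0 : 0 < k := by rw [hkN]; positivity
    set L := D / 2 * N - K with hL
    let q : ℝ → ℝ → ℝ := fun x s => p * (initialPotential R x / x) + k * s - L
    have hq1 : q x₀ s ≤ |initialPotential R x₀ / x₀| + K - θ * N := by
      have e1 : p * (initialPotential R x₀ / x₀) ≤ |initialPotential R x₀ / x₀| := by
        have := le_abs_self (initialPotential R x₀ / x₀)
        have := abs_nonneg (initialPotential R x₀ / x₀)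
        nlinarith
      have e2 : k * s ≤ k * s₁ := mul_le_mul_of_nonneg_left hs.2 hk0.le
      have e3 : k * s₁ = 2 * a * C * s₁ / κ * N := by rw [hkN]; ring
      have e4 : θ * N = D / 2 * N - 2 * a * C * s₁ / κ * N := by rw [hθ]; ring
      change p * (initialPotential R x₀ / x₀) + k * s - L ≤ _
      rw [hL]
      linarith
    have hqx : ∀ x > 0, ∀ s, HasDerivAt (fun y => q y s) (p * (reciprocalMoment R x / x ^ 2)) x := by
      intro x hx s
      have := ((((h₀.hasDerivAt_initialPotential hx).fun_div (hasDerivAt_id' x)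
        hx.ne').const_mul p).add_const (k * s)).sub_const L
      refine this.congr_deriv ?_
      rw [← LinearBounds.initialPotential_eq_sub]
      ring
    have hη : ∀ η > 0, initialPotential R x₀ - a * C * x₀ * s - x₀ * softplus β (q x₀ s) - η ≤
        potential a r x₀ s := by
      intro η hη
      obtain ⟨δ₀, hδ₀, hnear⟩ := h.exists_potential_near_zero ha.le hs₁ hη
      set δ := min δ₀ x₀ with hδ
      have hδ0 : 0 < δ := lt_min hδ₀ hx₀
      have hδX : δ ≤ X := (min_le_right _ _).trans hX.le
      have key := h.le_potential h₀ ha.le (α := δ) (β := X) (δ := 0) (s₁ := s₁) hδ0 hδX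
        le_rfl hs₁.1 (by rw [zero_add]; exact hs₁.2)
        (U := fun x s => initialPotential R x - a * C * x * s - x * softplus β (q x s) - η)
        (Ux := fun x s => reciprocalIntegral R x - a * C * s
          - (softplus β (q x s) + softstep β (q x s) * (p * (reciprocalMoment R x / x))))
        ?_ ?_ ?_ ?_ ?_ ?_ x₀ ⟨min_le_right _ _, hX.le⟩ s hs
      · rwa [zero_add] at key
      · have c1 : ContinuousOn (fun z : ℝ × ℝ => initialPotential R z.1)
            (Icc δ X ×ˢ Icc 0 s₁) := by
          have : ContinuousOn (initialPotential R) (Ioi 0) := fun x hx =>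
            (h₀.hasDerivAt_initialPotential hx).continuousAt.continuousWithinAt
          exact this.comp continuousOn_fst fun z hz => hδ0.trans_le hz.1.1
        have c2 : ContinuousOn (fun z : ℝ × ℝ => q z.1 z.2) (Icc δ X ×ˢ Icc 0 s₁) :=
          ((continuousOn_const.mul (c1.div continuousOn_fst
            fun z hz => (hδ0.trans_le hz.1.1).ne')).add (by fun_prop)).sub continuousOn_const
        have c3 := (continuous_softplus β).comp_continuousOn c2
        exact ((c1.sub (by fun_prop)).sub (continuousOn_fst.mul c3)).sub continuousOn_const
      · intro s hs x hx
        have hx0 : 0 < x := hδ0.trans hx.1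
        have d1 := (hasDerivAt_softplus hβ.ne' (q x s)).comp x (hqx x hx0 s)
        have d2 := (((h₀.hasDerivAt_initialPotential hx0).fun_sub
          (((hasDerivAt_id' x).const_mul (a * C)).mul_const s)).fun_sub
          ((hasDerivAt_id' x).fun_mul d1)).sub_const η
        refine d2.congr_deriv ?_
        simp only [Function.comp]
        field_simp
      · intro s hs x hx
        have hx0 : 0 < x := hδ0.trans hx.1
        set σ := softstep β (q x s) with hσ
        set m := reciprocalMoment R x with hm
        set F := (R x)⁻¹ with hF
        set T := p ^ 2 * (β * σ * (1 - σ)) * (m ^ 2 / x ^ 3) with hT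
        have hσ0 : 0 < σ := softstep_pos _ _
        have hσ1 : σ < 1 := softstep_lt_one _ _
        have hF0 : 0 < F := inv_pos.2 (h₀.R_pos hx0)
        have hCF : 1 ≤ C * x * F := by
          have := h₀.le_mul_inv hx0
          rw [div_le_iff₀ hC] at this
          change 1 ≤ x * F * C at this
          linarith
        have hTle : T ≤ p * σ * (1 - σ) * F := by
          have e1 : β * (m ^ 2 / x ^ 3) ≤ F := by
            have f1 : m ≤ x / c := h₀.reciprocalMoment_le hx0
            have f0 : 0 ≤ m := h₀.reciprocalMoment_nonneg hx0
            have f2 : m ^ 2 ≤ (x / c) ^ 2 := by gcongr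
            calc β * (m ^ 2 / x ^ 3) ≤ β * ((x / c) ^ 2 / x ^ 3) := by gcongr
              _ = 1 / (C * x) := by rw [hβdef]; field_simp
              _ ≤ F := by rw [div_le_iff₀ (by positivity)]; linarith
          have e2 : p ^ 2 ≤ p := by nlinarith
          have e3 : 0 ≤ σ * (1 - σ) := mul_nonneg hσ0.le (by linarith)
          calc T = p ^ 2 * ((σ * (1 - σ)) * (β * (m ^ 2 / x ^ 3))) := by rw [hT]; ring
            _ ≤ p * ((σ * (1 - σ)) * F) := by gcongr
            _ = p * σ * (1 - σ) * F := by ring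
        obtain ⟨hG0, hG⟩ := barrier_inequality ha hC hx0 hF0 hCF hσ0 hp0 hp1 hTle
        refine ⟨_, F - (p * σ * F + T), hG0, ?_, ?_, hG⟩
        · have d0 : HasDerivAt (fun s => q x s) k s :=
            ((((hasDerivAt_id' s).const_mul k).const_add
              (p * (initialPotential R x / x))).sub_const L).congr_deriv (mul_one k)
          have d1 := (hasDerivAt_softplus hβ.ne' (q x s)).comp s d0
          have d2 := ((((hasDerivAt_id' s).const_mul (a * C * x)).const_sub
            (initialPotential R x)).fun_sub (d1.const_mul x)).sub_const η
          exact d2.congr_deriv (by rw [mul_one])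
        · have d1 := (hasDerivAt_softplus hβ.ne' (q x s)).comp x (hqx x hx0 s)
          have d2 := (hasDerivAt_softstep β (q x s)).comp x (hqx x hx0 s)
          have d3 := ((h₀.hasDerivAt_reciprocalMoment hx0).fun_div (hasDerivAt_id' x)
            hx0.ne').const_mul p
          have d4 := ((h₀.hasDerivAt_reciprocalIntegral hx0).sub_const (a * C * s)).fun_sub
            (d1.fun_add (d2.fun_mul d3))
          -- The terms with `m / x²` cancel: `x (V₀ / x)'' + 2 (V₀ / x)' = V₀''`.
          refine d4.congr_deriv ?_
          simp only [Function.comp]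
          rw [hT, ← hσ, ← hm, ← hF]
          field_simp
          ring
      · intro x hx
        have hx0 : 0 < x := hδ0.trans_le hx.1
        rw [potential_zero]
        have := mul_nonneg hx0.le (softplus_nonneg hβ (q x 0))
        simp only [mul_zero]
        linarith
      · intro s hs
        have e1 := hnear δ ⟨hδ0, min_le_left _ _⟩ s hs
        have e2 := mul_nonneg hδ0.le (softplus_nonneg hβ (q δ s))
        have e3 : 0 ≤ a * C * δ * s := by have := hs.1; positivity
        rw [zero_add]
        linarith
      · intro s hs
        have hX0 : 0 < X := one_pos.trans_le hX1
        -- At the edge `softplus ≥ q` leaves at most `(1 - p) V₀ + X L`. Each half contributes `X (D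
        -- / 2) N`, and together they give `X (D N - K)`, the assumed lower bound for `V` at time
        -- `s₁`.
        have e1 := mul_le_mul_of_nonneg_left (le_softplus hβ (q X s)) hX0.le
        have e2 : X * q X s = p * initialPotential R X + X * (k * s) - X * L := by
          change X * (p * (initialPotential R X / X) + k * s - L) = _
          field_simp
        have e3 : 0 ≤ a * C * X * s := by have := hs.1; positivity
        have e4 : 0 ≤ X * (k * s) := by have := hs.1; positivity
        have e5 := mul_le_mul_of_nonneg_left (h₀.initialPotential_le hX1)
          (by rw [h1p]; positivity : 0 ≤ 1 - p)
        have e6 := hgrow X hX1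
        have e7 := h.potential_antitone ha.le hX0.le ⟨hs.1, hs.2.trans_lt hs₁.2⟩ hs₁ hs.2
        rw [hlogX, Real.sqrt_sq hN0.le] at e6
        have e8 : (1 - p) * (X * (Real.log X / c)) = X * (D / 2 * N) := by
          rw [h1p, hlogX, hκ]; field_simp
        rw [e8] at e5
        have e9 : X * L = X * (D / 2 * N) - X * K := by rw [hL]; ring
        have e10 : X * (D * N - K) = X * (D / 2 * N) + X * (D / 2 * N) - X * K := by ring
        rw [zero_add]
        linarith
    have h1 : initialPotential R x₀ - a * C * x₀ * s - x₀ * softplus β (q x₀ s) ≤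
        potential a r x₀ s := le_of_forall_pos_le_add fun η hη' => by linarith [hη η hη']
    have h2 : softplus β (q x₀ s) ≤
        β⁻¹ * Real.exp (β * (|initialPotential R x₀ / x₀| + K - θ * N)) :=
      (softplus_le hβ _).trans (by gcongr)
    have h3 := mul_le_mul_of_nonneg_left h2 hx₀.le
    linarith
  have hlim : Tendsto (fun N : ℝ => x₀ * (β⁻¹ * Real.exp (β *
      (|initialPotential R x₀ / x₀| + K - θ * N)))) atTop (𝓝 0) := by
    have h1 : Tendsto (fun N : ℝ => β * (|initialPotential R x₀ / x₀| + K - θ * N))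
        atTop atBot :=
      (tendsto_atBot_add_const_left _ _
        (tendsto_neg_atTop_atBot.comp (tendsto_id.const_mul_atTop hθ0))).const_mul_atBot hβ
    simpa using ((Real.tendsto_exp_atBot.comp h1).const_mul β⁻¹).const_mul x₀
  have hev : ∀ᶠ N : ℝ in atTop, initialPotential R x₀ - a * C * x₀ * s - potential a r x₀ s ≤
      x₀ * (β⁻¹ * Real.exp (β * (|initialPotential R x₀ / x₀| + K - θ * N))) := by
    have h1 : Tendsto (fun N : ℝ => Real.exp (N ^ 2)) atTop atTop :=
      Real.tendsto_exp_atTop.comp (tendsto_pow_atTop two_ne_zero)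
    filter_upwards [eventually_gt_atTop κ, h1.eventually_gt_atTop x₀] with N hN1 hN2
    exact main N hN1 hN2
  have := ge_of_tendsto hlim hev
  linarith

end IsFlow

/-! ### From averaged to pointwise bounds, and their persistence. -/

/-- Convexity of inversion; it makes convex combinations of subsolutions of `V_s = -a / V_xx`
subsolutions again. -/
theorem inv_combination_le {u v ε : ℝ} (hu : 0 < u) (hv : 0 < v) (hε : 0 < ε) (hε1 : ε < 1) :
    ((1 - ε) * u⁻¹ + ε * v⁻¹)⁻¹ ≤ (1 - ε) * u + ε * v := by
  have h1 : 0 < 1 - ε := sub_pos.2 hε1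
  have h2 : 0 < (1 - ε) * u⁻¹ + ε * v⁻¹ := by positivity
  rw [inv_le_iff_one_le_mul₀ h2, ← sub_nonneg]
  have : ((1 - ε) * u + ε * v) * ((1 - ε) * u⁻¹ + ε * v⁻¹) - 1
      = (1 - ε) * ε * (u - v) ^ 2 / (u * v) := by
    field_simp; ring
  rw [this]
  positivity

namespace IsFlow

variable {a S c C : ℝ} {r rx rxx : ℝ → ℝ → ℝ}

/-- The averaged bound on intervals starting at time zero propagates to all time intervals. -/
theorem potential_sub_le_potential_add (h : IsFlow a S r rx rxx)
    (h₀ : LinearBounds c C (fun y => r y 0)) (ha : 0 < a) {s₁ δ t : ℝ} (hs₁ : s₁ ∈ Ico 0 S)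
    (hV : ∀ x > 0, ∀ s ∈ Icc 0 s₁,
      initialPotential (fun y => r y 0) x - a * C * x * s ≤ potential a r x s)
    (hδ : 0 ≤ δ) (ht : 0 ≤ t) (hδt : δ + t ≤ s₁) {x₀ : ℝ} (hx₀ : 0 < x₀) :
    potential a r x₀ t - a * C * x₀ * δ ≤ potential a r x₀ (δ + t) := by
  have hc := h₀.pos
  have hC := h₀.upper_pos
  set V₀ := initialPotential (fun y => r y 0) with hV₀
  -- Half of the lower bound for `V₀`, so that `V₀ / 2 - B ≤ V₀`.
  set B := 1 / (2 * c) with hB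
  have hB2 : 2 * B = 1 / c := by rw [hB]; field_simp
  have hV₀B : ∀ x > 0, -(2 * B) ≤ V₀ x := fun x hx => by
    rw [hB2]; exact h₀.neg_inv_le_initialPotential hx
  have hz : (0 : ℝ) ∈ Ico 0 S := ⟨le_rfl, hs₁.1.trans_lt hs₁.2⟩
  have hVle : ∀ x > 0, ∀ s ∈ Icc 0 s₁, potential a r x s ≤ V₀ x := fun x hx s hs => by
    rw [hV₀, ← potential_zero a r]
    exact h.potential_antitone ha.le (le_of_lt hx) hz ⟨hs.1, hs.2.trans_lt hs₁.2⟩ hs.1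
  -- The solution `V` alone gives no control at the right edge, so a fraction `ε` of the subsolution
  -- `V₀ / 2 - 2 a C x s - B` is mixed in. Halving `V₀` gains `ε V₀ / 2`, which is superlinear and
  -- at a distant edge beats the linear loss `a C X s₁` allowed by `hV`.
  have main : ∀ ε ∈ Ioo (0 : ℝ) 1, ∀ η > 0,
      (1 - ε) * potential a r x₀ t + ε * (V₀ x₀ / 2 - 2 * a * C * x₀ * t - B)
        - a * C * x₀ * δ - η ≤ potential a r x₀ (δ + t) := by
    rintro ε ⟨hε, hε1⟩ η hη
    obtain ⟨α₀, hα₀, hnear⟩ := h.exists_potential_near_zero ha.le hs₁ hη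
    obtain ⟨X, hX1, hX2, hX3⟩ : ∃ X, 1 ≤ X ∧ x₀ ≤ X ∧
        2 * a * C * s₁ / ε ≤ Real.log X / C - 1 / c := by
      have h1 : Tendsto (fun X => Real.log X / C - 1 / c) atTop atTop :=
        tendsto_atTop_add_const_right _ _ (Real.tendsto_log_atTop.atTop_div_const hC)
      exact ((eventually_ge_atTop 1).and ((eventually_ge_atTop x₀).and
        (h1.eventually_ge_atTop _))).exists
    set α := min α₀ x₀ with hα
    have hα0 : 0 < α := lt_min hα₀ hx₀
    have htS : ∀ s ∈ Icc 0 t, s ∈ Icc 0 s₁ := fun s hs => ⟨hs.1, by linarith [hs.2]⟩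
    have htS' : ∀ s ∈ Icc 0 t, δ + s ∈ Icc 0 s₁ := fun s hs =>
      ⟨add_nonneg hδ hs.1, by linarith [hs.2]⟩
    refine h.le_potential h₀ ha.le (α := α) (β := X) (δ := δ) (s₁ := t) hα0
      ((min_le_right _ _).trans hX2) hδ ht (hδt.trans_lt hs₁.2)
      (U := fun x s => (1 - ε) * potential a r x s + ε * (V₀ x / 2 - 2 * a * C * x * s - B)
        - a * C * x * δ - η)
      (Ux := fun x s => (1 - ε) * antiderivSlope (fun x => potential a r x s)
        (fun x => (r x s)⁻¹) x + ε * (reciprocalIntegral (fun y => r y 0) x / 2 - 2 * a * C * s)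
        - a * C * δ)
      ?_ ?_ ?_ ?_ ?_ ?_ x₀ ⟨min_le_right _ _, hX2⟩ t ⟨ht, le_rfl⟩
    · have c1 : ContinuousOn (fun z : ℝ × ℝ => V₀ z.1) (Icc α X ×ˢ Icc 0 t) := by
        have : ContinuousOn V₀ (Ioi 0) := fun x hx =>
          (h₀.hasDerivAt_initialPotential hx).continuousAt.continuousWithinAt
        exact this.comp continuousOn_fst fun z hz => hα0.trans_le hz.1.1
      have c2 := h.continuousOn_potential h₀ (s := t) hα0 ((min_le_right _ _).trans hX2)
        ⟨ht, by linarith [hs₁.2]⟩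
      exact (((continuousOn_const.mul c2).add (continuousOn_const.mul
        (((c1.div_const 2).sub (by fun_prop)).sub continuousOn_const))).sub (by fun_prop)).sub
        continuousOn_const
    · intro s hs x hx
      have hx0 : 0 < x := hα0.trans hx.1
      have hs' : s ∈ Ico 0 S := ⟨hs.1.le, by linarith [hs.2, hs₁.2]⟩
      have d1 := ((h.secondAntideriv_potential h₀ hs').hasDerivAt
        (h.continuousOn_space_inv hs') hx0).const_mul (1 - ε)
      have d2 := ((((h₀.hasDerivAt_initialPotential hx0).div_const 2).fun_sub
        (((hasDerivAt_id' x).const_mul (2 * a * C)).mul_const s)).sub_const B).const_mul ε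
      have d3 := ((d1.fun_add d2).fun_sub
        (((hasDerivAt_id' x).const_mul (a * C)).mul_const δ)).sub_const η
      exact d3.congr_deriv (by simp only [mul_one])
    · intro s hs x hx
      have hx0 : 0 < x := hα0.trans hx.1
      have hs' : s ∈ Ioo 0 S := ⟨hs.1, by linarith [hs.2, hs₁.2]⟩
      have hs'' := Ioo_subset_Ico_self hs'
      have hr := h.pos x hx0 s hs''
      have hR := h₀.R_pos hx0
      have h1ε : 0 < 1 - ε := sub_pos.2 hε1
      refine ⟨-((1 - ε) * (a * r x s) + ε * (2 * a * C * x)),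
        (1 - ε) * (r x s)⁻¹ + ε * (2 * r x 0)⁻¹, by positivity, ?_, ?_, ?_⟩
      · have d1 := (h.hasDerivAt_potential_time hx0 hs').const_mul (1 - ε)
        have d2 := ((((hasDerivAt_id' s).const_mul (2 * a * C * x)).const_sub
          (V₀ x / 2)).sub_const B).const_mul ε
        exact (((d1.fun_add d2).sub_const _).sub_const η).congr_deriv (by ring)
      · have d1 := (SecondAntideriv.hasDerivAt_slope (g := fun x => potential a r x s)
          (h.continuousOn_space_inv hs'') hx0).const_mul (1 - ε)
        have d2 := (((h₀.hasDerivAt_reciprocalIntegral hx0).div_const 2).sub_const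
          (2 * a * C * s)).const_mul ε
        exact ((d1.fun_add d2).sub_const _).congr_deriv (by rw [mul_inv]; ring)
      · have e1 := inv_combination_le hr (by positivity : 0 < 2 * r x 0) hε hε1
        have e2 : r x 0 ≤ C * x := h₀.upper x hx0
        have e3 : ((1 - ε) * (r x s)⁻¹ + ε * (2 * r x 0)⁻¹)⁻¹ ≤
            (1 - ε) * r x s + ε * (2 * (C * x)) := e1.trans (by gcongr)
        have e4 := mul_le_mul_of_nonneg_left e3 ha.le
        rw [div_eq_mul_inv]
        linarith
    · intro x hx
      have hx0 : 0 < x := hα0.trans_le hx.1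
      have e1 := hV x hx0 δ (by simpa using htS' 0 ⟨le_rfl, ht⟩)
      have e2 := mul_le_mul_of_nonneg_left (hV₀B x hx0) hε.le
      simp only [potential_zero, mul_zero]
      change (1 - ε) * V₀ x + _ - _ - _ ≤ _
      linarith
    · intro s hs
      have e1 := hnear α ⟨hα0, min_le_left _ _⟩ (δ + s) (htS' s hs)
      have e2 := mul_le_mul_of_nonneg_left (hV₀B α hα0) hε.le
      have e3 := mul_le_mul_of_nonneg_left (hVle α hα0 s (htS s hs)) (sub_pos.2 hε1).le
      have e4 : 0 ≤ ε * (2 * a * C * α * s) := by have := hs.1; positivity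
      have e5 : 0 ≤ a * C * α * δ := by positivity
      linarith
    · intro s hs
      have hX0 : 0 < X := one_pos.trans_le hX1
      have e1 := hV X hX0 (δ + s) (htS' s hs)
      have e3 := mul_le_mul_of_nonneg_left (hVle X hX0 s (htS s hs)) (sub_pos.2 hε1).le
      have e4 : 0 ≤ ε * (2 * a * C * X * s) := by have := hs.1; positivity
      have e5 : 0 ≤ a * C * X * δ := by positivity
      have e6 : a * C * X * (δ + s) ≤ a * C * X * s₁ :=
        mul_le_mul_of_nonneg_left (htS' s hs).2 (by positivity)
      have e7 := h₀.le_initialPotential hX1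
      have e8 := mul_le_mul_of_nonneg_left hX3 (by positivity : 0 ≤ ε / 2 * X)
      have e9 : ε / 2 * X * (2 * a * C * s₁ / ε) = a * C * X * s₁ := by field_simp
      have e10 := mul_le_mul_of_nonneg_left e7 (by positivity : 0 ≤ ε / 2)
      have e11 : 0 ≤ ε * B := by positivity
      change _ ≤ ε / 2 * V₀ X at e10
      rw [e9] at e8
      linarith
  have averaged : ∀ ε ∈ Ioo (0 : ℝ) 1,
      (1 - ε) * potential a r x₀ t + ε * (V₀ x₀ / 2 - 2 * a * C * x₀ * t - B)
        - a * C * x₀ * δ ≤ potential a r x₀ (δ + t) := fun ε hε =>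
    le_of_forall_pos_le_add fun η hη => by linarith [main ε hε η hη]
  have hlim : Tendsto (fun ε : ℝ => (1 - ε) * potential a r x₀ t
      + ε * (V₀ x₀ / 2 - 2 * a * C * x₀ * t - B) - a * C * x₀ * δ) (𝓝[>] 0)
      (𝓝 (potential a r x₀ t - a * C * x₀ * δ)) := by
    have : Continuous (fun ε : ℝ => (1 - ε) * potential a r x₀ t
      + ε * (V₀ x₀ / 2 - 2 * a * C * x₀ * t - B) - a * C * x₀ * δ) := by fun_prop
    simpa using (this.tendsto 0).mono_left nhdsWithin_le_nhds
  refine le_of_tendsto hlim ?_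
  filter_upwards [Ioo_mem_nhdsGT one_pos] with ε hε
  exact averaged ε hε

/-- A flow with linearly bounded initial datum keeps its linear upper bound for a short time. -/
theorem exists_upper_bound (h : IsFlow a S r rx rxx)
    (h₀ : LinearBounds c C (fun y => r y 0)) (ha : 0 < a) (hS : 0 < S) :
    ∃ s₁ ∈ Ioo 0 S, ∀ s ∈ Ico 0 s₁, ∀ x > 0, r x s ≤ C * x := by
  have hc := h₀.pos
  have hC := h₀.upper_pos
  have hcC : c ≤ C := by
    have := (h₀.lower 1 one_pos).trans (h₀.upper 1 one_pos)
    linarith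
  -- Survival until `s₂` gives the growth rate `D² = a (s₂ - s₁) / 4`, and the barrier needs `8 a C
  -- s₁ < D² c`. The factor `c / (64 C)` meets this with room to spare.
  set s₂ := S / 2 with hs₂
  set s₁ := s₂ * (c / (64 * C)) with hs₁
  have hs₂0 : 0 < s₂ := half_pos hS
  have hs₁0 : 0 < s₁ := by positivity
  have hCs : C * s₁ = c * s₂ / 64 := by rw [hs₁]; field_simp
  have h64 : s₁ ≤ s₂ / 64 := by
    have : C * s₁ ≤ C * (s₂ / 64) := by rw [hCs]; nlinarith
    exact le_of_mul_le_mul_left this hC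
  have hs₁S : s₁ ∈ Ico 0 S := ⟨hs₁0.le, by linarith⟩
  obtain ⟨K, hK⟩ := h.exists_mul_sqrt_log_le_potential h₀ ha hs₁0.le (by linarith : s₁ < s₂)
    (half_lt_self hS)
  have hpos : 0 < a * (s₂ - s₁) := mul_pos ha (by linarith)
  have hV := fun x (hx : x > 0) s (hs : s ∈ Icc 0 s₁) =>
    h.initialPotential_sub_le_potential h₀ ha hs₁S (D := √(a * (s₂ - s₁)) / 2) (by positivity)
      (by
        rw [div_pow, Real.sq_sqrt hpos.le]
        have e1 : 8 * a * C * s₁ = a * (c * s₂ / 8) := by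
          rw [mul_assoc, hCs]; ring
        have e2 : a * (s₂ - s₁) / 2 ^ 2 * c = a * (c * (s₂ - s₁) / 4) := by ring
        rw [e1, e2]
        refine mul_lt_mul_of_pos_left ?_ ha
        nlinarith) hK hx hs
  refine ⟨s₁, ⟨hs₁0, hs₁S.2⟩, fun s hs x hx => ?_⟩
  rcases eq_or_lt_of_le hs.1 with rfl | hs0
  · exact h₀.upper x hx
  have hd := h.hasDerivAt_potential_time hx (s := s) ⟨hs0, hs.2.trans hs₁S.2⟩
  -- On `[s, σ]` the potential drops by at most `a C x (σ - s)`, whereas its time derivative at `s`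
  -- is `-a r`.
  have hle : -(a * (C * x)) ≤ -(a * r x s) := by
    have h1 : Tendsto (slope (fun σ => potential a r x σ) s) (𝓝[>] s) (𝓝 (-(a * r x s))) :=
      (hasDerivAt_iff_tendsto_slope.1 hd).mono_left (nhdsWithin_mono s fun y hy => ne_of_gt hy)
    refine ge_of_tendsto h1 ?_
    filter_upwards [Ioo_mem_nhdsGT hs.2] with σ hσ
    have h2 := h.potential_sub_le_potential_add h₀ ha hs₁S hV (δ := σ - s) (t := s)
      (sub_nonneg.2 hσ.1.le) hs.1 (by linarith [hσ.2]) hx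
    rw [sub_add_cancel] at h2
    rw [slope_def_field, le_div_iff₀ (sub_pos.2 hσ.1)]
    linarith
  exact le_of_mul_le_mul_left (by linarith : a * r x s ≤ a * (C * x)) ha

/-- The line `c x` is a stationary solution. Given `r ≤ C x`, the rate `l = 2 a C²` makes `ε e^{l s}
(1 + x²)` a supersolution of the linear equation with coefficient `a r²`, and it dominates `c x`
once `x ≥ c / ε`, so comparison on a bounded interval suffices. -/
theorem lower_bound_of_upper_bound (h : IsFlow a S r rx rxx) (ha : 0 ≤ a) {s₁ : ℝ}
    (hs₁ : s₁ ∈ Ico 0 S) (hinit : ∀ x > 0, c * x ≤ r x 0)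
    (hupper : ∀ s ∈ Icc 0 s₁, ∀ x > 0, r x s ≤ C * x) {x₀ s : ℝ} (hx₀ : 0 < x₀)
    (hs : s ∈ Icc 0 s₁) : c * x₀ ≤ r x₀ s := by
  set l := 2 * a * C ^ 2 with hl
  have hl0 : 0 ≤ l := by positivity
  have main : ∀ ε > 0, c * x₀ - r x₀ s - ε * (Real.exp (l * s) * (1 + x₀ ^ 2)) ≤ 0 := by
    intro ε hε
    set X := max x₀ (c / ε) with hX
    have hX0 : 0 < X := hx₀.trans_le (le_max_left _ _)
    refine parabolic_maximum_principle (α := 0) (β := X) (S := s₁)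
      (φ := fun x s => c * x - r x s - ε * (Real.exp (l * s) * (1 + x ^ 2)))
      (φx := fun x s => c - rx x s - ε * (Real.exp (l * s) * (2 * x))) ?_ ?_ ?_ ?_ ?_ ?_
      x₀ ⟨hx₀.le, le_max_left _ _⟩ s hs
    · refine ((by fun_prop : ContinuousOn (fun p : ℝ × ℝ => c * p.1) _).sub (h.continuousOn.mono
        (prod_mono Icc_subset_Ici_self fun s hs => ⟨hs.1, hs.2.trans_lt hs₁.2⟩))).sub ?_
      fun_prop
    · intro s hs x hx
      have d1 := h.hasDerivAt x hx.1 s ⟨hs.1, hs.2.trans_lt hs₁.2⟩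
      have d2 := ((((hasDerivAt_id' x).fun_pow 2).const_add 1).const_mul
        (Real.exp (l * s))).const_mul ε
      exact ((((hasDerivAt_id' x).const_mul c).fun_sub d1).fun_sub d2).congr_deriv (by
        push_cast; ring)
    · intro s hs x hx
      have hs' : s ∈ Ioo 0 S := ⟨hs.1, hs.2.trans_lt hs₁.2⟩
      have d1 := h.hasDerivAt_time x hx.1 s hs'
      have d2 := ((((hasDerivAt_id' s).const_mul l).exp).mul_const (1 + x ^ 2)).const_mul ε
      have d3 := h.hasDerivAt_two x hx.1 s hs'
      have d4 := (((hasDerivAt_id' x).const_mul 2).const_mul (Real.exp (l * s))).const_mul ε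
      refine ⟨_, _, (d1.const_sub (c * x)).fun_sub d2, (d3.const_sub c).fun_sub d4, fun hq => ?_⟩
      set E := Real.exp (l * s) with hE
      have hE0 : 0 < E := Real.exp_pos _
      have hr := h.pos x hx.1 s (Ioo_subset_Ico_self hs')
      have hrC := hupper s ⟨hs.1.le, hs.2⟩ x hx.1
      have e1 : r x s ^ 2 ≤ (C * x) ^ 2 := by gcongr
      have e2 : -rxx x s ≤ 2 * (ε * E) := by linarith
      have e3 := mul_le_mul_of_nonneg_left e2 (by positivity : 0 ≤ a * r x s ^ 2)
      have e4 : a * r x s ^ 2 * (2 * (ε * E)) ≤ a * (C * x) ^ 2 * (2 * (ε * E)) := by gcongr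
      have e5 : a * (C * x) ^ 2 * (2 * (ε * E)) = ε * (E * (l * x ^ 2)) := by rw [hl]; ring
      have e6 : 0 ≤ ε * (E * l) := by positivity
      linarith
    · intro x hx
      have : 0 < ε * (Real.exp (l * 0) * (1 + x ^ 2)) := by positivity
      rcases eq_or_lt_of_le hx.1 with h0 | h0
      · rw [← h0, h.zero 0 ⟨le_rfl, hs₁.1.trans_lt hs₁.2⟩]
        have : 0 < ε * (Real.exp (l * 0) * (1 + 0 ^ 2)) := by positivity
        linarith
      · linarith [hinit x h0]
    · intro s hs
      rw [h.zero s ⟨hs.1, hs.2.trans_lt hs₁.2⟩]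
      have : 0 < ε * (Real.exp (l * s) * (1 + 0 ^ 2)) := by positivity
      linarith
    · intro s hs
      have hr := h.pos X hX0 s ⟨hs.1, hs.2.trans_lt hs₁.2⟩
      have e1 : c ≤ X * ε := (div_le_iff₀ hε).1 (le_max_right _ _)
      have e2 : 1 ≤ Real.exp (l * s) := Real.one_le_exp (mul_nonneg hl0 hs.1)
      have e3 : c * X ≤ X * ε * X := mul_le_mul_of_nonneg_right e1 hX0.le
      have e4 : 1 + X ^ 2 ≤ Real.exp (l * s) * (1 + X ^ 2) :=
        le_mul_of_one_le_left (by positivity) e2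
      have e5 := mul_le_mul_of_nonneg_left e4 hε.le
      nlinarith
  have hlim : Tendsto (fun ε : ℝ => c * x₀ - r x₀ s - ε * (Real.exp (l * s) * (1 + x₀ ^ 2)))
      (𝓝[>] 0) (𝓝 (c * x₀ - r x₀ s)) := by
    have : Continuous (fun ε : ℝ => c * x₀ - r x₀ s - ε * (Real.exp (l * s) * (1 + x₀ ^ 2))) := by
      fun_prop
    simpa using (this.tendsto 0).mono_left nhdsWithin_le_nhds
  exact sub_nonpos.1 (le_of_tendsto hlim (eventually_nhdsWithin_of_forall main))

/-- Linear bounds on the initial datum persist for the whole life time of a flow; no growth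
condition on the flow is needed. -/
theorem linearBounds (h : IsFlow a S r rx rxx) (h₀ : LinearBounds c C (fun y => r y 0))
    (ha : 0 < a) {s : ℝ} (hs : s ∈ Ico 0 S) : LinearBounds c C (fun y => r y s) := by
  set E : Set ℝ := {s | ∀ x > 0, c * x ≤ r x s ∧ r x s ≤ C * x} with hE
  -- Continuation in time: the good times form a closed set, and restarting at any of them
  -- reproduces the same `c` and `C` on a short interval. The length of that interval need not be
  -- uniform.
  have hsub : Icc 0 s ⊆ E := by
    refine IsClosed.Icc_subset_of_forall_mem_nhdsWithin ?_ ?_ ?_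
    · have : E ∩ Icc 0 s = Icc 0 s ∩ ⋂ x ∈ Ioi (0 : ℝ),
          (Icc 0 s ∩ (fun σ => r x σ) ⁻¹' Icc (c * x) (C * x)) := by
        ext σ
        simp only [hE, mem_inter_iff, mem_ofPred_eq, mem_iInter, mem_preimage, mem_Icc, mem_Ioi]
        constructor
        · exact fun hh => ⟨hh.2, fun x hx => ⟨hh.2, hh.1 x hx⟩⟩
        · exact fun hh => ⟨fun x hx => (hh.2 x hx).2, hh.1⟩
      rw [this]
      refine isClosed_Icc.inter (isClosed_biInter fun x hx => ?_)
      refine ContinuousOn.preimage_isClosed_of_isClosed ?_ isClosed_Icc isClosed_Icc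
      exact (h.continuousOn_time (le_of_lt hx)).mono fun σ hσ => ⟨hσ.1, hσ.2.trans_lt hs.2⟩
    · exact fun x hx => ⟨h₀.lower x hx, h₀.upper x hx⟩
    · rintro σ ⟨hσE, hσ⟩
      have hσS : σ ∈ Ico 0 S := ⟨hσ.1, hσ.2.trans hs.2⟩
      have hsh := h.shift hσS
      have hb : LinearBounds c C (fun y => r y (σ + 0)) := by
        rw [add_zero]
        exact ⟨h₀.pos, (h.continuousOn_space hσS).mono Ioi_subset_Ici_self,
          fun x hx => (hσE x hx).1, fun x hx => (hσE x hx).2⟩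
      obtain ⟨s₁, hs₁, hup⟩ := hsh.exists_upper_bound hb ha (sub_pos.2 hσS.2)
      have hmem : Ioo σ (σ + s₁) ∈ 𝓝[>] σ := Ioo_mem_nhdsGT (by linarith [hs₁.1])
      refine mem_of_superset hmem fun t ht x hx => ?_
      have ht1 : t - σ ∈ Ico 0 s₁ := ⟨by linarith [ht.1], by linarith [ht.2]⟩
      have e1 := hup (t - σ) ht1 x hx
      have e2 := hsh.lower_bound_of_upper_bound ha.le (s₁ := t - σ) (C := C)
        ⟨ht1.1, ht1.2.trans hs₁.2⟩ hb.lower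
        (fun τ hτ y hy => hup τ ⟨hτ.1, hτ.2.trans_lt ht1.2⟩ y hy) hx ⟨ht1.1, le_rfl⟩
      simp only [add_sub_cancel] at e1 e2
      exact ⟨e2, e1⟩
  have := hsub (right_mem_Icc.2 hs.1)
  exact ⟨h₀.pos, (h.continuousOn_space hs).mono Ioi_subset_Ici_self,
    fun x hx => (this x hx).1, fun x hx => (this x hx).2⟩

end IsFlow

/-! ### Regularized positive part and Kato's inequality. -/

theorem hasDerivAt_sq_max_zero (z : ℝ) : HasDerivAt (fun z : ℝ => max z 0 ^ 2) (2 * max z 0) z := by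
  rcases lt_trichotomy z 0 with h | h | h
  · rw [max_eq_right h.le, mul_zero]
    refine (hasDerivAt_const z (0 : ℝ)).congr_of_eventuallyEq ?_
    filter_upwards [Iio_mem_nhds h] with y hy
    rw [max_eq_right (le_of_lt hy)]; simp
  · subst h
    rw [max_self, mul_zero, hasDerivAt_iff_tendsto_slope]
    have h1 : Tendsto (fun y : ℝ => max y 0) (𝓝[≠] 0) (𝓝 0) := by
      have : Continuous fun y : ℝ => max y 0 := by fun_prop
      simpa using (this.tendsto 0).mono_left nhdsWithin_le_nhds
    refine h1.congr' ?_
    filter_upwards [self_mem_nhdsWithin] with y hy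
    have hy0 : y ≠ 0 := hy
    rw [slope_def_field, max_self]
    rcases le_total y 0 with h2 | h2
    · rw [max_eq_right h2]; simp
    · rw [max_eq_left h2]; field_simp; ring
  · rw [max_eq_left h.le]
    refine ((hasDerivAt_pow 2 z).congr_of_eventuallyEq ?_).congr_deriv (by push_cast; ring)
    filter_upwards [Ioi_mem_nhds h] with y hy
    rw [max_eq_left (le_of_lt hy)]

/-- A smooth approximation of the indicator function of `(0, ∞)`. -/
noncomputable def stepApprox (η z : ℝ) : ℝ := max z 0 ^ 2 / (max z 0 ^ 2 + η)

/-- The primitive of `stepApprox η`, an approximation of the positive part. -/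
noncomputable def posApprox (η z : ℝ) : ℝ := ∫ ζ in (0 : ℝ)..z, stepApprox η ζ

section Approx

variable {η : ℝ}

theorem stepApprox_nonneg (hη : 0 < η) (z : ℝ) : 0 ≤ stepApprox η z := by
  rw [stepApprox]; positivity

theorem stepApprox_le_one (hη : 0 < η) (z : ℝ) : stepApprox η z ≤ 1 := by
  rw [stepApprox, div_le_one (by positivity)]
  linarith

theorem stepApprox_of_nonpos {z : ℝ} (hz : z ≤ 0) : stepApprox η z = 0 := by
  rw [stepApprox, max_eq_right hz]; simp

theorem hasDerivAt_stepApprox (hη : 0 < η) (z : ℝ) :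
    HasDerivAt (stepApprox η) (2 * max z 0 * η / (max z 0 ^ 2 + η) ^ 2) z := by
  refine ((hasDerivAt_sq_max_zero z).fun_div ((hasDerivAt_sq_max_zero z).add_const η)
    (by positivity)).congr_deriv ?_
  congr 1
  ring

theorem continuous_stepApprox (hη : 0 < η) : Continuous (stepApprox η) :=
  continuous_iff_continuousAt.2 fun z => (hasDerivAt_stepApprox hη z).continuousAt

theorem hasDerivAt_posApprox (hη : 0 < η) (z : ℝ) :
    HasDerivAt (posApprox η) (stepApprox η z) z :=
  intervalIntegral.integral_hasDerivAt_right ((continuous_stepApprox hη).intervalIntegrable (μ := volume) _ _)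
    (continuous_stepApprox hη).aestronglyMeasurable.stronglyMeasurableAtFilter
    (continuous_stepApprox hη).continuousAt

theorem continuous_posApprox (hη : 0 < η) : Continuous (posApprox η) :=
  continuous_iff_continuousAt.2 fun z => (hasDerivAt_posApprox hη z).continuousAt

theorem posApprox_of_nonpos {z : ℝ} (hz : z ≤ 0) : posApprox η z = 0 := by
  have : posApprox η z = ∫ _ in (0 : ℝ)..z, (0 : ℝ) := by
    refine intervalIntegral.integral_congr fun ζ hζ => ?_
    rw [uIcc_of_ge hz] at hζ
    exact stepApprox_of_nonpos hζ.2
  rw [this]; simp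

theorem posApprox_nonneg (hη : 0 < η) (z : ℝ) : 0 ≤ posApprox η z := by
  rcases le_total z 0 with hz | hz
  · rw [posApprox_of_nonpos hz]
  · exact intervalIntegral.integral_nonneg hz fun ζ _ => stepApprox_nonneg hη ζ

theorem posApprox_le (hη : 0 < η) (z : ℝ) : posApprox η z ≤ max z 0 := by
  rcases le_total z 0 with hz | hz
  · rw [posApprox_of_nonpos hz, max_eq_right hz]
  · rw [max_eq_left hz]
    have := intervalIntegral.integral_mono_on (μ := volume) hz
      ((continuous_stepApprox hη).intervalIntegrable 0 z)
      (continuous_const (y := (1 : ℝ)).intervalIntegrable (μ := volume) 0 z)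
      fun ζ _ => stepApprox_le_one hη ζ
    simpa [posApprox] using this

theorem tendsto_stepApprox (z : ℝ) :
    Tendsto (fun n : ℕ => stepApprox (1 / ((n : ℝ) + 1)) z) atTop
      (𝓝 (if 0 < z then 1 else 0)) := by
  split_ifs with h
  · have h0 : max z 0 ^ 2 ≠ 0 := by rw [max_eq_left h.le]; positivity
    have h1 := tendsto_one_div_add_atTop_nhds_zero_nat (𝕜 := ℝ)
    have h2 := (tendsto_const_nhds (x := max z 0 ^ 2)).div (h1.const_add (max z 0 ^ 2))
      (by simpa using h0)
    rw [add_zero, div_self h0] at h2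
    exact h2
  · simp [stepApprox_of_nonpos (not_lt.1 h)]

theorem tendsto_integral_stepApprox {z g : ℝ → ℝ} {s t : ℝ} (hz : ContinuousOn z (uIcc s t))
    (hg : ContinuousOn g (uIcc s t)) :
    Tendsto (fun n : ℕ => ∫ σ in s..t, stepApprox (1 / ((n : ℝ) + 1)) (z σ) * g σ) atTop
      (𝓝 (∫ σ in s..t, (if 0 < z σ then 1 else 0) * g σ)) := by
  refine intervalIntegral.tendsto_integral_filter_of_dominated_convergence (fun σ => |g σ|)
    (Eventually.of_forall fun n => ?_) (Eventually.of_forall fun n => ?_) ?_ ?_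
  · have hc : ContinuousOn (fun σ => stepApprox (1 / ((n : ℝ) + 1)) (z σ) * g σ) (uIcc s t) :=
      ((continuous_stepApprox (by positivity)).comp_continuousOn hz).mul hg
    exact (hc.mono uIoc_subset_uIcc).aestronglyMeasurable measurableSet_uIoc
  · refine Eventually.of_forall fun σ _ => ?_
    have hn : (0 : ℝ) < 1 / ((n : ℝ) + 1) := by positivity
    rw [norm_mul, Real.norm_of_nonneg (stepApprox_nonneg hn _), Real.norm_eq_abs]
    exact mul_le_of_le_one_left (abs_nonneg _) (stepApprox_le_one hn _)
  · exact hg.abs.intervalIntegrable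
  · exact Eventually.of_forall fun σ _ => (tendsto_stepApprox (z σ)).mul_const (g σ)

theorem tendsto_posApprox (z : ℝ) :
    Tendsto (fun n : ℕ => posApprox (1 / ((n : ℝ) + 1)) z) atTop (𝓝 (max z 0)) := by
  rcases le_total z 0 with hz | hz
  · simp [posApprox_of_nonpos hz, max_eq_right hz]
  · have h1 := tendsto_integral_stepApprox (z := fun ζ => ζ) (g := fun _ => 1) (s := 0) (t := z)
      continuousOn_id continuousOn_const
    have h2 : ∫ σ in (0 : ℝ)..z, (if 0 < σ then (1 : ℝ) else 0) * 1 = max z 0 := by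
      have : ∫ σ in (0 : ℝ)..z, (if 0 < σ then (1 : ℝ) else 0) * 1 = ∫ _ in (0 : ℝ)..z, (1 : ℝ) := by
        refine intervalIntegral.integral_congr_ae (Eventually.of_forall fun σ hσ => ?_)
        rw [uIoc_of_le hz] at hσ
        simp [hσ.1]
      rw [this, max_eq_left hz]; simp
    rw [h2] at h1
    simpa [posApprox] using h1

/-- Chain rule for the positive part, with a multiplier having the same sign as the function. -/
theorem tendsto_integral_stepApprox_mul_deriv {z N N' : ℝ → ℝ} {s t : ℝ}
    (hz : ContinuousOn z (uIcc s t)) (hN : ∀ σ ∈ uIcc s t, HasDerivAt N (N' σ) σ)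
    (hN' : ContinuousOn N' (uIcc s t)) (hsign : ∀ σ ∈ uIcc s t, 0 < z σ ↔ 0 < N σ) :
    Tendsto (fun n : ℕ => ∫ σ in s..t, stepApprox (1 / ((n : ℝ) + 1)) (z σ) * N' σ) atTop
      (𝓝 (max (N t) 0 - max (N s) 0)) := by
  have hNc : ContinuousOn N (uIcc s t) := fun σ hσ => (hN σ hσ).continuousAt.continuousWithinAt
  have h1 := tendsto_integral_stepApprox hz hN'
  have h2 := tendsto_integral_stepApprox hNc hN'
  have e : ∫ σ in s..t, (if 0 < z σ then (1 : ℝ) else 0) * N' σ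
      = ∫ σ in s..t, (if 0 < N σ then (1 : ℝ) else 0) * N' σ :=
    intervalIntegral.integral_congr fun σ hσ => by simp only [hsign σ hσ]
  rw [e] at h1
  have h3 := (tendsto_posApprox (N t)).sub (tendsto_posApprox (N s))
  have h4 : (fun n : ℕ => ∫ σ in s..t, stepApprox (1 / ((n : ℝ) + 1)) (N σ) * N' σ)
      = fun n : ℕ => posApprox (1 / ((n : ℝ) + 1)) (N t) - posApprox (1 / ((n : ℝ) + 1)) (N s) := by
    ext n
    have hn : (0 : ℝ) < 1 / ((n : ℝ) + 1) := by positivity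
    refine intervalIntegral.integral_eq_sub_of_hasDerivAt
      (f := fun σ => posApprox (1 / ((n : ℝ) + 1)) (N σ))
      (fun σ hσ => (hasDerivAt_posApprox hn _).comp σ (hN σ hσ)) ?_
    exact (((continuous_stepApprox hn).comp_continuousOn hNc).mul hN').intervalIntegrable
  rw [h4] at h2
  rw [tendsto_nhds_unique h3 h2]
  exact h1

/-- Kato's inequality, integrated against a convex weight. -/
theorem integral_mul_stepApprox_le (hη : 0 < η) {α β : ℝ} (hαβ : α ≤ β)
    {f f' f'' φ φ' φ'' : ℝ → ℝ}
    (hf : ∀ x ∈ Icc α β, HasDerivAt f (f' x) x) (hf' : ∀ x ∈ Icc α β, HasDerivAt f' (f'' x) x)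
    (hf'' : ContinuousOn f'' (Icc α β)) (hφ : ∀ x ∈ Icc α β, HasDerivAt φ (φ' x) x)
    (hφ' : ∀ x ∈ Icc α β, HasDerivAt φ' (φ'' x) x) (hφ'' : ContinuousOn φ'' (Icc α β))
    (hφ0 : ∀ x ∈ Icc α β, 0 ≤ φ x) :
    ∫ x in α..β, φ x * (stepApprox η (f x) * f'' x) ≤
      (φ β * (stepApprox η (f β) * f' β) - φ' β * posApprox η (f β))
      - (φ α * (stepApprox η (f α) * f' α) - φ' α * posApprox η (f α))
      + ∫ x in α..β, φ'' x * posApprox η (f x) := by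
  have cf : ContinuousOn f (Icc α β) := fun x hx => (hf x hx).continuousAt.continuousWithinAt
  have cf' : ContinuousOn f' (Icc α β) := fun x hx => (hf' x hx).continuousAt.continuousWithinAt
  have cφ : ContinuousOn φ (Icc α β) := fun x hx => (hφ x hx).continuousAt.continuousWithinAt
  have c1 := (continuous_stepApprox hη).comp_continuousOn cf
  have c2 := (continuous_posApprox hη).comp_continuousOn cf
  set H' : ℝ → ℝ := fun z => 2 * max z 0 * η / (max z 0 ^ 2 + η) ^ 2 with hH'
  have cH' : Continuous H' := by
    have : ∀ z : ℝ, (max z 0 ^ 2 + η) ^ 2 ≠ 0 := fun z => by positivity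
    exact Continuous.div (by fun_prop) (by fun_prop) this
  have c3 := cH'.comp_continuousOn cf
  have i1 : IntervalIntegrable (fun x => φ x * (stepApprox η (f x) * f'' x)) volume α β :=
    (cφ.mul (c1.mul hf'')).intervalIntegrable_of_Icc hαβ
  have i2 : IntervalIntegrable (fun x => φ'' x * posApprox η (f x)) volume α β :=
    (hφ''.mul c2).intervalIntegrable_of_Icc hαβ
  have i3 : IntervalIntegrable (fun x => φ x * (H' (f x) * f' x ^ 2)) volume α β :=
    (cφ.mul (c3.mul (cf'.pow 2))).intervalIntegrable_of_Icc hαβ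
  have hFTC := intervalIntegral.integral_eq_sub_of_hasDerivAt (a := α) (b := β)
    (f := fun x => φ x * (stepApprox η (f x) * f' x) - φ' x * posApprox η (f x))
    (f' := fun x => φ x * (H' (f x) * f' x ^ 2) + φ x * (stepApprox η (f x) * f'' x)
      - φ'' x * posApprox η (f x)) ?_ ((i3.add i1).sub i2)
  · rw [intervalIntegral.integral_sub (i3.add i1) i2, intervalIntegral.integral_add i3 i1] at hFTC
    -- The one term that is discarded, nonnegative because `stepApprox` is nondecreasing; the rest
    -- is two integrations by parts.
    have : 0 ≤ ∫ x in α..β, φ x * (H' (f x) * f' x ^ 2) :=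
      intervalIntegral.integral_nonneg hαβ fun x hx =>
        mul_nonneg (hφ0 x hx) (mul_nonneg (by simp only [hH']; positivity) (sq_nonneg _))
    linarith
  · intro x hx
    rw [uIcc_of_le hαβ] at hx
    have d1 := (hasDerivAt_stepApprox hη (f x)).comp x (hf x hx)
    have d2 := (hasDerivAt_posApprox hη (f x)).comp x (hf x hx)
    refine (((hφ x hx).fun_mul (d1.fun_mul (hf' x hx))).fun_sub
      ((hφ' x hx).fun_mul d2)).congr_deriv ?_
    simp only [Function.comp, hH']
    ring

end Approx

/-! ### Grönwall's inequality and the weights. -/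

/-- Integral form of Grönwall's inequality. -/
theorem le_exp_of_le_integral {J : ℝ → ℝ} {s₁ e l : ℝ} (hl : 0 < l)
    (hJ : ContinuousOn J (Icc 0 s₁))
    (h : ∀ s ∈ Icc 0 s₁, J s ≤ ∫ σ in (0 : ℝ)..s, (e + l * J σ)) {s : ℝ} (hs : s ∈ Icc 0 s₁) :
    l * J s + e ≤ e * Real.exp (l * s) := by
  rcases eq_or_lt_of_le hs.1 with rfl | hs0
  · have := h 0 hs
    rw [intervalIntegral.integral_same] at this
    rw [mul_zero, Real.exp_zero]
    nlinarith
  set G := fun s => ∫ σ in (0 : ℝ)..s, (e + l * J σ) with hG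
  have hc : ContinuousOn (fun σ => e + l * J σ) (Icc 0 s₁) :=
    continuousOn_const.add (continuousOn_const.mul hJ)
  have hGc : ContinuousOn G (Icc 0 s) := by
    have := intervalIntegral.continuousOn_primitive_interval (μ := volume)
      (f := fun σ => e + l * J σ) (a := 0) (b := s)
      ((hc.mono (by rw [uIcc_of_le hs.1]; exact Icc_subset_Icc_right hs.2)).integrableOn_compact
        isCompact_uIcc)
    rwa [uIcc_of_le hs.1] at this
  have hGd : ∀ t ∈ Ioo 0 s, HasDerivAt G (e + l * J t) t := fun t ht => by
    have hsub : Ioo 0 s ⊆ Icc 0 s₁ := fun y hy => ⟨hy.1.le, hy.2.le.trans hs.2⟩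
    refine intervalIntegral.integral_hasDerivAt_right ?_
      ((hc.mono hsub).stronglyMeasurableAtFilter isOpen_Ioo t ht)
      ((hc.mono hsub).continuousAt (Ioo_mem_nhds ht.1 ht.2))
    exact (hc.mono (Icc_subset_Icc_right (ht.2.le.trans hs.2))).intervalIntegrable_of_Icc ht.1.le
  have hPd : ∀ t ∈ Ioo 0 s, HasDerivAt (fun t => Real.exp (-(l * t)) * (l * G t + e))
      (Real.exp (-(l * t)) * (l * (l * (J t - G t)))) t := fun t ht => by
    have d1 := ((hasDerivAt_id' t).const_mul l).fun_neg.exp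
    exact (d1.fun_mul (((hGd t ht).const_mul l).add_const e)).congr_deriv (by ring)
  have hanti : AntitoneOn (fun t => Real.exp (-(l * t)) * (l * G t + e)) (Icc 0 s) := by
    refine antitoneOn_of_deriv_nonpos (convex_Icc 0 s) ?_ ?_ ?_
    · exact (by fun_prop : ContinuousOn (fun t => Real.exp (-(l * t))) _).mul
        ((continuousOn_const.mul hGc).add continuousOn_const)
    · rw [interior_Icc]
      exact fun t ht => (hPd t ht).differentiableAt.differentiableWithinAt
    · rw [interior_Icc]
      intro t ht
      rw [(hPd t ht).deriv]
      have : J t ≤ G t := h t ⟨ht.1.le, ht.2.le.trans hs.2⟩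
      have h1 : l * (l * (J t - G t)) ≤ 0 :=
        mul_nonpos_of_nonneg_of_nonpos hl.le
          (mul_nonpos_of_nonneg_of_nonpos hl.le (by linarith))
      exact mul_nonpos_of_nonneg_of_nonpos (Real.exp_pos _).le h1
  have h1 := hanti ⟨le_rfl, hs0.le⟩ ⟨hs0.le, le_rfl⟩ hs0.le
  simp only [mul_zero, neg_zero, Real.exp_zero, one_mul, Real.exp_neg] at h1
  have hG0 : G 0 = 0 := intervalIntegral.integral_same
  rw [hG0, mul_zero, zero_add, inv_mul_le_iff₀ (Real.exp_pos _)] at h1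
  have h2 : J s ≤ G s := h s hs
  nlinarith

/-- A solution of `x² φ'' = 2 φ` on `(0, ∞)` vanishing at `x = 1 / X`. -/
noncomputable def innerWeight (X x : ℝ) : ℝ := x ^ 2 - (X ^ 3)⁻¹ * x⁻¹

/-- A solution of `x² φ'' = 2 φ` on `(0, ∞)` vanishing at `x = X`. -/
noncomputable def outerWeight (X x : ℝ) : ℝ := x⁻¹ - (X ^ 3)⁻¹ * x ^ 2

theorem hasDerivAt_innerWeight (X : ℝ) {x : ℝ} (hx : 0 < x) :
    HasDerivAt (innerWeight X) (2 * x + (X ^ 3)⁻¹ * (x ^ 2)⁻¹) x :=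
  ((hasDerivAt_pow 2 x).fun_sub ((hasDerivAt_inv hx.ne').const_mul _)).congr_deriv (by
    push_cast; ring)

theorem hasDerivAt_outerWeight (X : ℝ) {x : ℝ} (hx : 0 < x) :
    HasDerivAt (outerWeight X) (-(x ^ 2)⁻¹ - (X ^ 3)⁻¹ * (2 * x)) x :=
  ((hasDerivAt_inv hx.ne').fun_sub ((hasDerivAt_pow 2 x).const_mul _)).congr_deriv (by
    push_cast; ring)

theorem hasDerivAt_inv_sq {x : ℝ} (hx : 0 < x) :
    HasDerivAt (fun x : ℝ => (x ^ 2)⁻¹) (-(2 * (x ^ 3)⁻¹)) x :=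
  ((hasDerivAt_pow 2 x).fun_inv (by positivity)).congr_deriv (by push_cast; field_simp)

theorem hasDerivAt_innerWeight_two (X : ℝ) {x : ℝ} (hx : 0 < x) :
    HasDerivAt (fun x => 2 * x + (X ^ 3)⁻¹ * (x ^ 2)⁻¹) (2 * innerWeight X x / x ^ 2) x :=
  (((hasDerivAt_id' x).const_mul 2).fun_add ((hasDerivAt_inv_sq hx).const_mul _)).congr_deriv (by
    rw [innerWeight, mul_sub, sub_div]
    field_simp
    ring)

theorem hasDerivAt_outerWeight_two (X : ℝ) {x : ℝ} (hx : 0 < x) :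
    HasDerivAt (fun x => -(x ^ 2)⁻¹ - (X ^ 3)⁻¹ * (2 * x)) (2 * outerWeight X x / x ^ 2) x :=
  ((hasDerivAt_inv_sq hx).fun_neg.fun_sub
    (((hasDerivAt_id' x).const_mul 2).const_mul _)).congr_deriv (by
    rw [outerWeight, mul_sub, sub_div]
    field_simp)

theorem innerWeight_nonneg {X x : ℝ} (hX : 0 < X) (hx : 1 / X ≤ x) : 0 ≤ innerWeight X x := by
  have hx0 : 0 < x := lt_of_lt_of_le (by positivity) hx
  have h1 : 1 ≤ X * x := by rwa [div_le_iff₀' hX] at hx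
  have h2 : innerWeight X x = ((X * x) ^ 3 - 1) / (X ^ 3 * x) := by
    rw [innerWeight]; field_simp
  rw [h2]
  have : 1 ≤ (X * x) ^ 3 := one_le_pow₀ h1
  exact div_nonneg (by linarith) (by positivity)

theorem innerWeight_pos {X x : ℝ} (hX : 0 < X) (hx : 1 / X < x) : 0 < innerWeight X x := by
  have hx0 : 0 < x := lt_trans (by positivity) hx
  have h1 : 1 < X * x := by rwa [div_lt_iff₀' hX] at hx
  have h2 : innerWeight X x = ((X * x) ^ 3 - 1) / (X ^ 3 * x) := by
    rw [innerWeight]; field_simp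
  rw [h2]
  have : 1 < (X * x) ^ 3 := one_lt_pow₀ h1 (by norm_num)
  exact div_pos (by linarith) (by positivity)

theorem outerWeight_nonneg {X x : ℝ} (hx0 : 0 < x) (hx : x ≤ X) : 0 ≤ outerWeight X x := by
  have hX : 0 < X := hx0.trans_le hx
  have h2 : outerWeight X x = (X ^ 3 - x ^ 3) / (X ^ 3 * x) := by
    rw [outerWeight]; field_simp
  rw [h2]
  have : x ^ 3 ≤ X ^ 3 := by gcongr
  exact div_nonneg (by linarith) (by positivity)

theorem outerWeight_pos {X x : ℝ} (hx0 : 0 < x) (hx : x < X) : 0 < outerWeight X x := by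
  have hX : 0 < X := hx0.trans hx
  have h2 : outerWeight X x = (X ^ 3 - x ^ 3) / (X ^ 3 * x) := by
    rw [outerWeight]; field_simp
  rw [h2]
  have : x ^ 3 < X ^ 3 := by gcongr
  exact div_pos (by linarith) (by positivity)

/-- Monotonicity in the cutoff lets the excess for a fixed cutoff be bounded by the excess for every
larger one, which tends to zero. -/
theorem innerWeight_mono {X Y x : ℝ} (hX : 0 < X) (hXY : X ≤ Y) (hx : 0 < x) :
    innerWeight X x ≤ innerWeight Y x := by
  have : (Y ^ 3)⁻¹ ≤ (X ^ 3)⁻¹ := by gcongr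
  rw [innerWeight, innerWeight]
  gcongr

theorem outerWeight_mono {X Y x : ℝ} (hX : 0 < X) (hXY : X ≤ Y) :
    outerWeight X x ≤ outerWeight Y x := by
  have : (Y ^ 3)⁻¹ ≤ (X ^ 3)⁻¹ := by gcongr
  rw [outerWeight, outerWeight]
  gcongr

theorem continuousOn_innerWeight (X : ℝ) : ContinuousOn (innerWeight X) (Ioi 0) := fun _ hx =>
  (hasDerivAt_innerWeight X hx).continuousAt.continuousWithinAt

theorem continuousOn_outerWeight (X : ℝ) : ContinuousOn (outerWeight X) (Ioi 0) := fun _ hx =>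
  (hasDerivAt_outerWeight X hx).continuousAt.continuousWithinAt

/-! ### Weighted `L¹` comparison of flows. -/

/-- The weighted integral of the positive part of `1 / r₂ - 1 / r₁`. -/
noncomputable def reciprocalExcess (r₁ r₂ : ℝ → ℝ → ℝ) (φ : ℝ → ℝ) (α β s : ℝ) : ℝ :=
  ∫ x in α..β, φ x * max ((r₂ x s)⁻¹ - (r₁ x s)⁻¹) 0

/-- Returns from `r₁ - r₂` to the difference of reciprocals, via `u - v = u v (1/v - 1/u)`. -/
theorem max_sub_le_mul {u v B : ℝ} (hu : 0 < u) (hv : 0 < v) (h : u * v ≤ B) :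
    max (u - v) 0 ≤ B * max (v⁻¹ - u⁻¹) 0 := by
  have e : u - v = u * v * (v⁻¹ - u⁻¹) := by field_simp
  have huv : 0 < u * v := mul_pos hu hv
  rw [e]
  refine max_le ?_ (mul_nonneg (huv.le.trans h) (le_max_right _ _))
  calc u * v * (v⁻¹ - u⁻¹) ≤ u * v * max (v⁻¹ - u⁻¹) 0 :=
        mul_le_mul_of_nonneg_left (le_max_left _ _) huv.le
    _ ≤ B * max (v⁻¹ - u⁻¹) 0 := mul_le_mul_of_nonneg_right h (le_max_right _ _)

namespace IsFlow

variable {a S C : ℝ} {r₁ r₁x r₁xx r₂ r₂x r₂xx : ℝ → ℝ → ℝ} {φ : ℝ → ℝ} {α β : ℝ}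

theorem continuousOn_excess_integrand (h₁ : IsFlow a S r₁ r₁x r₁xx) (h₂ : IsFlow a S r₂ r₂x r₂xx)
    (hφ : ContinuousOn φ (Icc α β)) (hα : 0 < α) : ContinuousOn
      (fun p : ℝ × ℝ => φ p.1 * max ((r₂ p.1 p.2)⁻¹ - (r₁ p.1 p.2)⁻¹) 0)
      (Icc α β ×ˢ Ico 0 S) := by
  have hsub : Icc α β ×ˢ Ico 0 S ⊆ Ioi 0 ×ˢ Ico 0 S :=
    prod_mono (fun x hx => hα.trans_le hx.1) Subset.rfl
  exact (hφ.comp continuousOn_fst fun p hp => hp.1).mul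
    (((h₂.continuousOn_inv.mono hsub).sub (h₁.continuousOn_inv.mono hsub)).sup continuousOn_const)

theorem continuousOn_excess_space (h₁ : IsFlow a S r₁ r₁x r₁xx) (h₂ : IsFlow a S r₂ r₂x r₂xx)
    (hφ : ContinuousOn φ (Icc α β)) (hα : 0 < α) {s : ℝ} (hs : s ∈ Ico 0 S) : ContinuousOn
      (fun x => φ x * max ((r₂ x s)⁻¹ - (r₁ x s)⁻¹) 0) (Icc α β) :=
  (h₁.continuousOn_excess_integrand h₂ hφ hα).comp (f := fun x => (x, s)) (by fun_prop)
    fun _ hx => ⟨hx, hs⟩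

theorem continuousOn_reciprocalExcess (h₁ : IsFlow a S r₁ r₁x r₁xx)
    (h₂ : IsFlow a S r₂ r₂x r₂xx) (hφ : ContinuousOn φ (Icc α β)) (hα : 0 < α) (hαβ : α ≤ β)
    {s₁ : ℝ} (hs₁ : s₁ ∈ Ico 0 S) :
    ContinuousOn (reciprocalExcess r₁ r₂ φ α β) (Icc 0 s₁) := by
  have := continuousOn_integral_rectangle (α := α) (β := β) (σ₀ := 0) (σ₁ := s₁)
    (f := fun x s => φ x * max ((r₂ x s)⁻¹ - (r₁ x s)⁻¹) 0) (by
      rw [uIcc_of_le hαβ, uIcc_of_le hs₁.1]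
      exact (h₁.continuousOn_excess_integrand h₂ hφ hα).mono (prod_mono Subset.rfl
        fun s hs => ⟨hs.1, hs.2.trans_lt hs₁.2⟩))
  rwa [uIcc_of_le hs₁.1] at this

theorem continuousOn_kato_integrand (h₁ : IsFlow a S r₁ r₁x r₁xx) (h₂ : IsFlow a S r₂ r₂x r₂xx)
    (hφ : ContinuousOn φ (Icc α β)) (hα : 0 < α) {η : ℝ} (hη : 0 < η) : ContinuousOn
      (fun p : ℝ × ℝ => φ p.1 * (stepApprox η (r₁ p.1 p.2 - r₂ p.1 p.2)
        * (a * (r₁xx p.1 p.2 - r₂xx p.1 p.2)))) (Icc α β ×ˢ Ioo 0 S) := by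
  have hsub : Icc α β ×ˢ Ioo 0 S ⊆ Ioi 0 ×ˢ Ioo 0 S :=
    prod_mono (fun x hx => hα.trans_le hx.1) Subset.rfl
  have hsub' : Icc α β ×ˢ Ioo 0 S ⊆ Ici 0 ×ˢ Ico 0 S :=
    prod_mono (fun x hx => hα.le.trans hx.1) Ioo_subset_Ico_self
  exact (hφ.comp continuousOn_fst fun p hp => hp.1).mul
    (((continuous_stepApprox hη).comp_continuousOn
      ((h₁.continuousOn.mono hsub').sub (h₂.continuousOn.mono hsub'))).mul
      (continuousOn_const.mul
        ((h₁.continuousOn_two.mono hsub).sub (h₂.continuousOn_two.mono hsub))))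

theorem hasDerivAt_inv_sub_inv (h₁ : IsFlow a S r₁ r₁x r₁xx) (h₂ : IsFlow a S r₂ r₂x r₂xx)
    {x s : ℝ} (hx : 0 < x) (hs : s ∈ Ioo 0 S) :
    HasDerivAt (fun σ => (r₂ x σ)⁻¹ - (r₁ x σ)⁻¹) (a * (r₁xx x s - r₂xx x s)) s :=
  ((h₂.hasDerivAt_inv_time hx hs).fun_sub (h₁.hasDerivAt_inv_time hx hs)).congr_deriv (by ring)

/-- The time increment of the weighted excess as a limit of regularized fluxes. -/
theorem tendsto_reciprocalExcess_sub (h₁ : IsFlow a S r₁ r₁x r₁xx)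
    (h₂ : IsFlow a S r₂ r₂x r₂xx) (hφ : ContinuousOn φ (Icc α β)) (hα : 0 < α) (hαβ : α ≤ β)
    {s t : ℝ} (hs : 0 < s) (hst : s ≤ t) (ht : t < S) :
    Tendsto (fun n : ℕ => ∫ σ in s..t, ∫ x in α..β, φ x *
      (stepApprox (1 / ((n : ℝ) + 1)) (r₁ x σ - r₂ x σ) * (a * (r₁xx x σ - r₂xx x σ)))) atTop
      (𝓝 (reciprocalExcess r₁ r₂ φ α β t - reciprocalExcess r₁ r₂ φ α β s)) := by
  have hIcc : Icc s t ⊆ Ioo 0 S := fun σ hσ => ⟨hs.trans_le hσ.1, hσ.2.trans_lt ht⟩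
  have hrect : Icc α β ×ˢ Icc s t ⊆ Ioi 0 ×ˢ Ioo 0 S :=
    prod_mono (fun x hx => hα.trans_le hx.1) hIcc
  have hsm : s ∈ Ico 0 S := ⟨hs.le, hst.trans_lt ht⟩
  have htm : t ∈ Ico 0 S := ⟨hs.le.trans hst, ht⟩
  have hD : ContinuousOn (fun p : ℝ × ℝ => a * (r₁xx p.1 p.2 - r₂xx p.1 p.2))
      (Icc α β ×ˢ Icc s t) := continuousOn_const.mul
    ((h₁.continuousOn_two.mono hrect).sub (h₂.continuousOn_two.mono hrect))
  obtain ⟨M, hM⟩ := (isCompact_Icc.prod isCompact_Icc).exists_bound_of_continuousOn hD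
  have hn : ∀ n : ℕ, (0 : ℝ) < 1 / ((n : ℝ) + 1) := fun n => by positivity
  have hswap : ∀ n : ℕ, ∫ σ in s..t, ∫ x in α..β, φ x *
      (stepApprox (1 / ((n : ℝ) + 1)) (r₁ x σ - r₂ x σ) * (a * (r₁xx x σ - r₂xx x σ)))
      = ∫ x in α..β, φ x * ∫ σ in s..t,
        stepApprox (1 / ((n : ℝ) + 1)) (r₁ x σ - r₂ x σ) * (a * (r₁xx x σ - r₂xx x σ)) := by
    intro n
    rw [← integral_swap_rectangle (f := fun x σ => φ x *
      (stepApprox (1 / ((n : ℝ) + 1)) (r₁ x σ - r₂ x σ) * (a * (r₁xx x σ - r₂xx x σ))))]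
    · simp only [intervalIntegral.integral_const_mul]
    · rw [uIcc_of_le hαβ, uIcc_of_le hst]
      exact (h₁.continuousOn_kato_integrand h₂ hφ hα (hn n)).mono (prod_mono Subset.rfl hIcc)
  simp only [hswap]
  have hsplit : reciprocalExcess r₁ r₂ φ α β t - reciprocalExcess r₁ r₂ φ α β s
      = ∫ x in α..β, φ x * (max ((r₂ x t)⁻¹ - (r₁ x t)⁻¹) 0 - max ((r₂ x s)⁻¹ - (r₁ x s)⁻¹) 0) := by
    rw [reciprocalExcess, reciprocalExcess, ← intervalIntegral.integral_sub
      ((h₁.continuousOn_excess_space h₂ hφ hα htm).intervalIntegrable_of_Icc hαβ)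
      ((h₁.continuousOn_excess_space h₂ hφ hα hsm).intervalIntegrable_of_Icc hαβ)]
    simp only [mul_sub]
  rw [hsplit]
  refine intervalIntegral.tendsto_integral_filter_of_dominated_convergence
    (fun x => |φ x| * (M * |t - s|)) (Eventually.of_forall fun n => ?_)
    (Eventually.of_forall fun n => ?_) ?_ (Eventually.of_forall fun x hx => ?_)
  · have hc := continuousOn_integral_rectangle (α := s) (β := t) (σ₀ := α) (σ₁ := β)
      (f := fun σ x => φ x * (stepApprox (1 / ((n : ℝ) + 1)) (r₁ x σ - r₂ x σ)
        * (a * (r₁xx x σ - r₂xx x σ)))) (by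
        rw [uIcc_of_le hαβ, uIcc_of_le hst]
        exact ((h₁.continuousOn_kato_integrand h₂ hφ hα (hn n)).mono
          (prod_mono Subset.rfl hIcc)).comp continuous_swap.continuousOn
          fun p hp => ⟨hp.2, hp.1⟩)
    simp only [intervalIntegral.integral_const_mul] at hc
    exact (hc.mono uIoc_subset_uIcc).aestronglyMeasurable measurableSet_uIoc
  · refine Eventually.of_forall fun x hx => ?_
    have hx' : x ∈ Icc α β := by rw [← uIcc_of_le hαβ]; exact uIoc_subset_uIcc hx
    rw [norm_mul, Real.norm_eq_abs]
    refine mul_le_mul_of_nonneg_left ?_ (abs_nonneg _)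
    refine intervalIntegral.norm_integral_le_of_norm_le_const fun σ hσ => ?_
    have hσ' : σ ∈ Icc s t := by rw [← uIcc_of_le hst]; exact uIoc_subset_uIcc hσ
    rw [norm_mul, Real.norm_of_nonneg (stepApprox_nonneg (hn n) _)]
    exact (mul_le_of_le_one_left (norm_nonneg _) (stepApprox_le_one (hn n) _)).trans
      (hM (x, σ) ⟨hx', hσ'⟩)
  · exact (hφ.abs.mul continuousOn_const).intervalIntegrable_of_Icc hαβ
  · have hx' : x ∈ Icc α β := by rw [← uIcc_of_le hαβ]; exact uIoc_subset_uIcc hx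
    have hx0 : 0 < x := hα.trans_le hx'.1
    -- The multiplier is evaluated at `r₁ - r₂`, as Kato's inequality in `x` requires, while the
    -- time derivative is that of `1/r₂ - 1/r₁`. Both quantities are positive at the same points.
    refine Tendsto.const_mul _ (tendsto_integral_stepApprox_mul_deriv
      (N := fun σ => (r₂ x σ)⁻¹ - (r₁ x σ)⁻¹) (N' := fun σ => a * (r₁xx x σ - r₂xx x σ)) ?_ ?_ ?_ ?_)
    · rw [uIcc_of_le hst]
      exact ((h₁.continuousOn_time hx0.le).sub (h₂.continuousOn_time hx0.le)).mono
        (hIcc.trans Ioo_subset_Ico_self)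
    · rw [uIcc_of_le hst]
      exact fun σ hσ => h₁.hasDerivAt_inv_sub_inv h₂ hx0 (hIcc hσ)
    · rw [uIcc_of_le hst]
      exact hD.comp (f := fun σ => (x, σ)) (by fun_prop) fun σ hσ => ⟨hx', hσ⟩
    · rw [uIcc_of_le hst]
      intro σ hσ
      have p1 := h₁.pos x hx0 σ (Ioo_subset_Ico_self (hIcc hσ))
      have p2 := h₂.pos x hx0 σ (Ioo_subset_Ico_self (hIcc hσ))
      rw [sub_pos, sub_pos, inv_lt_inv₀ p1 p2]

/-- The regularized flux through a fixed time, bounded by boundary terms and by the excess. -/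
theorem flux_le (h₁ : IsFlow a S r₁ r₁x r₁xx) (h₂ : IsFlow a S r₂ r₂x r₂xx) {s η : ℝ}
    (hs : s ∈ Ioo 0 S) (hη : 0 < η) (hα : 0 < α) (hαβ : α ≤ β)
    (hC₁ : ∀ x > 0, r₁ x s ≤ C * x) (hC₂ : ∀ x > 0, r₂ x s ≤ C * x) {φ φ' : ℝ → ℝ}
    (hφ : ∀ x > 0, HasDerivAt φ (φ' x) x) (hφ' : ∀ x > 0, HasDerivAt φ' (2 * φ x / x ^ 2) x)
    (hφ0 : ∀ x ∈ Icc α β, 0 ≤ φ x) :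
    ∫ x in α..β, φ x * (stepApprox η (r₁ x s - r₂ x s) * (r₁xx x s - r₂xx x s)) ≤
      (φ β * (stepApprox η (r₁ β s - r₂ β s) * (r₁x β s - r₂x β s))
        - φ' β * posApprox η (r₁ β s - r₂ β s))
      - (φ α * (stepApprox η (r₁ α s - r₂ α s) * (r₁x α s - r₂x α s))
        - φ' α * posApprox η (r₁ α s - r₂ α s))
      + 2 * C ^ 2 * reciprocalExcess r₁ r₂ φ α β s := by
  have hs' := Ioo_subset_Ico_self hs
  have hpos : ∀ x ∈ Icc α β, 0 < x := fun x hx => hα.trans_le hx.1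
  have cφ : ContinuousOn φ (Icc α β) := fun x hx =>
    (hφ x (hpos x hx)).continuousAt.continuousWithinAt
  have cφ'' : ContinuousOn (fun x => 2 * φ x / x ^ 2) (Icc α β) :=
    (continuousOn_const.mul cφ).div (by fun_prop) fun x hx => (pow_pos (hpos x hx) 2).ne'
  have hxx : ContinuousOn (fun x => r₁xx x s - r₂xx x s) (Icc α β) :=
    (h₁.continuousOn_two.sub h₂.continuousOn_two).comp (f := fun x => (x, s)) (by fun_prop)
      fun x hx => ⟨hpos x hx, hs⟩
  have cf : ContinuousOn (fun x => r₁ x s - r₂ x s) (Icc α β) :=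
    ((h₁.continuousOn_space hs').sub (h₂.continuousOn_space hs')).mono
      fun x hx => (hpos x hx).le
  have key := integral_mul_stepApprox_le hη hαβ (f := fun x => r₁ x s - r₂ x s)
    (f' := fun x => r₁x x s - r₂x x s) (f'' := fun x => r₁xx x s - r₂xx x s)
    (φ := φ) (φ' := φ') (φ'' := fun x => 2 * φ x / x ^ 2)
    (fun x hx => (h₁.hasDerivAt x (hpos x hx) s hs).fun_sub (h₂.hasDerivAt x (hpos x hx) s hs))
    (fun x hx => (h₁.hasDerivAt_two x (hpos x hx) s hs).fun_sub
      (h₂.hasDerivAt_two x (hpos x hx) s hs)) hxx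
    (fun x hx => hφ x (hpos x hx)) (fun x hx => hφ' x (hpos x hx)) cφ'' hφ0
  refine key.trans (add_le_add_right ?_ _)
  rw [reciprocalExcess, ← intervalIntegral.integral_const_mul]
  refine intervalIntegral.integral_mono_on hαβ
    ((cφ''.mul ((continuous_posApprox hη).comp_continuousOn cf)).intervalIntegrable_of_Icc hαβ)
    ((continuousOn_const.mul (h₁.continuousOn_excess_space h₂ cφ hα hs')).intervalIntegrable_of_Icc
      hαβ) fun x hx => ?_
  have hx0 := hpos x hx
  have p1 := h₁.pos x hx0 s hs'
  have p2 := h₂.pos x hx0 s hs'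
  -- The factor `x²` from `r₁ r₂ ≤ C² x²` cancels against `φ'' = 2 φ / x²`.
  have e1 : r₁ x s * r₂ x s ≤ C ^ 2 * x ^ 2 := by
    have := mul_le_mul (hC₁ x hx0) (hC₂ x hx0) p2.le (p1.le.trans (hC₁ x hx0))
    linarith [this, (by ring : C * x * (C * x) = C ^ 2 * x ^ 2)]
  have e2 := (posApprox_le hη (r₁ x s - r₂ x s)).trans (max_sub_le_mul p1 p2 e1)
  have e3 := mul_le_mul_of_nonneg_left e2
    (div_nonneg (mul_nonneg zero_le_two (hφ0 x hx)) (sq_nonneg x) : 0 ≤ 2 * φ x / x ^ 2)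
  refine e3.trans (le_of_eq ?_)
  field_simp

/-- Two flows below a common linear function are ordered if their initial data are. -/
theorem le_of_initial_le (h₁ : IsFlow a S r₁ r₁x r₁xx) (h₂ : IsFlow a S r₂ r₂x r₂xx)
    (ha : 0 < a) (hC : 0 < C) (hC₁ : ∀ s ∈ Ico 0 S, ∀ x > 0, r₁ x s ≤ C * x)
    (hC₂ : ∀ s ∈ Ico 0 S, ∀ x > 0, r₂ x s ≤ C * x) (hinit : ∀ x > 0, r₁ x 0 ≤ r₂ x 0)
    {x₀ s₁ : ℝ} (hx₀ : 0 < x₀) (hs₁ : s₁ ∈ Ico 0 S) : r₁ x₀ s₁ ≤ r₂ x₀ s₁ := by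
  have hz : (0 : ℝ) ∈ Ico 0 S := ⟨le_rfl, hs₁.1.trans_lt hs₁.2⟩
  set JL : ℝ → ℝ → ℝ := fun X s => reciprocalExcess r₁ r₂ (innerWeight X) (1 / X) 1 s with hJL
  set JR : ℝ → ℝ → ℝ := fun X s => reciprocalExcess r₁ r₂ (outerWeight X) 1 X s with hJR
  set l := 2 * a * C ^ 2 with hl
  have hl0 : 0 < l := by positivity
  have cL : ∀ X : ℝ, 1 ≤ X → ContinuousOn (innerWeight X) (Icc (1 / X) 1) := fun X hX =>
    (continuousOn_innerWeight X).mono fun x hx =>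
      lt_of_lt_of_le (one_div_pos.2 (one_pos.trans_le hX)) hx.1
  have cR : ∀ X : ℝ, ContinuousOn (outerWeight X) (Icc 1 X) := fun X =>
    (continuousOn_outerWeight X).mono fun x hx => one_pos.trans_le hx.1
  have hinv : ∀ X : ℝ, 1 ≤ X → 0 < 1 / X ∧ 1 / X ≤ 1 := fun X hX =>
    ⟨one_div_pos.2 (one_pos.trans_le hX), by
      rw [div_le_one (one_pos.trans_le hX)]; exact hX⟩
  have hL0 : ∀ X : ℝ, 1 ≤ X → ∀ s, 0 ≤ JL X s := fun X hX s =>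
    intervalIntegral.integral_nonneg (hinv X hX).2 fun x hx =>
      mul_nonneg (innerWeight_nonneg (one_pos.trans_le hX) hx.1) (le_max_right _ _)
  have hR0 : ∀ X : ℝ, 1 ≤ X → ∀ s, 0 ≤ JR X s := fun X hX s =>
    intervalIntegral.integral_nonneg hX fun x hx =>
      mul_nonneg (outerWeight_nonneg (one_pos.trans_le hx.1) hx.2) (le_max_right _ _)
  have hzero : ∀ (φ : ℝ → ℝ) (α β : ℝ), 0 < α → α ≤ β → reciprocalExcess r₁ r₂ φ α β 0 = 0 := by
    intro φ α β hα hαβ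
    have : reciprocalExcess r₁ r₂ φ α β 0 = ∫ _ in α..β, (0 : ℝ) := by
      refine intervalIntegral.integral_congr fun x hx => ?_
      rw [uIcc_of_le hαβ] at hx
      have hx0 : 0 < x := hα.trans_le hx.1
      have : (r₂ x 0)⁻¹ ≤ (r₁ x 0)⁻¹ := inv_anti₀ (h₁.pos x hx0 0 hz) (hinit x hx0)
      simp only [max_eq_right (sub_nonpos.2 this), mul_zero]
    rw [this]; simp
  -- The weights vanish at `1 / X` and `X`, so no bound on `r_x` is needed there. At `1` they agree,
  -- so the terms with `r_x` cancel; the slope jumps downwards, so the remaining term there has the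
  -- favourable sign. Each outer end costs at most `3 a C / X`.
  have hflux : ∀ X : ℝ, 1 ≤ X → ∀ s ∈ Ioo 0 S, ∀ η > 0,
      (∫ x in (1 / X)..1, innerWeight X x * (stepApprox η (r₁ x s - r₂ x s)
          * (a * (r₁xx x s - r₂xx x s))))
        + (∫ x in (1 : ℝ)..X, outerWeight X x * (stepApprox η (r₁ x s - r₂ x s)
          * (a * (r₁xx x s - r₂xx x s))))
      ≤ 6 * a * C / X + l * (JL X s + JR X s) := by
    intro X hX s hs η hη
    have hX0 : 0 < X := one_pos.trans_le hX
    have hs' := Ioo_subset_Ico_self hs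
    have f1 := h₁.flux_le h₂ hs hη (hinv X hX).1 (hinv X hX).2 (hC₁ s hs') (hC₂ s hs')
      (fun x hx => hasDerivAt_innerWeight X hx) (fun x hx => hasDerivAt_innerWeight_two X hx)
      fun x hx => innerWeight_nonneg hX0 hx.1
    have f2 := h₁.flux_le h₂ hs hη one_pos hX (hC₁ s hs') (hC₂ s hs')
      (fun x hx => hasDerivAt_outerWeight X hx) (fun x hx => hasDerivAt_outerWeight_two X hx)
      fun x hx => outerWeight_nonneg (one_pos.trans_le hx.1) hx.2
    have w1 : innerWeight X (1 / X) = 0 := by rw [innerWeight]; field_simp; ring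
    have w2 : outerWeight X X = 0 := by rw [outerWeight]; field_simp; ring
    have w3 : innerWeight X 1 = outerWeight X 1 := by rw [innerWeight, outerWeight]; ring
    have w4 : 2 * (1 / X) + (X ^ 3)⁻¹ * ((1 / X) ^ 2)⁻¹ = 3 / X := by field_simp; ring
    have w5 : -(X ^ 2)⁻¹ - (X ^ 3)⁻¹ * (2 * X) = -(3 / X ^ 2) := by field_simp; ring
    rw [w1, w3, w4] at f1
    rw [w2, w5] at f2
    have b : ∀ x > 0, posApprox η (r₁ x s - r₂ x s) ≤ C * x := fun x hx => by
      have p1 := h₁.pos x hx s hs'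
      have p2 := h₂.pos x hx s hs'
      have p3 := hC₁ s hs' x hx
      exact (posApprox_le hη _).trans (max_le (by linarith) (by linarith))
    have b1 : 3 / X * posApprox η (r₁ (1 / X) s - r₂ (1 / X) s) ≤ 3 * C / X := by
      have e1 : C * (1 / X) ≤ C := mul_le_of_le_one_right hC.le (hinv X hX).2
      calc 3 / X * posApprox η (r₁ (1 / X) s - r₂ (1 / X) s) ≤ 3 / X * C :=
            mul_le_mul_of_nonneg_left ((b _ (hinv X hX).1).trans e1) (by positivity)
        _ = 3 * C / X := by ring
    have b2 : 3 / X ^ 2 * posApprox η (r₁ X s - r₂ X s) ≤ 3 * C / X := by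
      calc 3 / X ^ 2 * posApprox η (r₁ X s - r₂ X s) ≤ 3 / X ^ 2 * (C * X) :=
            mul_le_mul_of_nonneg_left (b X hX0) (by positivity)
        _ = 3 * C / X := by field_simp
    have b3 : 0 ≤ posApprox η (r₁ 1 s - r₂ 1 s) := posApprox_nonneg hη _
    have b4 : 0 ≤ (X ^ 3)⁻¹ * posApprox η (r₁ 1 s - r₂ 1 s) := by positivity
    have e1 : ∀ (φ : ℝ → ℝ) (α β : ℝ), ∫ x in α..β, φ x * (stepApprox η (r₁ x s - r₂ x s)
          * (a * (r₁xx x s - r₂xx x s))) = a * ∫ x in α..β, φ x *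
          (stepApprox η (r₁ x s - r₂ x s) * (r₁xx x s - r₂xx x s)) := fun φ α β => by
      rw [← intervalIntegral.integral_const_mul]
      congr 1
      ext x
      ring
    rw [e1, e1, ← mul_add]
    have e2 : 6 * a * C / X + l * (JL X s + JR X s)
        = a * (6 * C / X + 2 * C ^ 2 * (JL X s + JR X s)) := by rw [hl]; ring
    rw [e2]
    refine mul_le_mul_of_nonneg_left ?_ ha.le
    have e3 : 6 * C / X = 3 * C / X + 3 * C / X := by ring
    change _ ≤ _ + 2 * C ^ 2 * JL X s at f1
    change _ ≤ _ + 2 * C ^ 2 * JR X s at f2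
    simp only [one_pow, inv_one, mul_one] at f1 f2
    nlinarith
  have hJc : ∀ X : ℝ, 1 ≤ X → ContinuousOn (fun s => JL X s + JR X s) (Icc 0 s₁) := fun X hX =>
    (h₁.continuousOn_reciprocalExcess h₂ (cL X hX) (hinv X hX).1 (hinv X hX).2 hs₁).add
      (h₁.continuousOn_reciprocalExcess h₂ (cR X) one_pos hX hs₁)
  have hincr : ∀ X : ℝ, 1 ≤ X → ∀ s t : ℝ, 0 < s → s ≤ t → t ≤ s₁ →
      (JL X t + JR X t) - (JL X s + JR X s) ≤
        ∫ σ in s..t, (6 * a * C / X + l * (JL X σ + JR X σ)) := by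
    intro X hX s t hs hst ht
    have htS : t < S := ht.trans_lt hs₁.2
    have hX0 : 0 < X := one_pos.trans_le hX
    have hIcc : Icc s t ⊆ Ioo 0 S := fun σ hσ => ⟨hs.trans_le hσ.1, hσ.2.trans_lt htS⟩
    have t1 := h₁.tendsto_reciprocalExcess_sub h₂ (cL X hX) (hinv X hX).1 (hinv X hX).2 hs hst htS
    have t2 := h₁.tendsto_reciprocalExcess_sub h₂ (cR X) one_pos hX hs hst htS
    have hle := le_of_tendsto (t1.add t2)
      (b := ∫ σ in s..t, (6 * a * C / X + l * (JL X σ + JR X σ)))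
      (Eventually.of_forall fun n => ?_)
    · change (JL X t - JL X s) + (JR X t - JR X s) ≤ _ at hle
      linarith
    · have hn : (0 : ℝ) < 1 / ((n : ℝ) + 1) := by positivity
      have ii : ∀ (φ : ℝ → ℝ) (α β : ℝ), ContinuousOn φ (Icc α β) → 0 < α → α ≤ β →
          IntervalIntegrable (fun σ => ∫ x in α..β, φ x * (stepApprox (1 / ((n : ℝ) + 1))
            (r₁ x σ - r₂ x σ) * (a * (r₁xx x σ - r₂xx x σ)))) volume s t := by
        intro φ α β hφ hα hαβ
        refine (continuousOn_integral_rectangle (f := fun x σ => φ x *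
          (stepApprox (1 / ((n : ℝ) + 1)) (r₁ x σ - r₂ x σ)
            * (a * (r₁xx x σ - r₂xx x σ)))) ?_).intervalIntegrable
        rw [uIcc_of_le hαβ, uIcc_of_le hst]
        exact (h₁.continuousOn_kato_integrand h₂ hφ hα hn).mono (prod_mono Subset.rfl hIcc)
      have i1 := ii _ _ _ (cL X hX) (hinv X hX).1 (hinv X hX).2
      have i2 := ii _ _ _ (cR X) one_pos hX
      rw [← intervalIntegral.integral_add i1 i2]
      refine intervalIntegral.integral_mono_on hst (i1.add i2) ?_
        fun σ hσ => hflux X hX σ (hIcc hσ) _ hn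
      exact (continuousOn_const.add (continuousOn_const.mul ((hJc X hX).mono
        (Icc_subset_Icc hs.le ht)))).intervalIntegrable_of_Icc hst
  -- The increment estimate holds from positive times only; time `0` is reached because the excess
  -- is continuous and vanishes initially.
  have hint : ∀ X : ℝ, 1 ≤ X → ∀ t ∈ Icc 0 s₁,
      JL X t + JR X t ≤ ∫ σ in (0 : ℝ)..t, (6 * a * C / X + l * (JL X σ + JR X σ)) := by
    intro X hX t ht
    have hX0 : 0 < X := one_pos.trans_le hX
    have hJ00 : JL X 0 + JR X 0 = 0 := by
      simp only [hJL, hJR, hzero _ _ _ (hinv X hX).1 (hinv X hX).2, hzero _ _ _ one_pos hX,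
        add_zero]
    rcases eq_or_lt_of_le ht.1 with rfl | ht0
    · rw [hJ00, intervalIntegral.integral_same]
    have hcI : ContinuousOn (fun σ => 6 * a * C / X + l * (JL X σ + JR X σ)) (Icc 0 s₁) :=
      continuousOn_const.add (continuousOn_const.mul (hJc X hX))
    have hev : ∀ᶠ s in 𝓝[>] (0 : ℝ), JL X t + JR X t ≤ (JL X s + JR X s)
        + ∫ σ in (0 : ℝ)..t, (6 * a * C / X + l * (JL X σ + JR X σ)) := by
      filter_upwards [Ioo_mem_nhdsGT ht0] with s hs
      have e1 := hincr X hX s t hs.1 hs.2.le ht.2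
      have e2 := intervalIntegral.integral_add_adjacent_intervals (μ := volume)
        ((hcI.mono (Icc_subset_Icc_right (hs.2.le.trans ht.2))).intervalIntegrable_of_Icc hs.1.le)
        ((hcI.mono (Icc_subset_Icc hs.1.le ht.2)).intervalIntegrable_of_Icc hs.2.le)
      have e3 : 0 ≤ ∫ σ in (0 : ℝ)..s, (6 * a * C / X + l * (JL X σ + JR X σ)) :=
        intervalIntegral.integral_nonneg hs.1.le fun σ _ => by
          have := hL0 X hX σ
          have := hR0 X hX σ
          positivity
      linarith
    have hlim : Tendsto (fun s => JL X s + JR X s) (𝓝[>] 0) (𝓝 0) := by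
      have := (hJc X hX) 0 ⟨le_rfl, hs₁.1⟩
      rw [ContinuousWithinAt, hJ00] at this
      exact this.mono_left (nhdsWithin_le_of_mem (mem_of_superset
        (Ioo_mem_nhdsGT (ht0.trans_le ht.2)) Ioo_subset_Icc_self))
    have := ge_of_tendsto (hlim.add_const _) hev
    rwa [zero_add] at this
  have hbound : ∀ X : ℝ, 1 ≤ X →
      JL X s₁ + JR X s₁ ≤ 6 * a * C * Real.exp (l * s₁) / l * X⁻¹ := by
    intro X hX
    have hX0 : 0 < X := one_pos.trans_le hX
    have e1 := le_exp_of_le_integral hl0 (hJc X hX) (hint X hX) (s := s₁) ⟨hs₁.1, le_rfl⟩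
    have e2 : 0 ≤ 6 * a * C / X := by positivity
    have e3 : 6 * a * C * Real.exp (l * s₁) / l * X⁻¹ = 6 * a * C / X * Real.exp (l * s₁) / l := by
      field_simp
    rw [e3, le_div_iff₀ hl0]
    linarith
  have hlim : Tendsto (fun X : ℝ => 6 * a * C * Real.exp (l * s₁) / l * X⁻¹) atTop (𝓝 0) := by
    simpa using tendsto_inv_atTop_zero.const_mul (6 * a * C * Real.exp (l * s₁) / l)
  by_contra hlt
  push Not at hlt
  have hN : 0 < max ((r₂ x₀ s₁)⁻¹ - (r₁ x₀ s₁)⁻¹) 0 :=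
    lt_max_of_lt_left (sub_pos.2 (inv_strictAnti₀ (h₂.pos x₀ hx₀ s₁ hs₁) hlt))
  obtain ⟨X₀, hX1, hX2, hX3⟩ : ∃ X₀ : ℝ, 1 ≤ X₀ ∧ x₀ < X₀ ∧ 1 / X₀ < x₀ := by
    refine ⟨1 + x₀ + 1 / x₀, by linarith [one_div_pos.2 hx₀], by linarith [one_div_pos.2 hx₀], ?_⟩
    rw [div_lt_iff₀ (by positivity), mul_add, mul_one_div_cancel hx₀.ne']
    nlinarith
  have hX0 : 0 < X₀ := one_pos.trans_le hX1
  rcases le_total x₀ 1 with hx1 | hx1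
  · have hpos : 0 < JL X₀ s₁ := by
      refine intervalIntegral.integral_pos (lt_of_lt_of_le hX3 hx1)
        (h₁.continuousOn_excess_space h₂ (cL X₀ hX1) (hinv X₀ hX1).1 hs₁)
        (fun x hx => mul_nonneg (innerWeight_nonneg hX0 hx.1.le) (le_max_right _ _))
        ⟨x₀, ⟨hX3.le, hx1⟩, mul_pos (innerWeight_pos hX0 hX3) hN⟩
    have hle : ∀ X ≥ X₀, JL X₀ s₁ ≤ 6 * a * C * Real.exp (l * s₁) / l * X⁻¹ := by
      intro X hX
      have hX' : 1 ≤ X := hX1.trans hX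
      refine le_trans ?_ ((le_add_of_nonneg_right (hR0 X hX' s₁)).trans (hbound X hX'))
      have hsub : 1 / X ≤ 1 / X₀ := one_div_le_one_div_of_le hX0 hX
      have cX := h₁.continuousOn_excess_space h₂ (cL X hX') (hinv X hX').1 hs₁
      have e1 : JL X₀ s₁ ≤ reciprocalExcess r₁ r₂ (innerWeight X) (1 / X₀) 1 s₁ :=
        intervalIntegral.integral_mono_on (hinv X₀ hX1).2
          ((h₁.continuousOn_excess_space h₂ (cL X₀ hX1) (hinv X₀ hX1).1
            hs₁).intervalIntegrable_of_Icc (hinv X₀ hX1).2)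
          ((cX.mono (Icc_subset_Icc_left hsub)).intervalIntegrable_of_Icc (hinv X₀ hX1).2)
          fun x hx => mul_le_mul_of_nonneg_right
            (innerWeight_mono hX0 hX ((hinv X₀ hX1).1.trans_le hx.1)) (le_max_right _ _)
      refine e1.trans ?_
      have e2 := intervalIntegral.integral_add_adjacent_intervals (μ := volume)
        ((cX.mono (Icc_subset_Icc_right (hinv X₀ hX1).2)).intervalIntegrable_of_Icc hsub)
        ((cX.mono (Icc_subset_Icc_left hsub)).intervalIntegrable_of_Icc (hinv X₀ hX1).2)
      have e3 : 0 ≤ ∫ x in (1 / X)..(1 / X₀),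
          innerWeight X x * max ((r₂ x s₁)⁻¹ - (r₁ x s₁)⁻¹) 0 :=
        intervalIntegral.integral_nonneg hsub fun x hx =>
          mul_nonneg (innerWeight_nonneg (one_pos.trans_le hX') hx.1) (le_max_right _ _)
      change (∫ x in (1 / X₀)..1, _) ≤ ∫ x in (1 / X)..1, _
      linarith
    have := ge_of_tendsto hlim ((eventually_ge_atTop X₀).mono hle)
    linarith
  · have hpos : 0 < JR X₀ s₁ := by
      refine intervalIntegral.integral_pos (lt_of_le_of_lt hx1 hX2)
        (h₁.continuousOn_excess_space h₂ (cR X₀) one_pos hs₁)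
        (fun x hx => mul_nonneg (outerWeight_nonneg (one_pos.trans hx.1) hx.2) (le_max_right _ _))
        ⟨x₀, ⟨hx1, hX2.le⟩, mul_pos (outerWeight_pos hx₀ hX2) hN⟩
    have hle : ∀ X ≥ X₀, JR X₀ s₁ ≤ 6 * a * C * Real.exp (l * s₁) / l * X⁻¹ := by
      intro X hX
      have hX' : 1 ≤ X := hX1.trans hX
      refine le_trans ?_ ((le_add_of_nonneg_left (hL0 X hX' s₁)).trans (hbound X hX'))
      have cX := h₁.continuousOn_excess_space h₂ (cR X) one_pos hs₁
      have e1 : JR X₀ s₁ ≤ reciprocalExcess r₁ r₂ (outerWeight X) 1 X₀ s₁ :=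
        intervalIntegral.integral_mono_on hX1
          ((h₁.continuousOn_excess_space h₂ (cR X₀) one_pos hs₁).intervalIntegrable_of_Icc hX1)
          ((cX.mono (Icc_subset_Icc_right hX)).intervalIntegrable_of_Icc hX1)
          fun x hx => mul_le_mul_of_nonneg_right (outerWeight_mono hX0 hX) (le_max_right _ _)
      refine e1.trans ?_
      have e2 := intervalIntegral.integral_add_adjacent_intervals (μ := volume)
        ((cX.mono (Icc_subset_Icc_right hX)).intervalIntegrable_of_Icc hX1)
        ((cX.mono (Icc_subset_Icc_left hX1)).intervalIntegrable_of_Icc hX)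
      have e3 : 0 ≤ ∫ x in X₀..X, outerWeight X x * max ((r₂ x s₁)⁻¹ - (r₁ x s₁)⁻¹) 0 :=
        intervalIntegral.integral_nonneg hX fun x hx =>
          mul_nonneg (outerWeight_nonneg (hX0.trans_le hx.1) hx.2) (le_max_right _ _)
      change (∫ x in (1 : ℝ)..X₀, _) ≤ ∫ x in (1 : ℝ)..X, _
      linarith
    have := ge_of_tendsto hlim ((eventually_ge_atTop X₀).mono hle)
    linarith

end IsFlow

/-! ### Linear bounds on the risk tolerance of an admissible utility. -/

namespace IsUtility

variable {U : ℝ → ℝ} {x : ℝ}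

theorem differentiableAt (h : IsUtility U) (hx : 0 < x) : DifferentiableAt ℝ U x :=
  (h.smooth.differentiableOn (by simp)).differentiableAt (Ioi_mem_nhds hx)

theorem differentiableAt_deriv (h : IsUtility U) (hx : 0 < x) :
    DifferentiableAt ℝ (deriv U) x :=
  (((contDiffOn_infty_iff_deriv_of_isOpen isOpen_Ioi).1 h.smooth).2.differentiableOn
    (by simp)).differentiableAt (Ioi_mem_nhds hx)

theorem strictAntiOn_deriv (h : IsUtility U) : StrictAntiOn (deriv U) (Ioi 0) :=
  h.strictConcave.strictAntiOn_deriv fun _ hx => h.differentiableAt hx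

theorem deriv_pos (h : IsUtility U) (hx : 0 < x) : 0 < deriv U x := by
  have hx1 : x + 1 ∈ Ioi (0 : ℝ) := by simp only [mem_Ioi]; linarith
  refine lt_of_le_of_lt ?_ (h.strictAntiOn_deriv hx hx1 (lt_add_one x))
  exact le_of_tendsto h.inada_top ((eventually_ge_atTop (x + 1)).mono fun y hy =>
    h.strictAntiOn_deriv.antitoneOn hx1 (mem_Ioi.2 ((mem_Ioi.1 hx1).trans_le hy)) hy)

theorem inverseMarginal_deriv (h : IsUtility U) (hx : 0 < x) :
    inverseMarginal U (deriv U x) = x :=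
  h.strictAntiOn_deriv.injOn.leftInvOn_invFunOn hx

theorem deriv_inverseMarginal_mul (h : IsUtility U) (hx : 0 < x)
    (hd : DifferentiableAt ℝ (inverseMarginal U) (deriv U x)) :
    deriv (inverseMarginal U) (deriv U x) * iteratedDeriv 2 U x = 1 := by
  rw [iteratedDeriv_succ, iteratedDeriv_one]
  have h1 := hd.hasDerivAt.comp x (h.differentiableAt_deriv hx).hasDerivAt
  refine h1.unique ((hasDerivAt_id x).congr_of_eventuallyEq ?_)
  filter_upwards [Ioi_mem_nhds hx] with y hy
  exact h.inverseMarginal_deriv hy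

theorem iteratedDeriv_two_nonpos (h : IsUtility U) (hx : 0 < x) : iteratedDeriv 2 U x ≤ 0 := by
  rw [iteratedDeriv_succ, iteratedDeriv_one, ← derivWithin_of_isOpen isOpen_Ioi (mem_Ioi.2 hx)]
  exact h.strictAntiOn_deriv.antitoneOn.derivWithin_nonpos

end IsUtility

namespace IsAdmissibleUtility

/-- With `y = U'(x)`, inverting gives `x = I(y)` and `I'(y) = 1 / U''(x)`, so the risk tolerance is
`|y I'(y)|` and the bounds are those of `FirstDerivBound` at `y`. -/
theorem exists_linear_bounds {U : ℝ → ℝ} (h : IsAdmissibleUtility U) :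
    ∃ c C : ℝ, 0 < c ∧ 0 < C ∧
      ∀ x > 0, c * x ≤ riskTolerance U x ∧ riskTolerance U x ≤ C * x := by
  obtain ⟨c, C, hc, hC, hI⟩ := h.first
  refine ⟨c, C, hc, hC, fun x hx => ?_⟩
  have hu := h.isUtility
  have hy := hu.deriv_pos hx
  have hb := hI _ hy
  rw [hu.inverseMarginal_deriv hx] at hb
  -- Since `deriv` takes the value `0` at points of non-differentiability, excluding `0` also proves
  -- that `I` is differentiable at `y`.
  have hne : deriv (inverseMarginal U) (deriv U x) ≠ 0 := by
    intro h0
    rw [h0, mul_zero, abs_zero] at hb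
    exact (mul_pos hc hx).not_ge hb.1
  have h1 := hu.deriv_inverseMarginal_mul hx (differentiableAt_of_deriv_ne_zero hne)
  have hneg : iteratedDeriv 2 U x < 0 := (hu.iteratedDeriv_two_nonpos hx).lt_of_ne fun h0 => by
    rw [h0, mul_zero] at h1
    exact zero_ne_one h1
  have e : |deriv U x * deriv (inverseMarginal U) (deriv U x)| = riskTolerance U x := by
    rw [riskTolerance, if_pos hx, eq_one_div_of_mul_eq_one_left h1, mul_one_div, abs_div,
      abs_of_pos hy, abs_of_neg hneg, div_neg, neg_div]
  rwa [e] at hb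

end IsAdmissibleUtility

/-! ### Solutions of Black's equation as flows, and the conclusion. -/

/-- A solution of the linear equation `u' = k u` which is positive at the initial time
stays positive, even if the rate `k` is unbounded there. -/
theorem pos_of_hasDerivAt_mul {u k : ℝ → ℝ} {S s : ℝ} (hu : ContinuousOn u (Ico 0 S))
    (hk : ContinuousOn k (Ioo 0 S)) (hd : ∀ s ∈ Ioo 0 S, HasDerivAt u (k s * u s) s)
    (h0 : 0 < u 0) (hs : s ∈ Ico 0 S) : 0 < u s := by
  rcases hs.1.eq_or_lt with rfl | hs0
  · exact h0
  have hsub : Ioo 0 s ⊆ Ico 0 S := fun y hy => ⟨hy.1.le, hy.2.trans hs.2⟩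
  have hev : ∀ᶠ y in 𝓝[Ioo 0 s] 0, 0 < u y :=
    ((hu 0 ⟨le_rfl, hs0.trans hs.2⟩).mono hsub).eventually (lt_mem_nhds h0)
  have hnb : (𝓝[Ioo 0 s] (0 : ℝ)).NeBot := by
    rw [nhdsWithin_Ioo_eq_nhdsGT hs0]; infer_instance
  obtain ⟨δ, hδ, hδs⟩ := (hev.and self_mem_nhdsWithin).exists
  have hδS : Icc δ s ⊆ Ioo 0 S := fun y hy => ⟨hδs.1.trans_le hy.1, hy.2.trans_lt hs.2⟩
  obtain ⟨B, hB⟩ := isCompact_Icc.exists_bound_of_continuousOn (hk.mono hδS)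
  -- With `B` a bound for `|k|` away from time `0`, the square of `u` times `exp (2 B y)` is
  -- nondecreasing, so `u` cannot reach zero after `δ`.
  have hder : ∀ y ∈ Icc δ s, HasDerivAt (fun y => u y ^ 2 * Real.exp (2 * B * y))
      (2 * (u y ^ 2 * Real.exp (2 * B * y)) * (k y + B)) y := fun y hy => by
    have h1 := ((hd y (hδS hy)).fun_pow 2).fun_mul
      (((hasDerivAt_id y).const_mul (2 * B)).exp)
    refine h1.congr_deriv ?_
    simp only [id]
    push_cast
    ring
  have hmono : MonotoneOn (fun y => u y ^ 2 * Real.exp (2 * B * y)) (Icc δ s) := by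
    refine monotoneOn_of_deriv_nonneg (convex_Icc δ s)
      (fun y hy => (hder y hy).continuousAt.continuousWithinAt)
      (fun y hy => (hder y (interior_subset hy)).differentiableAt.differentiableWithinAt)
      fun y hy => ?_
    rw [(hder y (interior_subset hy)).deriv]
    have := (abs_le.1 (hB y (interior_subset hy))).1
    exact mul_nonneg (by positivity) (by linarith)
  by_contra! hneg
  obtain ⟨z, hz, hz0⟩ := intermediate_value_Icc' hδs.2.le
    (hu.mono (hδS.trans Ioo_subset_Ico_self)) ⟨hneg, hδ.le⟩
  have := hmono ⟨le_rfl, hδs.2.le⟩ hz hz.1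
  simp only [hz0] at this
  have h2 : 0 < u δ ^ 2 * Real.exp (2 * B * δ) := by positivity
  linarith

namespace IsBlackSolution

variable {N : ℕ} {lam : EuclideanSpace ℝ (Fin N)} {T : ℝ} {R : ℝ → ℝ} {r : ℝ → ℝ → ℝ}

theorem continuousOn_backward (h : IsBlackSolution lam T R r) :
    ContinuousOn (fun p : ℝ × ℝ => r p.1 (T - p.2)) (Ici 0 ×ˢ Ico 0 T) :=
  h.continuousOn.comp (f := fun p : ℝ × ℝ => (p.1, T - p.2)) (by fun_prop)
    fun p hp => ⟨hp.1, by have := hp.2.1; have := hp.2.2; constructor <;> linarith⟩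

theorem continuousOn_backward_two (h : IsBlackSolution lam T R r) :
    ContinuousOn (fun p : ℝ × ℝ => iteratedDeriv 2 (fun y => r y (T - p.2)) p.1)
      (Ioi 0 ×ˢ Ioo 0 T) :=
  h.continuousOn_space_deriv_two.comp (f := fun p : ℝ × ℝ => (p.1, T - p.2)) (by fun_prop)
    fun p hp => ⟨hp.1, by have := hp.2.1; have := hp.2.2; constructor <;> linarith⟩

theorem hasDerivAt_backward (h : IsBlackSolution lam T R r) {x s : ℝ} (hx : 0 < x)
    (hs : s ∈ Ioo 0 T) : HasDerivAt (fun σ => r x (T - σ))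
      (1 / 2 * ‖lam‖ ^ 2 * r x (T - s) ^ 2 * iteratedDeriv 2 (fun y => r y (T - s)) x) s := by
  have hs' : T - s ∈ Ioo 0 T := ⟨by linarith [hs.2], by linarith [hs.1]⟩
  have h1 := (h.differentiable_time x _ hx hs').hasDerivAt.comp s
    ((hasDerivAt_id s).const_sub T)
  refine h1.congr_deriv ?_
  linarith [h.equation x _ hx hs']

/-- Positivity is not part of the notion of solution. For fixed `x` the equation is linear in `r`
along time, with rate `a r r_xx`, so positivity is inherited from the terminal datum. -/
theorem backward_pos (h : IsBlackSolution lam T R r) (hR : ∀ x > 0, 0 < R x)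
    {x s : ℝ} (hx : 0 < x) (hs : s ∈ Ico 0 T) : 0 < r x (T - s) := by
  have hline : ContinuousOn (fun s => r x (T - s)) (Ico 0 T) :=
    h.continuousOn_backward.comp (f := fun s => (x, s)) (by fun_prop) fun s hs => ⟨hx.le, hs⟩
  have hline2 : ContinuousOn (fun s => iteratedDeriv 2 (fun y => r y (T - s)) x) (Ioo 0 T) :=
    h.continuousOn_backward_two.comp (f := fun s => (x, s)) (by fun_prop) fun s hs => ⟨hx, hs⟩
  refine pos_of_hasDerivAt_mul (u := fun s => r x (T - s))
    (k := fun s => 1 / 2 * ‖lam‖ ^ 2 * r x (T - s) * iteratedDeriv 2 (fun y => r y (T - s)) x)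
    hline ((continuousOn_const.mul (hline.mono Ioo_subset_Ico_self)).mul hline2)
    (fun s hs => (h.hasDerivAt_backward hx hs).congr_deriv (by ring)) ?_ hs
  simp only [sub_zero, h.terminal x hx.le, hR x hx]

theorem isFlow (h : IsBlackSolution lam T R r) (hR : ∀ x > 0, 0 < R x) :
    IsFlow (1 / 2 * ‖lam‖ ^ 2) T (fun x s => r x (T - s))
      (fun x s => deriv (fun y => r y (T - s)) x)
      (fun x s => iteratedDeriv 2 (fun y => r y (T - s)) x) where
  continuousOn := h.continuousOn_backward
  zero s hs := h.boundary _ ⟨by linarith [hs.2], by linarith [hs.1]⟩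
  pos x hx s hs := h.backward_pos hR hx hs
  hasDerivAt x hx s hs :=
    (((h.contDiff_space (T - s) ⟨by linarith [hs.2], by linarith [hs.1]⟩).differentiableOn
      two_ne_zero).differentiableAt (Ioi_mem_nhds hx)).hasDerivAt
  hasDerivAt_two x hx s hs := by
    have h2 := h.contDiff_space (T - s) ⟨by linarith [hs.2], by linarith [hs.1]⟩
    rw [iteratedDeriv_succ, iteratedDeriv_one]
    rw [show (2 : WithTop ℕ∞) = 1 + 1 from one_add_one_eq_two.symm,
      contDiffOn_succ_iff_deriv_of_isOpen isOpen_Ioi] at h2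
    exact ((h2.2.2.differentiableOn one_ne_zero).differentiableAt (Ioi_mem_nhds hx)).hasDerivAt
  hasDerivAt_time x hx s hs := h.hasDerivAt_backward hx hs
  continuousOn_two := h.continuousOn_backward_two

theorem continuousOn_terminal (h : IsBlackSolution lam T R r) (hT : 0 < T) :
    ContinuousOn R (Ici 0) := by
  have h1 : ContinuousOn (fun x => r x T) (Ici 0) :=
    h.continuousOn.comp (f := fun x => (x, T)) (by fun_prop)
      fun x hx => ⟨hx, hT.le, le_rfl⟩
  exact h1.congr fun x hx => (h.terminal x hx).symm

theorem continuousOn_time (h : IsBlackSolution lam T R r) {x : ℝ} (hx : 0 ≤ x) :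
    ContinuousOn (fun t => r x t) (Icc 0 T) :=
  h.continuousOn.comp (f := fun t => (x, t)) (by fun_prop) fun t ht => ⟨hx, ht⟩

/-- For `lam = 0` the equation reads `r_t = 0`. The flow arguments need `a > 0`, so this case is
treated separately. -/
theorem eq_terminal_of_eq_zero (h : IsBlackSolution lam T R r) (hlam : lam = 0) {x t : ℝ}
    (hx : 0 < x) (ht : t ∈ Icc 0 T) : r x t = R x := by
  have hd : ∀ τ ∈ Ioo 0 T, HasDerivAt (fun τ => r x τ) 0 τ := fun τ hτ =>
    (h.differentiable_time x τ hx hτ).hasDerivAt.congr_deriv (by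
      have := h.equation x τ hx hτ
      simpa [hlam] using this)
  rw [← h.terminal x hx.le]
  rcases ht.2.eq_or_lt with rfl | htT
  · rfl
  obtain ⟨τ, hτ, e⟩ := exists_hasDerivAt_eq_slope (fun τ => r x τ) (fun _ => 0) htT
    ((h.continuousOn_time hx.le).mono (Icc_subset_Icc_left ht.1))
    fun τ hτ => hd τ ⟨ht.1.trans_lt hτ.1, hτ.2⟩
  have hne : T - t ≠ 0 := (sub_pos.2 htT).ne'
  rw [eq_comm, div_eq_zero_iff, or_iff_left hne, sub_eq_zero] at e
  exact e.symm

/-- Comparison for Black's equation with ordered terminal data of linear growth. -/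
theorem le_of_terminal_le {R₁ R₂ : ℝ → ℝ} {r₁ r₂ : ℝ → ℝ → ℝ} {c₁ C₁ c₂ C₂ : ℝ}
    (h₁ : IsBlackSolution lam T R₁ r₁) (h₂ : IsBlackSolution lam T R₂ r₂) (hT : 0 < T)
    (hc₁ : 0 < c₁) (hc₂ : 0 < c₂) (hC₁ : 0 < C₁)
    (hR₁ : ∀ x > 0, c₁ * x ≤ R₁ x ∧ R₁ x ≤ C₁ * x)
    (hR₂ : ∀ x > 0, c₂ * x ≤ R₂ x ∧ R₂ x ≤ C₂ * x)
    (hR : ∀ x ≥ 0, R₁ x ≤ R₂ x) {x t : ℝ} (hx : 0 ≤ x) (ht : t ∈ Icc 0 T) :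
    r₁ x t ≤ r₂ x t := by
  rcases hx.eq_or_lt with rfl | hx
  · rw [h₁.boundary t ht, h₂.boundary t ht]
  rcases eq_or_ne lam 0 with hlam | hlam
  · rw [h₁.eq_terminal_of_eq_zero hlam hx ht, h₂.eq_terminal_of_eq_zero hlam hx ht]
    exact hR x hx.le
  have ha : 0 < 1 / 2 * ‖lam‖ ^ 2 := by
    have := norm_pos_iff.2 hlam
    positivity
  have f₁ := h₁.isFlow fun y hy => (mul_pos hc₁ hy).trans_le (hR₁ y hy).1
  have f₂ := h₂.isFlow fun y hy => (mul_pos hc₂ hy).trans_le (hR₂ y hy).1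
  have bounds : ∀ {R : ℝ → ℝ} {r : ℝ → ℝ → ℝ} {c C : ℝ}, IsBlackSolution lam T R r → 0 < c →
      (∀ x > 0, c * x ≤ R x ∧ R x ≤ C * x) → LinearBounds c C (fun y => r y (T - 0)) := by
    intro R r c C h hc hb
    have e : ∀ y ∈ Ioi (0 : ℝ), r y (T - 0) = R y := fun y hy => by
      rw [sub_zero, h.terminal y (le_of_lt hy)]
    exact ⟨hc, ((h.continuousOn_terminal hT).mono Ioi_subset_Ici_self).congr e,
      fun y hy => (e y hy).symm ▸ (hb y hy).1, fun y hy => (e y hy).symm ▸ (hb y hy).2⟩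
  -- The reversed flow lives on `[0, T)`, which leaves out `t = 0`; that time is recovered
  -- afterwards by continuity.
  have key : ∀ τ ∈ Ioc 0 T, r₁ x τ ≤ r₂ x τ := by
    intro τ hτ
    have := f₁.le_of_initial_le f₂ ha (lt_max_of_lt_left hC₁ : 0 < max C₁ C₂)
      (fun s hs y hy => ((f₁.linearBounds (bounds h₁ hc₁ hR₁) ha hs).upper y hy).trans
        (mul_le_mul_of_nonneg_right (le_max_left _ _) (le_of_lt hy)))
      (fun s hs y hy => ((f₂.linearBounds (bounds h₂ hc₂ hR₂) ha hs).upper y hy).trans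
        (mul_le_mul_of_nonneg_right (le_max_right _ _) (le_of_lt hy)))
      (fun y hy => by
        rw [sub_zero, h₁.terminal y (le_of_lt hy), h₂.terminal y (le_of_lt hy)]
        exact hR y (le_of_lt hy))
      hx (s₁ := T - τ) ⟨by linarith [hτ.2], by linarith [hτ.1]⟩
    simpa using this
  rcases ht.1.eq_or_lt with rfl | ht0
  · have hcl : (0 : ℝ) ∈ closure (Ioc 0 T) := by
      rw [closure_Ioc hT.ne]; exact ⟨le_rfl, hT.le⟩
    exact ContinuousWithinAt.closure_le hcl
      ((h₁.continuousOn_time hx.le 0 ht).mono Ioc_subset_Icc_self)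
      ((h₂.continuousOn_time hx.le 0 ht).mono Ioc_subset_Icc_self) key
  · exact key t ⟨ht0, ht.2⟩

end IsBlackSolution

theorem proposition5 {N : ℕ} (lam : EuclideanSpace ℝ (Fin N)) (T : ℝ) (hT : 0 < T) :
    (∀ U₁ U₂ : ℝ → ℝ, IsAdmissibleUtility U₁ → IsAdmissibleUtility U₂ →
      (∀ x : ℝ, 0 ≤ x → riskTolerance U₁ x ≤ riskTolerance U₂ x) →
      ∀ r₁ r₂ : ℝ → ℝ → ℝ,
        IsBlackSolution lam T (riskTolerance U₁) r₁ →
        IsBlackSolution lam T (riskTolerance U₂) r₂ →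
        ∀ x t : ℝ, 0 ≤ x → t ∈ Set.Icc 0 T → r₁ x t ≤ r₂ x t) ∧
    (∀ U : ℝ → ℝ, IsAdmissibleUtility U →
      ∀ r r' : ℝ → ℝ → ℝ,
        IsBlackSolution lam T (riskTolerance U) r →
        IsBlackSolution lam T (riskTolerance U) r' →
        ∀ x t : ℝ, 0 ≤ x → t ∈ Set.Icc 0 T → r x t = r' x t) := by
  refine ⟨fun U₁ U₂ hU₁ hU₂ hR r₁ r₂ h₁ h₂ x t hx ht => ?_,
    fun U hU r r' h h' x t hx ht => ?_⟩
  · obtain ⟨c₁, C₁, hc₁, hC₁, hb₁⟩ := hU₁.exists_linear_bounds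
    obtain ⟨c₂, C₂, hc₂, -, hb₂⟩ := hU₂.exists_linear_bounds
    exact h₁.le_of_terminal_le h₂ hT hc₁ hc₂ hC₁ hb₁ hb₂ hR hx ht
  · obtain ⟨c, C, hc, hC, hb⟩ := hU.exists_linear_bounds
    exact le_antisymm (h.le_of_terminal_le h' hT hc hc hC hb hb (fun _ _ => le_rfl) hx ht)
      (h'.le_of_terminal_le h hT hc hc hC hb hb (fun _ _ => le_rfl) hx ht)
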